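/- **Proposition (Type B Γ-triangle).** Let $\Phi$ be a root system of type $\mathbb{B}_n$ with simple roots $\alpha_i$ ($i\in I$, $|I|=n$), let $c$ be a Coxeter element of its Weyl group, and let $\Delta$ be the associated cluster complex: its vertices are the almost positive roots (the positive roots and the negative simple roots), and its faces are the sets of pairwise $c$-compatible almost positive roots. Let $F(x,y)=\sum_{i,j}F_{i,j}x^iy^j$, where $F_{i,j}$ is the number of faces of $\Delta$ with $i$ elements that are positive roots and $j$ elements that are negative simple roots, and let $$H(x,y)=(1-x)^n\,F\!\left(\frac{x}{1-x},\frac{xy}{1-x}\right).$$ The $\Gamma$-triangle of $\Delta$ is the family of integers $(\gamma_{k,\ell})_{k,\ell\ge 0,\ \ell+2k\le n}$ such that $$H(x,y)=\sum_{k,\ell}\gamma_{k,\ell}\,x^k(1+xy)^\ell(1+x)^{n-2k-\ell};$$ such a family exists and is unique. For all $k,\ell\ge 0$ with $\ell+2k\le n$, $$\gamma_{k,\ell}=\binom{n}{k}\binom{n-k-\ell-1}{k-1},$$ where, here and below, $\binom{-1}{-1}=1$ and $\binom{a}{-1}=0$ for $a\ge 0$. Moreover, consider the formal power series (all sums over non-negative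 integers) $$g_{\mathbb A}=\sum_{m,k}\frac{1}{k+m+1}\binom{2k+m}{k}\binom{k+m-1}{k-1}x^kt^{2k+m},\qquad G_{\mathbb A}=\sum_{m,k,\ell}\frac{\ell+1}{\ell+k+m+1}\binom{\ell+2k+m}{k}\binom{k+m-1}{k-1}x^ky^\ell t^{2k+m+\ell},$$ $$g_{\mathbb B}=\sum_{m,k}\binom{2k+m}{k}\binom{k+m-1}{k-1}x^kt^{2k+m},\qquad G_{\mathbb B}=\sum_{m,k,\ell}\binom{2k+\ell+m}{k}\binom{k+m-1}{k-1}x^ky^\ell t^{2k+\ell+m}.$$ Then $$G_{\mathbb B}=g_{\mathbb B}+yt\,g_{\mathbb A}\,G_{\mathbb B}=g_{\mathbb B}+yt\,g_{\mathbb B}\,G_{\mathbb A}.$$ -/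

import Mathlib

open Polynomial
open scoped Polynomial.Bivariate

noncomputable section

/-! ### Triangles of a simplicial complex with a distinguished facet

A finite simplicial complex on the vertex type `V` (a collection of subsets closed under taking
subsets, the empty face included) is a `LowerSet (Finset V)`. -/

section Triangles

variable {V : Type*} [DecidableEq V]

/-- The entry `F_{i,j}` of the `F`-triangle of `(Δ, T)`: the number of faces of `C` made of
`i` vertices not in `T` and `j` vertices in `T`. -/
def fTriangle (Δ : LowerSet (Finset V)) (T : Finset V) (i j : ℕ) : ℕ :=
  {f : Finset V | f ∈ Δ ∧ (f \ T).card = i ∧ (f ∩ T).card = j}.ncard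

/-- The `H`-triangle `H(x,y) = (1-x)^d F(x/(1-x), xy/(1-x))` of a pure complex `Δ` of dimension
`d - 1` with distinguished facet `T`, where `d = |T|`. Denominators are cleared: the
term `F_{i,j} x^i y^j` of `F` contributes `F_{i,j} x^i (x y)^j (1-x)^(d-(i+j))`
(and `i + j ≤ d` for every face). The outer variable `Y` is `y`, the inner one is `x`. -/
def hTriangle (Δ : LowerSet (Finset V)) (T : Finset V) : ℤ[X][Y] :=
  ∑ i ∈ Finset.range (T.card + 1), ∑ j ∈ Finset.range (T.card + 1),
    (fTriangle Δ T i j : ℤ[X][Y]) * (C X) ^ i * (C X * Y) ^ j * (1 - C X) ^ (T.card - (i + j))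

/-- `γ` is the `Γ`-triangle of `(Δ, T)`, where `d = |T|`: it is supported on
`{(i,j) | j + 2 i ≤ d}` and `H(x,y) = ∑ γ_{i,j} x^i (1 + x y)^j (1 + x)^(d - 2i - j)`. -/
def IsGammaTriangle (Δ : LowerSet (Finset V)) (T : Finset V) (γ : ℕ → ℕ → ℤ) : Prop :=
  (∀ i j, T.card < j + 2 * i → γ i j = 0) ∧
  hTriangle Δ T =
    ∑ i ∈ Finset.range (T.card + 1), ∑ j ∈ Finset.range (T.card + 1),
      if j + 2 * i ≤ T.card then
        (γ i j : ℤ[X][Y]) * (C X) ^ i * (1 + C X * Y) ^ j * (1 + C X) ^ (T.card - 2 * i - j)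
      else 0

end Triangles

/-! ### Cluster complexes

`P` is a root system with base `b`; roots are referred to by their indices in `ι`. -/

namespace RootPairing.Base

variable {ι K M N : Type*} [Field K] [CharZero K] [AddCommGroup M] [Module K M]
  [AddCommGroup N] [Module K N] {P : RootPairing ι K M N} (b : P.Base)

/-- The coefficient `[β : α_s]` of the simple root `s` in the root `β`. -/
def simpleCoeff (β : ι) (s : b.support) : ℤ :=
  b.toWeightBasisInt.repr (P.rootSpanMem ℤ β) s

/-- `β` is the negative of a simple root (`P.reflectionPerm β β` is the index of `-β`). -/
def IsNegSimple (β : ι) : Prop :=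
  P.reflectionPerm β β ∈ b.support

/-- Almost positive roots: the positive roots and the negatives of the simple roots. -/
def IsAlmostPos (β : ι) : Prop :=
  b.IsPos β ∨ b.IsNegSimple β

open Classical in
/-- The piecewise linear reflection `σ_s` in a simple root `s`: it fixes the negative simple roots
other than `-α_s`, and is the reflection in `α_s` on all other almost positive roots. -/
def plReflection (s β : ι) : ι :=
  if b.IsNegSimple β ∧ P.reflectionPerm β β ≠ s then β else P.reflectionPerm s β

/-- The word `c` lists every simple root exactly once, so that the product of the
reflections in its letters is a Coxeter element. Every Coxeter element (relative to `b`) has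
such a word. -/
def IsCoxeterWord (c : List ι) : Prop :=
  c.Nodup ∧ ∀ s, s ∈ c ↔ s ∈ b.support

/-- The deformed Coxeter element `τ_c` on almost positive roots: apply `σ_s` for the successive
letters `s` of `c`. -/
def deformedCoxeter (c : List ι) (β : ι) : ι :=
  c.foldl (fun β' s => b.plReflection s β') β

/-- `c`-compatibility of almost positive roots, that is vanishing of the compatibility degree
`(α ‖ β)_c`. The degree is determined by `(-α_s ‖ β)_c = max [β : α_s] 0` and by invariance under
`τ_c`, since every orbit of `τ_c` contains a negative simple root. For bipartite `c` this is the
compatibility of Fomin and Zelevinsky. -/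
def Compatible (c : List ι) (α β : ι) : Prop :=
  ∀ (m : ℕ) (s : b.support),
    P.root ((b.deformedCoxeter c)^[m] α) = -P.root s →
      b.simpleCoeff ((b.deformedCoxeter c)^[m] β) s ≤ 0

/-- The cluster complex: its faces are the sets of pairwise compatible almost positive roots. -/
def clusterComplex (c : List ι) : LowerSet (Finset ι) where
  carrier := {f | (∀ β ∈ f, b.IsAlmostPos β) ∧
    ∀ α ∈ f, ∀ β ∈ f, α ≠ β → b.Compatible c α β}
  lower' := fun _ _ hgf hf =>
    ⟨fun β hβ => hf.1 β (hgf hβ), fun α hα β hβ => hf.2 α (hgf hα) β (hgf hβ)⟩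

/-- The distinguished facet of the cluster complex: the set of negative simple roots. -/
def negSimples [DecidableEq ι] : Finset ι :=
  b.support.image fun s => P.reflectionPerm s s

/-- The base `b` is of type `B_n`: for a suitable numbering of the simple roots its
Cartan matrix is that of type `B_n`. -/
def IsTypeB [P.IsCrystallographic] (n : ℕ) : Prop :=
  ∃ e : Fin n ≃ b.support, ∀ i j, b.cartanMatrix (e i) (e j) = CartanMatrix.B n i j

end RootPairing.Base

/-! ### Coefficients and generating series -/

/-- `binom(a - 1, b - 1)` for natural numbers `a` and `b`, with the usual conventions
`binom(-1, -1) = 1` and `binom(a - 1, -1) = 0` for `a ≥ 1`. -/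
def choosePred : ℕ → ℕ → ℕ
  | 0, 0 => 1
  | _ + 1, 0 => 0
  | 0, _ + 1 => 0
  | a + 1, b + 1 => a.choose b

/-- The series `∑ a k ℓ m x^k y^ℓ t^(2k+ℓ+m)` over all `k, ℓ, m ≥ 0`, as a power series in `t` over
`ℚ[x][y]`. -/
def triangleSeries (a : ℕ → ℕ → ℕ → ℚ) : PowerSeries ℚ[X][Y] :=
  PowerSeries.mk fun n =>
    ∑ k ∈ Finset.range (n + 1), ∑ l ∈ Finset.range (n + 1),
      if 2 * k + l ≤ n then C (C (a k l (n - 2 * k - l))) * (C X) ^ k * Y ^ l else 0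

/-- `g_A = ∑ 1/(k+m+1) binom(2k+m, k) binom(k+m-1, k-1) x^k t^(2k+m)`. -/
def smallSeriesA : PowerSeries ℚ[X][Y] :=
  triangleSeries fun k l m =>
    if l = 0 then 1 / ((k : ℚ) + m + 1) * (2 * k + m).choose k * choosePred (k + m) k else 0

/-- `G_A = ∑ (ℓ+1)/(ℓ+k+m+1) binom(ℓ+2k+m, k) binom(k+m-1, k-1) x^k y^ℓ t^(2k+m+ℓ)`. -/
def bigSeriesA : PowerSeries ℚ[X][Y] :=
  triangleSeries fun k l m =>
    ((l : ℚ) + 1) / ((l : ℚ) + k + m + 1) * (l + 2 * k + m).choose k * choosePred (k + m) k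

/-- `g_B = ∑ binom(2k+m, k) binom(k+m-1, k-1) x^k t^(2k+m)`. -/
def smallSeriesB : PowerSeries ℚ[X][Y] :=
  triangleSeries fun k l m =>
    if l = 0 then ((2 * k + m).choose k : ℚ) * choosePred (k + m) k else 0

/-- `G_B = ∑ binom(2k+ℓ+m, k) binom(k+m-1, k-1) x^k y^ℓ t^(2k+ℓ+m)`. -/
def bigSeriesB : PowerSeries ℚ[X][Y] :=
  triangleSeries fun k l m =>
    ((2 * k + l + m).choose k : ℚ) * choosePred (k + m) k

end

/-! The Γ-triangle follows from a closed form for the F-triangle: in type B_n, F_{i,j} = binom(n,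
i+j) binom(n+i-1, i). It is proved together with its type A_N analogue (l+1)/(k+l+1) binom(N, k+l)
binom(N+k, k), because both types occur on segments of the Dynkin diagram of type B_n. Two relations
determine the face numbers.

The first is a recursion. A face with a negative simple root is cut at the first such root α_i: the
rest is a face of type A without negative simple roots on the left segment, and an arbitrary face of
the same type as the whole on the right segment (`faceCount_succ`).

The second gives the faces of positive roots only. The piecewise linear Coxeter element τ permutes
the faces, so the number of m-element faces containing a root v is τ-invariant. Averaging over
orbits gives 2 ∑_v φ(v) = (h+2) ∑_i φ(-α_i) for every τ-invariant φ, with h the Coxeter number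
(`two_mul_sum_almostPos`). Counting incidences then yields a linear relation among the F_{k,l} with
k+l = m, which expresses F_{m,0} through the others.

Invariance of compatibility is obtained from a non-symmetric Euler form E attached to c, with E(cv,
u) = -E(u, v) (`euler_cox`). Positive roots are compatible exactly when E is nonnegative on them in
both orders, and this criterion is checked to be τ-invariant (`rel_plCox_plCox`). The closed forms
satisfy the same two relations, by Lagrange inversion for T = t(1+T)/(1-xT) and by hockey-stick
sums.

From F to Γ, both sides of the defining identity are coefficients of T^n in explicit series,
exchanged by the substitution T = U/(1-U) (`sum_fEntry_eq_sum_gammaEntry`); uniqueness is a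
triangularity argument.

The series identities are independent of root systems. With T = t(1 + xT²/(1-T)), Lagrange inversion
gives g_A = T/t and g_B = tT'/T, and summing over ℓ gives G_A = g_A/(1 - y t g_A) and G_B = g_B/(1 -
y t g_A). -/

noncomputable section

/-! ### Lagrange inversion in terms of coefficients -/

section Lagrange

variable {R : Type*} [CommRing R]

/-- The factor `1 - T φ'(T) / φ(T)` of Lagrange inversion, where `ψ = 1 / φ`. -/
def lagrangeFactor (φ ψ : PowerSeries R) : PowerSeries R :=
  1 - PowerSeries.X * PowerSeries.derivative R φ * ψ

/-- The coefficient of `t ^ n` in `H(T(t))`, where `T = t φ(T)` and `ψ = 1 / φ`. -/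
def lagrangeCoeff (φ ψ H : PowerSeries R) (n : ℕ) : R :=
  PowerSeries.coeff n (H * φ ^ n * lagrangeFactor φ ψ)

/-- The inverse of the factor `1 - T φ'(T) / φ(T)`. -/
def lagrangeFactorInv (φ ψ : PowerSeries R) : PowerSeries R :=
  PowerSeries.invOfUnit (lagrangeFactor φ ψ) 1

lemma lagrangeFactor_mul_inv (φ ψ : PowerSeries R) :
    lagrangeFactor φ ψ * lagrangeFactorInv φ ψ = 1 :=
  PowerSeries.mul_invOfUnit _ _ (by simp [lagrangeFactor])

variable {φ ψ : PowerSeries R}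

lemma lagrangeCoeff_zero (H : PowerSeries R) :
    lagrangeCoeff φ ψ H 0 = PowerSeries.constantCoeff H := by
  simp [lagrangeCoeff, lagrangeFactor]

lemma lagrangeCoeff_add (H K : PowerSeries R) (n : ℕ) :
    lagrangeCoeff φ ψ (H + K) n = lagrangeCoeff φ ψ H n + lagrangeCoeff φ ψ K n := by
  simp [lagrangeCoeff, add_mul]

lemma lagrangeCoeff_C_mul (a : R) (H : PowerSeries R) (n : ℕ) :
    lagrangeCoeff φ ψ (PowerSeries.C a * H) n = a * lagrangeCoeff φ ψ H n := by
  simp [lagrangeCoeff, mul_assoc]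

/-- The series T/φ(T) is t itself, so multiplying by it shifts the coefficients by one. -/
lemma lagrangeCoeff_X_mul (h : φ * ψ = 1) (H : PowerSeries R) (n : ℕ) :
    lagrangeCoeff φ ψ (PowerSeries.X * ψ * H) (n + 1) = lagrangeCoeff φ ψ H n := by
  have : PowerSeries.X * ψ * H * φ ^ (n + 1) * lagrangeFactor φ ψ
      = PowerSeries.X * (H * φ ^ n * lagrangeFactor φ ψ) := by
    linear_combination (PowerSeries.X * H * φ ^ n * lagrangeFactor φ ψ) * h
  rw [lagrangeCoeff, this, PowerSeries.coeff_succ_X_mul, lagrangeCoeff]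

/-- The inverse factor stands for tT'/T; it cancels the Lagrange factor and leaves a bare
coefficient of a power of φ. -/
lemma lagrangeCoeff_mul_inv (s n : ℕ) :
    lagrangeCoeff φ ψ (φ ^ s * lagrangeFactorInv φ ψ) n = PowerSeries.coeff n (φ ^ (n + s)) := by
  rw [lagrangeCoeff]
  congr 1
  linear_combination (φ ^ s * φ ^ n) * lagrangeFactor_mul_inv φ ψ

/-- The classical Lagrange formula for powers of φ(T) = T/t, with the denominator cleared so that no
division in `R` is needed. -/
lemma lagrangeCoeff_pow_succ (h : φ * ψ = 1) (r n : ℕ) :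
    ((n : R) + r + 1) * lagrangeCoeff φ ψ (φ ^ (r + 1)) n
      = (r + 1) * PowerSeries.coeff n (φ ^ (n + r + 1)) := by
  have hd : PowerSeries.derivative R (φ ^ (n + r + 1))
      = ((n + r + 1 : ℕ) : PowerSeries R) * φ ^ (n + r) * PowerSeries.derivative R φ := by
    rw [Derivation.leibniz_pow]
    simp [mul_assoc]
  have h1 : φ ^ (r + 1) * φ ^ n * lagrangeFactor φ ψ = φ ^ (n + r + 1)
      - PowerSeries.X * (φ ^ (n + r) * PowerSeries.derivative R φ) := by
    rw [lagrangeFactor]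
    linear_combination (-(φ ^ (n + r)) * PowerSeries.X * PowerSeries.derivative R φ) * h
  have h2 : ((n : R) + r + 1) * PowerSeries.coeff n
      (PowerSeries.X * (φ ^ (n + r) * PowerSeries.derivative R φ))
      = n * PowerSeries.coeff n (φ ^ (n + r + 1)) := by
    cases n with
    | zero => simp
    | succ m =>
      rw [PowerSeries.coeff_succ_X_mul]
      have := congrArg (PowerSeries.coeff m) hd
      rw [PowerSeries.coeff_derivative, mul_assoc, ← map_natCast (PowerSeries.C (R := R)),
        PowerSeries.coeff_C_mul] at this
      push_cast at this ⊢
      rw [← this]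
      ring
  rw [lagrangeCoeff, h1, map_sub, mul_sub, h2]
  ring

variable [IsDomain R] [CharZero R]

/-- Comparing coefficients of T^n in (φ^(n+1))' = (n+1) φ^n φ' shows that the two terms cancel after
multiplication by n+1. Cancelling n+1 is what requires a domain of characteristic zero. -/
lemma lagrangeCoeff_one_succ (h : φ * ψ = 1) (n : ℕ) : lagrangeCoeff φ ψ 1 (n + 1) = 0 := by
  have hd : PowerSeries.derivative R (φ ^ (n + 1))
      = ((n + 1 : ℕ) : PowerSeries R) * φ ^ n * PowerSeries.derivative R φ := by
    rw [Derivation.leibniz_pow]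
    simp [mul_assoc]
  have h1 : 1 * φ ^ (n + 1) * lagrangeFactor φ ψ = φ ^ (n + 1)
      - PowerSeries.X * (φ ^ n * PowerSeries.derivative R φ) := by
    rw [lagrangeFactor]
    linear_combination (-(φ ^ n) * PowerSeries.X * PowerSeries.derivative R φ) * h
  have h2 := congrArg (PowerSeries.coeff n) hd
  rw [PowerSeries.coeff_derivative, mul_assoc, ← map_natCast (PowerSeries.C (R := R)),
    PowerSeries.coeff_C_mul] at h2
  rw [lagrangeCoeff, h1, map_sub, PowerSeries.coeff_succ_X_mul]
  have h3 : ((n : R) + 1) ≠ 0 := by exact_mod_cast n.succ_ne_zero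
  apply mul_left_cancel₀ h3
  push_cast at h2
  linear_combination h2

/-- Substitution of `T(t)`, where `T = t φ(T)`, is multiplicative. -/
lemma lagrangeCoeff_mul (h : φ * ψ = 1) (H K : PowerSeries R) (n : ℕ) :
    lagrangeCoeff φ ψ (H * K) n =
      ∑ p ∈ Finset.HasAntidiagonal.antidiagonal n, lagrangeCoeff φ ψ H p.1 * lagrangeCoeff φ ψ K p.2 := by
  induction n generalizing H with
  | zero => simp [lagrangeCoeff_zero]
  | succ n ih =>
    -- Every series is a constant plus t = Tψ times another series. This reduces the degree by one
    -- and replaces any composition of power series.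
    obtain ⟨H', hH⟩ : ∃ H', H = PowerSeries.C (PowerSeries.constantCoeff H)
        + PowerSeries.X * ψ * H' := by
      have : PowerSeries.X ∣ H - PowerSeries.C (PowerSeries.constantCoeff H) := by
        rw [PowerSeries.X_dvd_iff]; simp
      obtain ⟨G, hG⟩ := this
      exact ⟨φ * G, by linear_combination hG - PowerSeries.X * G * h⟩
    set a := PowerSeries.constantCoeff H
    have hs (m : ℕ) : lagrangeCoeff φ ψ H (m + 1) = lagrangeCoeff φ ψ H' m := by
      rw [hH, lagrangeCoeff_add, lagrangeCoeff_X_mul h, ← mul_one (PowerSeries.C a),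
        lagrangeCoeff_C_mul, lagrangeCoeff_one_succ h, mul_zero, zero_add]
    have hHK : H * K = PowerSeries.C a * K + PowerSeries.X * ψ * (H' * K) := by
      linear_combination K * hH
    rw [hHK, lagrangeCoeff_add, lagrangeCoeff_C_mul, lagrangeCoeff_X_mul h, ih,
      Finset.Nat.sum_antidiagonal_succ, lagrangeCoeff_zero]
    simp only [hs]
    rfl

variable (φ ψ) in
/-- The series `H(T(t))`, where `T = t φ(T)` and `ψ = 1 / φ`. -/
def lagrangeSeries (H : PowerSeries R) : PowerSeries R :=
  PowerSeries.mk (lagrangeCoeff φ ψ H)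

lemma lagrangeSeries_mul (h : φ * ψ = 1) (H K : PowerSeries R) :
    lagrangeSeries φ ψ (H * K) = lagrangeSeries φ ψ H * lagrangeSeries φ ψ K := by
  ext n
  simp [lagrangeSeries, PowerSeries.coeff_mul, lagrangeCoeff_mul h]

lemma lagrangeSeries_pow_succ (h : φ * ψ = 1) (H : PowerSeries R) (n : ℕ) :
    lagrangeSeries φ ψ (H ^ (n + 1)) = lagrangeSeries φ ψ H ^ (n + 1) := by
  induction n with
  | zero => simp
  | succ n ih => rw [pow_succ, lagrangeSeries_mul h, ih, ← pow_succ]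

end Lagrange

end

noncomputable section

lemma coeff_invOneSubPow_eq_choosePred (R : Type*) [CommRing R] (k m : ℕ) :
    PowerSeries.coeff m (PowerSeries.invOneSubPow R k : PowerSeries R) = choosePred (k + m) k := by
  cases k with
  | zero => cases m <;> simp [choosePred, PowerSeries.invOneSubPow_zero, PowerSeries.coeff_one]
  | succ k =>
    rw [PowerSeries.invOneSubPow_val_succ_eq_mk_add_choose, PowerSeries.coeff_mk,
      show k + 1 + m = (k + m) + 1 by ring]
    simp [choosePred]

lemma invOneSubPow_one_pow (R : Type*) [CommRing R] (k : ℕ) :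
    (PowerSeries.invOneSubPow R 1 : PowerSeries R) ^ k = PowerSeries.invOneSubPow R k := by
  induction k with
  | zero => simp [PowerSeries.invOneSubPow_zero]
  | succ k ih => rw [pow_succ, ih, PowerSeries.invOneSubPow_add, Units.val_mul]

/-! ### The series of type `A` and `B` -/

/-- The series `(1 - x T)⁻ᵏ`. -/
def invOneSubMulPow {R : Type*} [CommRing R] (x : R) (k : ℕ) : PowerSeries R :=
  PowerSeries.rescale x (PowerSeries.invOneSubPow R k : PowerSeries R)

lemma choosePred_add_left (N k : ℕ) : choosePred (N + k) N = (N + k - 1).choose k := by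
  cases N with
  | zero => cases k <;> simp [choosePred]
  | succ N =>
    rw [show N + 1 + k = N + k + 1 by ring, choosePred, Nat.add_sub_cancel, Nat.choose_symm_add]

lemma coeff_invOneSubMulPow {R : Type*} [CommRing R] (x : R) (k n : ℕ) :
    PowerSeries.coeff n (invOneSubMulPow x k) = x ^ n * ((k + n - 1).choose n : ℕ) := by
  rw [invOneSubMulPow, PowerSeries.coeff_rescale, coeff_invOneSubPow_eq_choosePred,
    choosePred_add_left]

lemma invOneSubMulPow_pow {R : Type*} [CommRing R] (x : R) (k : ℕ) :
    invOneSubMulPow x 1 ^ k = invOneSubMulPow x k := by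
  rw [invOneSubMulPow, ← map_pow, invOneSubPow_one_pow, invOneSubMulPow]

lemma one_sub_mul_pow_mul_inv {R : Type*} [CommRing R] (x : R) (k : ℕ) :
    (1 - PowerSeries.C x * PowerSeries.X) ^ k * invOneSubMulPow x k = 1 := by
  have h : (1 - PowerSeries.X : PowerSeries R) ^ k * (PowerSeries.invOneSubPow R k : PowerSeries R) = 1 := by
    rw [← PowerSeries.invOneSubPow_inv_eq_one_sub_pow]
    exact (PowerSeries.invOneSubPow R k).inv_val
  have := congrArg (PowerSeries.rescale x) h
  simpa [invOneSubMulPow, PowerSeries.rescale_X] using this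

lemma coeff_one_add_mul_X_pow {R : Type*} [CommRing R] (x : R) (N n : ℕ) :
    PowerSeries.coeff n ((1 + PowerSeries.C x * PowerSeries.X) ^ N) = x ^ n * (N.choose n : ℕ) := by
  have := PowerSeries.coeff_rescale ((((1 + Polynomial.X : R[X]) ^ N : R[X])) : PowerSeries R) x n
  rw [Polynomial.coeff_coe, Polynomial.coeff_one_add_X_pow] at this
  rw [← this]
  simp [PowerSeries.rescale_X]

/-- The series `1 + x T² / (1 - z T)`. -/
def oneAddSqKernel {R : Type*} [CommRing R] (x z : R) : PowerSeries R :=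
  1 + PowerSeries.C x * PowerSeries.X ^ 2 * invOneSubMulPow z 1

/-- Binomial theorem in x T²/(1-zT): the k-th term carries T^(2k) (1-zT)^(-k), whence binom(n-k-1,
k-1) z^(n-2k). -/
lemma coeff_oneAddSqKernel_pow {R : Type*} [CommRing R] (x z : R) (N n : ℕ) :
    PowerSeries.coeff n (oneAddSqKernel x z ^ N) = ∑ k ∈ Finset.range (n + 1),
      if 2 * k ≤ n then ((N.choose k * choosePred (n - k) k : ℕ) : R) * x ^ k * z ^ (n - 2 * k)
      else 0 := by
  have h (k : ℕ) : PowerSeries.coeff n ((PowerSeries.C x * PowerSeries.X ^ 2 *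
      invOneSubMulPow z 1) ^ k * (N.choose k : PowerSeries R))
      = if 2 * k ≤ n then ((N.choose k * choosePred (n - k) k : ℕ) : R) * x ^ k * z ^ (n - 2 * k)
        else 0 := by
    rw [mul_pow, invOneSubMulPow_pow, mul_pow, ← map_pow, ← pow_mul,
      ← map_natCast (PowerSeries.C (R := R)), mul_comm, mul_assoc, PowerSeries.coeff_C_mul,
      PowerSeries.coeff_C_mul, PowerSeries.coeff_X_pow_mul']
    split_ifs with hk
    · rw [coeff_invOneSubMulPow, ← choosePred_add_left, show k + (n - 2 * k) = n - k by omega]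
      push_cast
      ring
    · simp
  rw [oneAddSqKernel, add_comm, add_pow, map_sum]
  simp only [one_pow, mul_one, h]
  -- The binomial sum runs up to N, the target up to n; the surplus terms vanish since 2k > n or
  -- binom(N, k) = 0.
  rcases le_total n N with hn | hn
  · symm
    apply Finset.sum_subset
    · intro k; simp only [Finset.mem_range]; omega
    · intro k _ hk
      simp only [Finset.mem_range] at hk
      rw [if_neg (by omega)]
  · apply Finset.sum_subset
    · intro k; simp only [Finset.mem_range]; omega
    · intro k _ hk
      simp only [Finset.mem_range, not_lt] at hk
      simp [Nat.choose_eq_zero_of_lt (by omega : N < k)]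

/-- The series `1 + x T² / (1 - T)`. -/
def gammaKernel : PowerSeries ℚ[X][Y] :=
  oneAddSqKernel (C X) 1

/-- The inverse of `1 + x T² / (1 - T)`. -/
def gammaKernelInv : PowerSeries ℚ[X][Y] :=
  PowerSeries.invOfUnit gammaKernel 1

lemma gammaKernel_mul_inv : gammaKernel * gammaKernelInv = 1 :=
  PowerSeries.mul_invOfUnit _ _ (by simp [gammaKernel, oneAddSqKernel])

lemma coeff_gammaKernel_pow (N n : ℕ) :
    PowerSeries.coeff n (gammaKernel ^ N) = ∑ k ∈ Finset.range (n + 1),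
      if 2 * k ≤ n then ((N.choose k * choosePred (n - k) k : ℕ) : ℚ[X][Y]) * (C X) ^ k else 0 := by
  simp [gammaKernel, coeff_oneAddSqKernel_pow]

lemma coeff_triangleSeries (a : ℕ → ℕ → ℕ → ℚ) (n : ℕ) :
    PowerSeries.coeff n (triangleSeries a) = ∑ l ∈ Finset.range (n + 1), Y ^ l *
      ∑ k ∈ Finset.range (n - l + 1),
        if 2 * k ≤ n - l then C (C (a k l (n - l - 2 * k))) * (C X) ^ k else 0 := by
  rw [triangleSeries, PowerSeries.coeff_mk, Finset.sum_comm]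
  refine Finset.sum_congr rfl fun l hl => ?_
  rw [Finset.mem_range] at hl
  rw [Finset.mul_sum]
  symm
  apply Finset.sum_subset_zero_on_sdiff
  · intro k; simp only [Finset.mem_range]; omega
  · intro k hk
    simp only [Finset.mem_sdiff, Finset.mem_range] at hk
    rw [if_neg (by omega)]
  · intro k _
    by_cases h : 2 * k + l ≤ n
    · rw [if_pos h, if_pos (by omega), show n - l - 2 * k = n - 2 * k - l by omega]
      ring
    · rw [if_neg h, if_neg (by omega), mul_zero]

/-- `T(t) / t`, where `T = t (1 + x T² / (1 - T))`. -/
def gammaSeriesA : PowerSeries ℚ[X][Y] :=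
  lagrangeSeries gammaKernel gammaKernelInv gammaKernel

/-- `t T'(t) / T(t)`, where `T = t (1 + x T² / (1 - T))`. -/
def gammaSeriesB : PowerSeries ℚ[X][Y] :=
  lagrangeSeries gammaKernel gammaKernelInv (lagrangeFactorInv gammaKernel gammaKernelInv)

lemma natCast_mul_C_C_eq (a b c : ℕ) (q : ℚ) (h : (a : ℚ) * q = b * c) :
    (a : ℚ[X][Y]) * C (C q) = b * (c : ℚ[X][Y]) := by
  have := congrArg (fun q : ℚ => (C (C q) : ℚ[X][Y])) h
  simpa using this

/-- Lagrange inversion gives (l+1)/(n+l+1) binom(n+l+1, k); absorbing the denominator turns it into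
(l+1)/(n+l+1-k) binom(n+l, k), and n+l+1-k = l+k+m+1 for m = n-2k. -/
lemma coeff_gammaSeriesA_pow (l n : ℕ) :
    PowerSeries.coeff n (gammaSeriesA ^ (l + 1)) = ∑ k ∈ Finset.range (n + 1),
      if 2 * k ≤ n then C (C (((l : ℚ) + 1) / ((l : ℚ) + k + (n - 2 * k : ℕ) + 1) *
        (l + 2 * k + (n - 2 * k)).choose k * choosePred (k + (n - 2 * k)) k)) * (C X) ^ k else 0 := by
  rw [gammaSeriesA, ← lagrangeSeries_pow_succ gammaKernel_mul_inv, lagrangeSeries,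
    PowerSeries.coeff_mk]
  have h0 : ((n : ℚ[X][Y]) + l + 1) ≠ 0 := by exact_mod_cast (n + l).succ_ne_zero
  apply mul_left_cancel₀ h0
  rw [lagrangeCoeff_pow_succ gammaKernel_mul_inv, coeff_gammaKernel_pow, Finset.mul_sum,
    Finset.mul_sum]
  refine Finset.sum_congr rfl fun k _ => ?_
  split_ifs with hk
  · rw [show l + 2 * k + (n - 2 * k) = n + l by omega, show k + (n - 2 * k) = n - k by omega]
    have h1 := Nat.choose_mul_succ_eq (n + l) k
    have h2 : ((n + l + 1 : ℕ) : ℚ) * (((l : ℚ) + 1) / ((l : ℚ) + k + (n - 2 * k : ℕ) + 1) *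
        (n + l).choose k * choosePred (n - k) k) =
        ((l + 1 : ℕ) : ℚ) * (((n + l + 1).choose k * choosePred (n - k) k : ℕ) : ℚ) := by
      have h3 : (l : ℚ) + k + (n - 2 * k : ℕ) + 1 = (n + l + 1 - k : ℕ) := by
        rw [show n + l + 1 - k = l + k + (n - 2 * k) + 1 by omega]; push_cast; ring
      have h4 : ((n + l + 1 - k : ℕ) : ℚ) ≠ 0 := by
        have : n + l + 1 - k ≠ 0 := by omega
        exact_mod_cast this
      rw [h3]
      field_simp
      have h1' : ((n + l).choose k : ℚ) * (n + l + 1 : ℕ)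
        = ((n + l + 1).choose k : ℚ) * (n + l + 1 - k : ℕ) := by exact_mod_cast h1
      push_cast at h1' ⊢
      linear_combination ((l : ℚ) + 1) * (choosePred (n - k) k : ℚ) * h1'
    have h5 := natCast_mul_C_C_eq _ _ _ _ h2
    push_cast [mul_assoc] at h5 ⊢
    rw [← mul_assoc, ← mul_assoc, ← mul_assoc, h5]
    ring
  · simp

/-- Here the inverse Lagrange factor removes the fraction of type A, leaving the coefficient of T^n
in φ^(n+l). -/
lemma coeff_gammaSeriesB_mul_pow (l n : ℕ) :
    PowerSeries.coeff n (gammaSeriesA ^ l * gammaSeriesB) = ∑ k ∈ Finset.range (n + 1),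
      if 2 * k ≤ n then C (C ((2 * k + l + (n - 2 * k)).choose k *
        choosePred (k + (n - 2 * k)) k : ℚ)) * (C X) ^ k else 0 := by
  have h : gammaSeriesA ^ l * gammaSeriesB = lagrangeSeries gammaKernel gammaKernelInv
      (gammaKernel ^ l * lagrangeFactorInv gammaKernel gammaKernelInv) := by
    cases l with
    | zero => simp [gammaSeriesB]
    | succ l =>
      rw [lagrangeSeries_mul gammaKernel_mul_inv, lagrangeSeries_pow_succ gammaKernel_mul_inv,
        gammaSeriesA, gammaSeriesB]
  rw [h, lagrangeSeries, PowerSeries.coeff_mk, lagrangeCoeff_mul_inv, coeff_gammaKernel_pow]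
  refine Finset.sum_congr rfl fun k _ => ?_
  split_ifs with hk
  · rw [show 2 * k + l + (n - 2 * k) = n + l by omega, show k + (n - 2 * k) = n - k by omega]
    push_cast
    simp
  · rfl

lemma smallSeriesA_eq : smallSeriesA = gammaSeriesA := by
  ext1 n
  rw [smallSeriesA, coeff_triangleSeries, Finset.sum_range_succ', Finset.sum_eq_zero, zero_add,
    ← pow_one gammaSeriesA, ← zero_add 1, coeff_gammaSeriesA_pow]
  · simp
  · intro l _
    simp

lemma smallSeriesB_eq : smallSeriesB = gammaSeriesB := by
  ext1 n
  rw [smallSeriesB, coeff_triangleSeries, Finset.sum_range_succ', Finset.sum_eq_zero, zero_add,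
    ← one_mul gammaSeriesB, ← pow_zero gammaSeriesA, coeff_gammaSeriesB_mul_pow]
  · simp
  · intro l _
    simp

/-- A series whose coefficients are those of `∑ (y t u)^l v` is `v / (1 - y t u)`. -/
lemma mul_one_sub_eq_of_coeff {R : Type*} [CommRing R] (y : R) (u v G : PowerSeries R)
    (hG : ∀ n, PowerSeries.coeff n G =
      ∑ l ∈ Finset.range (n + 1), y ^ l * PowerSeries.coeff (n - l) (u ^ l * v)) :
    G * (1 - PowerSeries.C y * PowerSeries.X * u) = v := by
  -- The l-th term is divisible by t^l, so up to degree N the series agrees with the geometric sum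
  -- of its first N+1 terms.
  have h (N n : ℕ) (hn : n ≤ N) : PowerSeries.coeff n G = PowerSeries.coeff n
      (∑ l ∈ Finset.range (N + 1), (PowerSeries.C y * PowerSeries.X * u) ^ l * v) := by
    rw [hG, map_sum]
    apply Finset.sum_subset_zero_on_sdiff
    · intro l; simp only [Finset.mem_range]; omega
    · intro l hl
      simp only [Finset.mem_sdiff, Finset.mem_range] at hl
      rw [mul_pow, mul_pow, ← map_pow, mul_assoc, mul_assoc, PowerSeries.coeff_C_mul,
        PowerSeries.coeff_X_pow_mul', if_neg (by omega), mul_zero]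
    · intro l hl
      simp only [Finset.mem_range] at hl
      rw [mul_pow, mul_pow, ← map_pow, mul_assoc, mul_assoc, PowerSeries.coeff_C_mul,
        PowerSeries.coeff_X_pow_mul', if_pos (by omega)]
  ext n
  have h1 : PowerSeries.coeff n (G * (1 - PowerSeries.C y * PowerSeries.X * u)) =
      PowerSeries.coeff n ((∑ l ∈ Finset.range (n + 1),
        (PowerSeries.C y * PowerSeries.X * u) ^ l * v) *
          (1 - PowerSeries.C y * PowerSeries.X * u)) := by
    rw [PowerSeries.coeff_mul, PowerSeries.coeff_mul]
    refine Finset.sum_congr rfl fun q hq => ?_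
    rw [h n q.1 (Finset.HasAntidiagonal.antidiagonal.fst_le hq)]
  rw [h1, ← Finset.sum_mul, mul_right_comm, geom_sum_mul_neg, sub_mul, one_mul, map_sub, mul_pow,
    mul_pow, ← map_pow, mul_assoc, mul_assoc, PowerSeries.coeff_C_mul,
    PowerSeries.coeff_X_pow_mul', if_neg (by omega), mul_zero, sub_zero]

/-- The coefficient of y^l in G_A is t^l g_A^(l+1), a geometric progression. -/
lemma bigSeriesA_mul :
    bigSeriesA * (1 - PowerSeries.C (Y : ℚ[X][Y]) * PowerSeries.X * gammaSeriesA) = gammaSeriesA := by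
  apply mul_one_sub_eq_of_coeff
  intro n
  rw [bigSeriesA, coeff_triangleSeries]
  refine Finset.sum_congr rfl fun l _ => ?_
  rw [← pow_succ, coeff_gammaSeriesA_pow]

lemma bigSeriesB_mul :
    bigSeriesB * (1 - PowerSeries.C (Y : ℚ[X][Y]) * PowerSeries.X * gammaSeriesA) = gammaSeriesB := by
  apply mul_one_sub_eq_of_coeff
  intro n
  rw [bigSeriesB, coeff_triangleSeries]
  refine Finset.sum_congr rfl fun l _ => ?_
  rw [coeff_gammaSeriesB_mul_pow]

lemma bigSeriesB_eq_small_add_smallA_mul :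
    bigSeriesB = smallSeriesB +
      PowerSeries.C (Y : ℚ[X][Y]) * PowerSeries.X * smallSeriesA * bigSeriesB := by
  rw [smallSeriesA_eq, smallSeriesB_eq]
  linear_combination bigSeriesB_mul

lemma bigSeriesB_eq_small_add_smallB_mul :
    bigSeriesB = smallSeriesB +
      PowerSeries.C (Y : ℚ[X][Y]) * PowerSeries.X * smallSeriesB * bigSeriesA := by
  rw [smallSeriesB_eq]
  -- Both large series have this denominator; its constant term is 1, so it may be cancelled.
  have h0 : (1 - PowerSeries.C (Y : ℚ[X][Y]) * PowerSeries.X * gammaSeriesA) ≠ 0 := by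
    intro h
    simpa using congrArg PowerSeries.constantCoeff h
  apply mul_right_cancel₀ h0
  linear_combination bigSeriesB_mul - (PowerSeries.C (Y : ℚ[X][Y]) * PowerSeries.X * gammaSeriesB) * bigSeriesA_mul

end

noncomputable section

/-! ### The entries of the `F`-triangles of type `A` and `B` -/

open Finset.HasAntidiagonal (antidiagonal)

/-- The entries of the `F`-triangle of type `A_N`. -/
def fEntryA (N k l : ℕ) : ℚ :=
  ((l : ℚ) + 1) / ((k : ℚ) + l + 1) * N.choose (k + l) * (N + k).choose k

/-- The entries of the `F`-triangle of type `B_N`. -/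
def fEntryB (N k l : ℕ) : ℚ :=
  N.choose (k + l) * (N + k - 1).choose k

/-- The series `(1 + T) / (1 - x T)`. -/
def clusterKernel : PowerSeries ℚ[X] :=
  (1 + PowerSeries.X) * invOneSubMulPow X 1

/-- The inverse of `(1 + T) / (1 - x T)`. -/
def clusterKernelInv : PowerSeries ℚ[X] :=
  PowerSeries.invOfUnit clusterKernel 1

lemma clusterKernel_mul_inv : clusterKernel * clusterKernelInv = 1 :=
  PowerSeries.mul_invOfUnit _ _ (by
    have := coeff_invOneSubMulPow (X : ℚ[X]) 1 0
    rw [PowerSeries.coeff_zero_eq_constantCoeff_apply] at this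
    simp [clusterKernel, this])

lemma coeff_coeff_clusterKernel_pow (N n k : ℕ) :
    (PowerSeries.coeff n (clusterKernel ^ N)).coeff k =
      if k ≤ n then (((N + k - 1).choose k * N.choose (n - k) : ℕ) : ℚ) else 0 := by
  have h1 := coeff_one_add_mul_X_pow (1 : ℚ[X]) N
  simp only [map_one, one_mul, one_pow] at h1
  rw [clusterKernel, mul_pow, invOneSubMulPow_pow, mul_comm, PowerSeries.coeff_mul,
    Finset.Nat.sum_antidiagonal_eq_sum_range_succ_mk, Polynomial.finsetSum_coeff]
  have h2 (j : ℕ) : ((PowerSeries.coeff j (invOneSubMulPow (X : ℚ[X]) N) *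
      PowerSeries.coeff (n - j) ((1 + PowerSeries.X : PowerSeries ℚ[X]) ^ N)).coeff k) =
      if j = k then (((N + k - 1).choose k * N.choose (n - k) : ℕ) : ℚ) else 0 := by
    rw [coeff_invOneSubMulPow, h1, mul_assoc, ← Nat.cast_mul, ← Polynomial.C_eq_natCast,
      Polynomial.coeff_X_pow_mul', Polynomial.coeff_C]
    by_cases h : j = k
    · subst h; simp
    · rw [if_neg h]
      split_ifs
      · omega
      · rfl
      · rfl
  simp only [h2]
  rw [Finset.sum_ite_eq' (Finset.range n.succ) k]
  simp

/-- `T(t) / t`, where `T = t (1 + T) / (1 - x T)`. -/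
def clusterSeriesA : PowerSeries ℚ[X] :=
  lagrangeSeries clusterKernel clusterKernelInv clusterKernel

/-- `t T'(t) / T(t)`, where `T = t (1 + T) / (1 - x T)`. -/
def clusterSeriesB : PowerSeries ℚ[X] :=
  lagrangeSeries clusterKernel clusterKernelInv (lagrangeFactorInv clusterKernel clusterKernelInv)

/-- Lagrange inversion gives (l+1)/(N+1) binom(N+1, k+l+1) binom(N+k, k), and absorption replaces
binom(N+1, k+l+1)/(N+1) by binom(N, k+l)/(k+l+1). -/
lemma coeff_coeff_clusterSeriesA_pow (N k l : ℕ) :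
    (PowerSeries.coeff N (PowerSeries.X ^ l * clusterSeriesA ^ (l + 1))).coeff k = fEntryA N k l := by
  rw [PowerSeries.coeff_X_pow_mul']
  split_ifs with hl
  · obtain ⟨n, rfl⟩ := Nat.exists_eq_add_of_le hl
    rw [Nat.add_sub_cancel_left, clusterSeriesA, ← lagrangeSeries_pow_succ clusterKernel_mul_inv,
      lagrangeSeries, PowerSeries.coeff_mk]
    have h := congrArg (Polynomial.coeff · k) (lagrangeCoeff_pow_succ clusterKernel_mul_inv l n)
    have h0 : ((n + l + 1 : ℕ) : ℚ) ≠ 0 := by exact_mod_cast (n + l).succ_ne_zero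
    apply mul_left_cancel₀ h0
    have e1 : ((n : ℚ[X]) + l + 1) = Polynomial.C ((n + l + 1 : ℕ) : ℚ) := by simp
    have e2 : ((l : ℚ[X]) + 1) = Polynomial.C ((l + 1 : ℕ) : ℚ) := by simp
    simp only [e1, e2, Polynomial.coeff_C_mul, coeff_coeff_clusterKernel_pow] at h
    rw [h, fEntryA]
    split_ifs with hk
    · have h1 : (n + l + 1).choose (n - k) = (n + l + 1).choose (k + l + 1) :=
        Nat.choose_symm_of_eq_add (by omega)
      have h2 : ((n + l + 1 : ℕ) : ℚ) * (n + l).choose (k + l) =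
          (n + l + 1).choose (k + l + 1) * ((k + l + 1 : ℕ) : ℚ) := by
        exact_mod_cast Nat.add_one_mul_choose_eq (n + l) (k + l)
      rw [h1, show n + l + 1 + k - 1 = l + n + k by omega, add_comm l n]
      have h3 : ((k : ℚ) + l + 1) ≠ 0 := by exact_mod_cast (k + l).succ_ne_zero
      push_cast at h2 ⊢
      field_simp
      linear_combination -((n + l + k).choose k : ℚ) * h2
    · rw [Nat.choose_eq_zero_of_lt (by omega : l + n < k + l)]
      simp
  · rw [fEntryA, Nat.choose_eq_zero_of_lt (by omega : N < k + l)]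
    simp

lemma coeff_coeff_clusterSeriesB_mul_pow (N k l : ℕ) :
    (PowerSeries.coeff N (PowerSeries.X ^ l * (clusterSeriesA ^ l * clusterSeriesB))).coeff k
      = fEntryB N k l := by
  have h : clusterSeriesA ^ l * clusterSeriesB = lagrangeSeries clusterKernel clusterKernelInv
      (clusterKernel ^ l * lagrangeFactorInv clusterKernel clusterKernelInv) := by
    cases l with
    | zero => simp [clusterSeriesB]
    | succ l =>
      rw [lagrangeSeries_mul clusterKernel_mul_inv, lagrangeSeries_pow_succ clusterKernel_mul_inv,
        clusterSeriesA, clusterSeriesB]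
  rw [PowerSeries.coeff_X_pow_mul']
  split_ifs with hl
  · obtain ⟨n, rfl⟩ := Nat.exists_eq_add_of_le hl
    rw [Nat.add_sub_cancel_left, h, lagrangeSeries, PowerSeries.coeff_mk, lagrangeCoeff_mul_inv,
      coeff_coeff_clusterKernel_pow, fEntryB]
    split_ifs with hk
    · have h1 : (n + l).choose (n - k) = (n + l).choose (k + l) :=
        Nat.choose_symm_of_eq_add (by omega)
      rw [h1, add_comm l n]
      push_cast
      ring
    · rw [Nat.choose_eq_zero_of_lt (by omega : l + n < k + l)]
      simp
  · rw [fEntryB, Nat.choose_eq_zero_of_lt (by omega : N < k + l)]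
    simp

/-- A factorisation of t^(l+1) A^(l+2), read on coefficients. It mirrors the recursion
`IsTypeB.faceCount_succ` for faces cut at their first negative simple root. -/
lemma fEntryA_succ_succ (N k l : ℕ) :
    fEntryA (N + 1) k (l + 1) = ∑ s ∈ antidiagonal N, ∑ p ∈ antidiagonal k,
      fEntryA s.1 p.1 0 * fEntryA s.2 p.2 l := by
  have h : (PowerSeries.X ^ (l + 1) * clusterSeriesA ^ (l + 1 + 1) : PowerSeries ℚ[X]) =
      PowerSeries.X * ((PowerSeries.X ^ 0 * clusterSeriesA ^ (0 + 1)) *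
        (PowerSeries.X ^ l * clusterSeriesA ^ (l + 1))) := by ring
  rw [← coeff_coeff_clusterSeriesA_pow, h, PowerSeries.coeff_succ_X_mul, PowerSeries.coeff_mul,
    Polynomial.finsetSum_coeff]
  simp only [Polynomial.coeff_mul, coeff_coeff_clusterSeriesA_pow]

lemma fEntryB_succ_succ (N k l : ℕ) :
    fEntryB (N + 1) k (l + 1) = ∑ s ∈ antidiagonal N, ∑ p ∈ antidiagonal k,
      fEntryA s.1 p.1 0 * fEntryB s.2 p.2 l := by
  have h : (PowerSeries.X ^ (l + 1) * (clusterSeriesA ^ (l + 1) * clusterSeriesB) : PowerSeries ℚ[X]) =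
      PowerSeries.X * ((PowerSeries.X ^ 0 * clusterSeriesA ^ (0 + 1)) *
        (PowerSeries.X ^ l * (clusterSeriesA ^ l * clusterSeriesB))) := by ring
  rw [← coeff_coeff_clusterSeriesB_mul_pow, h, PowerSeries.coeff_succ_X_mul, PowerSeries.coeff_mul,
    Polynomial.finsetSum_coeff]
  simp only [Polynomial.coeff_mul, coeff_coeff_clusterSeriesA_pow,
    coeff_coeff_clusterSeriesB_mul_pow]

/-! ### Hockey-stick sums and the Coxeter number relation for the closed forms. -/

lemma sum_antidiagonal_choose (N m : ℕ) :
    ∑ p ∈ antidiagonal m, ((N + p.1).choose p.1 : ℚ) = (N + m + 1).choose m := by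
  induction m with
  | zero => simp
  | succ m ih =>
    rw [Finset.Nat.sum_antidiagonal_succ', ih, show N + (m + 1) + 1 = N + m + 1 + 1 by ring,
      Nat.choose_succ_succ]
    push_cast
    rw [add_comm, add_assoc N m 1]

lemma sum_antidiagonal_succ_mul_choose (N m : ℕ) :
    ∑ p ∈ antidiagonal m, ((p.2 : ℚ) + 1) * (N + p.1).choose p.1 = (N + m + 2).choose m := by
  induction m with
  | zero => simp
  | succ m ih =>
    have h (p : ℕ × ℕ) : ((p.2 + 1 : ℕ) + 1 : ℚ) * (N + p.1).choose p.1 =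
        ((p.2 : ℚ) + 1) * (N + p.1).choose p.1 + (N + p.1).choose p.1 := by push_cast; ring
    rw [Finset.Nat.sum_antidiagonal_succ']
    simp only [h, Finset.sum_add_distrib, ih, sum_antidiagonal_choose]
    rw [show N + (m + 1) + 2 = N + m + 2 + 1 by ring, Nat.choose_succ_succ (N + m + 2),
      show N + m + 2 = N + m + 1 + 1 by ring, Nat.choose_succ_succ (N + m + 1) m]
    push_cast
    rw [add_assoc N m 1]
    ring

lemma sum_antidiagonal_mul_succ_mul_choose (N m : ℕ) :
    ∑ p ∈ antidiagonal (m + 1), (p.2 : ℚ) * ((p.2 : ℚ) + 1) * (N + p.1).choose p.1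
      = 2 * (N + m + 3).choose m := by
  induction m with
  | zero => simp [Finset.Nat.sum_antidiagonal_succ']; norm_num
  | succ m ih =>
    have h (p : ℕ × ℕ) : ((p.2 + 1 : ℕ) : ℚ) * ((p.2 + 1 : ℕ) + 1 : ℚ) * (N + p.1).choose p.1 =
        (p.2 : ℚ) * ((p.2 : ℚ) + 1) * (N + p.1).choose p.1
          + 2 * (((p.2 : ℚ) + 1) * (N + p.1).choose p.1) := by push_cast; ring
    rw [Finset.Nat.sum_antidiagonal_succ']
    simp only [h, Finset.sum_add_distrib, ih, ← Finset.mul_sum, sum_antidiagonal_succ_mul_choose]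
    rw [show N + (m + 1) + 3 = N + m + 3 + 1 by ring, Nat.choose_succ_succ (N + m + 3) m,
      show N + (m + 1) + 2 = N + m + 3 by ring]
    push_cast
    ring

lemma sum_antidiagonal_mul_choose (N m : ℕ) :
    ∑ p ∈ antidiagonal (m + 1), (p.2 : ℚ) * (N + p.1).choose p.1 = (N + m + 2).choose m := by
  rw [Finset.Nat.sum_antidiagonal_succ']
  simpa using sum_antidiagonal_succ_mul_choose N m

/-- The counterpart of `sum_antidiagonal_faceCount` with Coxeter number h = N+1. On k+l = m+1 the
factor binom(N, m+1)/(m+2) is constant, and the rest is a combination of two hockey-stick sums. -/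
lemma sum_fEntryA_eq_zero (N m : ℕ) :
    ∑ p ∈ antidiagonal (m + 1),
      (((N : ℚ) + 1 + 2) * p.2 - 2 * (m + 1)) * fEntryA N p.1 p.2 = 0 := by
  have h (p : ℕ × ℕ) (hp : p ∈ antidiagonal (m + 1)) :
      (((N : ℚ) + 1 + 2) * p.2 - 2 * (m + 1)) * fEntryA N p.1 p.2 =
      (N.choose (m + 1) / ((m : ℚ) + 2)) *
      (((N : ℚ) + 3) * ((p.2 : ℚ) * ((p.2 : ℚ) + 1) * (N + p.1).choose p.1)
        - 2 * (m + 1) * (((p.2 : ℚ) + 1) * (N + p.1).choose p.1)) := by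
    have h1 : p.1 + p.2 = m + 1 := Finset.HasAntidiagonal.mem_antidiagonal.mp hp
    have h2 : (p.1 : ℚ) + p.2 + 1 = m + 2 := by
      have : ((p.1 + p.2 : ℕ) : ℚ) = (m + 1 : ℕ) := by rw [h1]
      push_cast at this; linarith
    rw [fEntryA, h1, h2]
    ring
  rw [Finset.sum_congr rfl h, ← Finset.mul_sum, Finset.sum_sub_distrib, ← Finset.mul_sum,
    ← Finset.mul_sum, sum_antidiagonal_mul_succ_mul_choose, sum_antidiagonal_succ_mul_choose]
  have h3 := Nat.choose_succ_right_eq (N + m + 3) m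
  rw [show N + m + 3 - m = N + 3 by omega] at h3
  have h3' : ((N + m + 3).choose (m + 1) : ℚ) * (m + 1) = (N + m + 3).choose m * (N + 3) := by
    exact_mod_cast h3
  rw [show N + (m + 1) + 2 = N + m + 3 by ring]
  linear_combination (-2 * (N.choose (m + 1) / ((m : ℚ) + 2))) * h3'

/-- The same relation with the Coxeter number h = 2N of type B_N. -/
lemma sum_fEntryB_eq_zero (N m : ℕ) :
    ∑ p ∈ antidiagonal (m + 1),
      ((2 * (N : ℚ) + 2) * p.2 - 2 * (m + 1)) * fEntryB N p.1 p.2 = 0 := by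
  have h (p : ℕ × ℕ) (hp : p ∈ antidiagonal (m + 1)) :
      ((2 * (N : ℚ) + 2) * p.2 - 2 * (m + 1)) * fEntryB N p.1 p.2 =
      (2 * N.choose (m + 1)) * ((N + 1) * ((p.2 : ℚ) * (N + p.1 - 1).choose p.1)
        - (m + 1) * (N + p.1 - 1).choose p.1) := by
    rw [fEntryB, Finset.HasAntidiagonal.mem_antidiagonal.mp hp]
    ring
  rw [Finset.sum_congr rfl h, ← Finset.mul_sum, Finset.sum_sub_distrib, ← Finset.mul_sum,
    ← Finset.mul_sum]
  -- For N = 0 everything vanishes with binom(0, m+1); for N ≥ 1 the subtraction in N+k-1 is not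
  -- truncated.
  cases N with
  | zero => simp
  | succ N =>
    simp only [show ∀ k, N + 1 + k - 1 = N + k by omega]
    rw [sum_antidiagonal_mul_choose, sum_antidiagonal_choose]
    have h3 := Nat.choose_succ_right_eq (N + m + 2) m
    rw [show N + m + 2 - m = N + 2 by omega] at h3
    have h3' : ((N + m + 2).choose (m + 1) : ℚ) * (m + 1) = (N + m + 2).choose m * (N + 2) := by
      exact_mod_cast h3
    rw [show N + (m + 1) + 1 = N + m + 2 by ring]
    push_cast
    linear_combination (-2 * ((N + 1).choose (m + 1) : ℚ)) * h3'

end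

noncomputable section

/-! ### From the `F`-triangle to the `Γ`-triangle -/

section Residue

variable {R : Type*} [CommRing R]

lemma one_sub_X_mul_invOneSubPow_one :
    (1 - PowerSeries.X) * (PowerSeries.invOneSubPow R 1 : PowerSeries R) = 1 := by
  rw [← pow_one (1 - PowerSeries.X), ← PowerSeries.invOneSubPow_inv_eq_one_sub_pow]
  exact (PowerSeries.invOneSubPow R 1).inv_val

lemma hasSubst_X_mul_invOneSubPow :
    PowerSeries.HasSubst (PowerSeries.X * (PowerSeries.invOneSubPow R 1 : PowerSeries R)) :=
  PowerSeries.HasSubst.of_constantCoeff_zero' (by simp)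

/-- The substitution `T ↦ U / (1 - U)`. -/
def substDivOneSub : PowerSeries R →ₐ[R] PowerSeries R :=
  PowerSeries.substAlgHom hasSubst_X_mul_invOneSubPow

lemma substDivOneSub_X : substDivOneSub (PowerSeries.X : PowerSeries R) =
    PowerSeries.X * (PowerSeries.invOneSubPow R 1 : PowerSeries R) := by
  rw [substDivOneSub, PowerSeries.coe_substAlgHom, PowerSeries.subst_X hasSubst_X_mul_invOneSubPow]

lemma substDivOneSub_C (a : R) : substDivOneSub (PowerSeries.C a) = PowerSeries.C a :=
  substDivOneSub.commutes a

lemma coeff_one_sub_X_pow_of_lt {n m : ℕ} (h : n < m) :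
    PowerSeries.coeff m ((1 - PowerSeries.X : PowerSeries R) ^ n) = 0 := by
  have := coeff_one_add_mul_X_pow (-1 : R) n m
  rw [Nat.choose_eq_zero_of_lt h] at this
  simpa [← sub_eq_add_neg] using this

/-- The change of variables `T = U / (1 - U)` in the residue of `f(T) dT / T ^ (n + 1)`. -/
lemma coeff_substDivOneSub (f : PowerSeries R) (n : ℕ) :
    PowerSeries.coeff n ((1 - PowerSeries.X) ^ n * (PowerSeries.invOneSubPow R 1 : PowerSeries R) *
      substDivOneSub f) = PowerSeries.coeff n f := by
  set W := (PowerSeries.invOneSubPow R 1 : PowerSeries R) with hW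
  have hUW : (1 - PowerSeries.X) * W = 1 := one_sub_X_mul_invOneSubPow_one
  -- Only f modulo T^(n+1) matters, so the claim reduces to the monomials T^j with j ≤ n.
  obtain ⟨r, hr⟩ : PowerSeries.X ^ (n + 1) ∣
      f - ∑ j ∈ Finset.range (n + 1), PowerSeries.C (PowerSeries.coeff j f) * PowerSeries.X ^ j := by
    rw [PowerSeries.X_pow_dvd_iff]
    intro m hm
    simp [PowerSeries.coeff_X_pow, hm]
  have hj (j : ℕ) (hj : j < n + 1) : PowerSeries.coeff n ((1 - PowerSeries.X) ^ n * W *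
      (PowerSeries.C (PowerSeries.coeff j f) * (PowerSeries.X * W) ^ j)) =
      if j = n then PowerSeries.coeff n f else 0 := by
    obtain ⟨i, rfl⟩ := Nat.exists_eq_add_of_le (Nat.le_of_lt_succ hj)
    have e : (1 - PowerSeries.X) ^ (j + i) * W *
        (PowerSeries.C (PowerSeries.coeff j f) * (PowerSeries.X * W) ^ j) =
        PowerSeries.C (PowerSeries.coeff j f) * (PowerSeries.X ^ j *
          ((1 - PowerSeries.X) ^ i * W)) := by
      calc _ = PowerSeries.C (PowerSeries.coeff j f) * (PowerSeries.X ^ j *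
          ((1 - PowerSeries.X) ^ i * W)) * ((1 - PowerSeries.X) * W) ^ j := by
            simp only [mul_pow]; ring
        _ = _ := by rw [hUW, one_pow, mul_one]
    rw [e, PowerSeries.coeff_C_mul, PowerSeries.coeff_X_pow_mul', if_pos (by omega),
      Nat.add_sub_cancel_left]
    -- With i = n-j, the monomial T^j contributes the coefficient of U^i in (1-U)^(i-1): this is 1
    -- for i = 0, and 0 for i > 0 by degree.
    cases i with
    | zero => simp [hW, coeff_invOneSubPow_eq_choosePred, choosePred, -PowerSeries.coeff_zero_eq_constantCoeff]
    | succ i =>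
      rw [pow_succ, mul_assoc, hUW, mul_one, coeff_one_sub_X_pow_of_lt (by omega), mul_zero,
        if_neg (by omega)]
  have hf : f = ∑ j ∈ Finset.range (n + 1),
      PowerSeries.C (PowerSeries.coeff j f) * PowerSeries.X ^ j + PowerSeries.X ^ (n + 1) * r := by
    rw [← hr]; ring
  have hS : substDivOneSub f = ∑ j ∈ Finset.range (n + 1),
      PowerSeries.C (PowerSeries.coeff j f) * (PowerSeries.X * W) ^ j +
        (PowerSeries.X * W) ^ (n + 1) * substDivOneSub r := by
    conv_lhs => rw [hf]
    simp only [map_add, map_sum, map_mul, map_pow, substDivOneSub_X, substDivOneSub_C, hW]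
  rw [hS, mul_add, map_add, Finset.mul_sum, map_sum,
    Finset.sum_congr rfl fun j h => hj j (Finset.mem_range.mp h), Finset.sum_ite_eq',
    if_pos (by simp)]
  have e : (1 - PowerSeries.X) ^ n * W * ((PowerSeries.X * W) ^ (n + 1) * substDivOneSub r) =
      PowerSeries.X ^ (n + 1) * ((1 - PowerSeries.X) ^ n * W * W ^ (n + 1) * substDivOneSub r) := by
    ring
  rw [e, PowerSeries.coeff_X_pow_mul', if_neg (by omega), add_zero]

lemma coeff_mul_mul_eq_sum_range (A B D : PowerSeries R) (n : ℕ) :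
    PowerSeries.coeff n (A * B * D) = ∑ i ∈ Finset.range (n + 1), ∑ j ∈ Finset.range (n + 1),
      if i + j ≤ n then PowerSeries.coeff i A * PowerSeries.coeff j B *
        PowerSeries.coeff (n - (i + j)) D else 0 := by
  rw [mul_assoc, PowerSeries.coeff_mul, Finset.Nat.sum_antidiagonal_eq_sum_range_succ_mk]
  refine Finset.sum_congr rfl fun i hi => ?_
  rw [Finset.mem_range] at hi
  rw [PowerSeries.coeff_mul, Finset.Nat.sum_antidiagonal_eq_sum_range_succ_mk, Finset.mul_sum]
  apply Finset.sum_subset_zero_on_sdiff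
  · intro j; simp only [Finset.mem_range]; omega
  · intro j hj
    simp only [Finset.mem_sdiff, Finset.mem_range] at hj
    rw [if_neg (by omega)]
  · intro j hj
    simp only [Finset.mem_range] at hj
    rw [if_pos (by omega), Nat.sub_add_eq, mul_assoc]

/-- A Cauchy product of three factors: binom(n+i-1, i) x^i from (1-xT)^(-n), (xy)^j from a geometric
series, and binom(n, i+j) (1-x)^(n-i-j) from the binomial. -/
lemma sum_fEntry_eq_coeff (x y : R) (n : ℕ) :
    ∑ i ∈ Finset.range (n + 1), ∑ j ∈ Finset.range (n + 1),
      ((n.choose (i + j) * (n + i - 1).choose i : ℕ) : R) * x ^ i * (x * y) ^ j *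
        (1 - x) ^ (n - (i + j)) =
      PowerSeries.coeff n (invOneSubMulPow x n * invOneSubMulPow (x * y) 1 *
        (1 + PowerSeries.C (1 - x) * PowerSeries.X) ^ n) := by
  rw [coeff_mul_mul_eq_sum_range]
  refine Finset.sum_congr rfl fun i _ => Finset.sum_congr rfl fun j _ => ?_
  split_ifs with h
  · rw [coeff_invOneSubMulPow, coeff_invOneSubMulPow, coeff_one_add_mul_X_pow, Nat.choose_symm h]
    simp only [Nat.add_sub_cancel_left, Nat.choose_self]
    push_cast
    ring
  · rw [Nat.choose_eq_zero_of_lt (by omega : n < i + j)]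
    simp

lemma sum_gammaEntry_eq_coeff (x y : R) (n : ℕ) :
    ∑ i ∈ Finset.range (n + 1), ∑ j ∈ Finset.range (n + 1), (if j + 2 * i ≤ n then
      ((n.choose i * choosePred (n - i - j) i : ℕ) : R) * x ^ i * (1 + x * y) ^ j *
        (1 + x) ^ (n - 2 * i - j) else 0) =
      PowerSeries.coeff n (invOneSubMulPow (1 + x * y) 1 * oneAddSqKernel x (1 + x) ^ n) := by
  rw [PowerSeries.coeff_mul, Finset.Nat.sum_antidiagonal_eq_sum_range_succ_mk, Finset.sum_comm]
  refine Finset.sum_congr rfl fun j hj => ?_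
  rw [Finset.mem_range] at hj
  rw [coeff_oneAddSqKernel_pow, coeff_invOneSubMulPow, Finset.mul_sum]
  symm
  apply Finset.sum_subset_zero_on_sdiff
  · intro i; simp only [Finset.mem_range]; omega
  · intro i hi
    simp only [Finset.mem_sdiff, Finset.mem_range] at hi
    rw [if_neg (by omega)]
  · intro i _
    by_cases h : j + 2 * i ≤ n
    · rw [if_pos h, if_pos (by omega), show n - j - i = n - i - j by omega,
        show n - j - 2 * i = n - 2 * i - j by omega]
      simp only [Nat.add_sub_cancel_left, Nat.choose_self]
      push_cast
      ring
    · rw [if_neg h, if_neg (by omega), mul_zero]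

/-- The `H`-polynomial and its expansion given by the `Γ`-triangle agree. -/
lemma sum_fEntry_eq_sum_gammaEntry (x y : R) (n : ℕ) :
    ∑ i ∈ Finset.range (n + 1), ∑ j ∈ Finset.range (n + 1),
      ((n.choose (i + j) * (n + i - 1).choose i : ℕ) : R) * x ^ i * (x * y) ^ j *
        (1 - x) ^ (n - (i + j)) =
    ∑ i ∈ Finset.range (n + 1), ∑ j ∈ Finset.range (n + 1), (if j + 2 * i ≤ n then
      ((n.choose i * choosePred (n - i - j) i : ℕ) : R) * x ^ i * (1 + x * y) ^ j *
        (1 + x) ^ (n - 2 * i - j) else 0) := by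
  rw [sum_fEntry_eq_coeff, sum_gammaEntry_eq_coeff, ← coeff_substDivOneSub]
  congr 1
  have hp (z : R) (k : ℕ) := one_sub_mul_pow_mul_inv z k
  have hUW := one_sub_X_mul_invOneSubPow_one (R := R)
  have hx := congrArg substDivOneSub (hp x n)
  have hxy := congrArg substDivOneSub (hp (x * y) 1)
  simp only [map_mul, map_sub, map_one, map_pow, map_add, substDivOneSub_C, substDivOneSub_X,
    pow_one] at hx hxy ⊢
  set W := (PowerSeries.invOneSubPow R 1 : PowerSeries R)
  set U := (PowerSeries.X : PowerSeries R)
  set a := PowerSeries.C x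
  set b := PowerSeries.C y
  -- The three factors of the H-side after T = U/(1-U), where W = 1/(1-U); the factors 1+x and 1+xy
  -- of the Γ-expansion appear here.
  have e1 : 1 - a * (U * W) = W * (1 - (1 + a) * U) := by linear_combination -hUW
  have e2 : 1 - a * b * (U * W) = W * (1 - (1 + a * b) * U) := by linear_combination -hUW
  have e3 : 1 + (1 - a) * (U * W) = W * (1 - a * U) := by linear_combination -hUW
  have h1 := hp (1 + x) 1
  have h2 := hp (1 + x * y) 1
  simp only [map_mul, map_one, map_add, pow_one] at h1 h2
  -- The source of the quadratic kernel: (1-U)(1-xU) = 1 - (1+x)U + xU².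
  have hk : oneAddSqKernel x (1 + x) * (1 - (1 + a) * U) = (1 - U) * (1 - a * U) := by
    rw [oneAddSqKernel]
    linear_combination (a * U ^ 2) * h1
  have hu : IsUnit ((1 - (1 + a) * U) ^ n * (1 - (1 + a * b) * U)) :=
    ((IsUnit.of_mul_eq_one _ h1).pow n).mul (IsUnit.of_mul_eq_one _ h2)
  apply hu.mul_right_cancel
  rw [e1, mul_pow] at hx
  rw [e2] at hxy
  rw [e3]
  generalize substDivOneSub (invOneSubMulPow x n) = p at *
  generalize substDivOneSub (invOneSubMulPow (x * y) 1) = q at *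
  generalize invOneSubMulPow (1 + x * y) 1 = r at *
  generalize oneAddSqKernel x (1 + x) = s at *
  change (1 - (1 + a * b) * U) * r = 1 at h2
  calc _ = (1 - U) ^ n * (1 - a * U) ^ n *
        ((W ^ n * (1 - (1 + a) * U) ^ n * p) * (W * (1 - (1 + a * b) * U) * q)) := by
        rw [mul_pow]; ring
    _ = ((1 - U) * (1 - a * U)) ^ n := by rw [hx, hxy, mul_pow]; ring
    _ = (s * (1 - (1 + a) * U)) ^ n * ((1 - (1 + a * b) * U) * r) := by rw [hk, h2, mul_one]
    _ = _ := by rw [mul_pow]; ring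

end Residue

/-! ### Uniqueness of the Γ-triangle. -/

lemma coeff_one_add_C_mul_Y_pow (a : ℤ[X]) (m j : ℕ) :
    ((1 + C a * Y : ℤ[X][Y]) ^ m).coeff j = (m.choose j : ℤ[X]) * a ^ j := by
  have := Polynomial.comp_C_mul_X_coeff (p := (1 + Y : ℤ[X][Y]) ^ m) (r := a) (n := j)
  rw [Polynomial.coeff_one_add_X_pow] at this
  rw [← this]
  simp

/-- The monomial x^(k+l) y^l is chosen because it occurs only when l ≤ j and i ≤ k, with coefficient
z at (i, j) = (k, l). This triangularity gives linear independence. -/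
lemma coeff_coeff_gammaTerm (z : ℤ) (i j e k l : ℕ) :
    (((z : ℤ[X][Y]) * (C X) ^ i * (1 + C X * Y) ^ j * (1 + C X) ^ e).coeff l).coeff (k + l) =
      z * (j.choose l * if i ≤ k then (e.choose (k - i) : ℤ) else 0) := by
  have h : ((z : ℤ[X][Y]) * (C X) ^ i * (1 + C X * Y) ^ j * (1 + C X) ^ e) =
      C (C z * (X ^ i * (1 + X) ^ e)) * (1 + C X * Y) ^ j := by
    simp
    ring
  rw [h, Polynomial.coeff_C_mul, coeff_one_add_C_mul_Y_pow]
  have h2 : (C z * (X ^ i * (1 + X) ^ e)) * ((j.choose l : ℤ[X]) * X ^ l) =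
      C (z * (j.choose l : ℤ)) * (X ^ i * (1 + X) ^ e) * X ^ l := by
    simp
    ring
  rw [h2, Polynomial.coeff_mul_X_pow, Polynomial.coeff_C_mul, Polynomial.coeff_X_pow_mul',
    Polynomial.coeff_one_add_X_pow]
  split_ifs <;> simp [mul_assoc]

/-- The polynomials `x^i (1 + x y)^j (1 + x)^(n - 2i - j)` are linearly independent. -/
lemma eq_zero_of_sum_gammaTerm_eq_zero (n : ℕ) (δ : ℕ → ℕ → ℤ)
    (h : ∑ i ∈ Finset.range (n + 1), ∑ j ∈ Finset.range (n + 1), (if j + 2 * i ≤ n then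
        (δ i j : ℤ[X][Y]) * (C X) ^ i * (1 + C X * Y) ^ j * (1 + C X) ^ (n - 2 * i - j) else 0) = 0)
    (k l : ℕ) (hkl : l + 2 * k ≤ n) : δ k l = 0 := by
  -- The outer induction disposes of all j > l, the inner one of i < k for j = l.
  induction hl : n - l using Nat.strong_induction_on generalizing k l with
  | _ t iht =>
  induction k using Nat.strong_induction_on with
  | _ k ihk =>
  have h1 := congrArg (fun p : ℤ[X][Y] => (p.coeff l).coeff (k + l)) h
  simp only [Polynomial.finsetSum_coeff, Polynomial.coeff_zero] at h1
  rw [Finset.sum_eq_single k, Finset.sum_eq_single l] at h1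
  · rw [if_pos hkl, coeff_coeff_gammaTerm] at h1
    simpa using h1
  · intro j _ hj
    split_ifs with hc
    · rw [coeff_coeff_gammaTerm]
      rcases lt_or_gt_of_ne hj with hj | hj
      · simp [Nat.choose_eq_zero_of_lt hj]
      · rw [iht (n - j) (by omega) k j hc rfl, zero_mul]
    · simp
  · intro hc; simp only [Finset.mem_range] at hc; omega
  · intro i _ hi
    apply Finset.sum_eq_zero
    intro j _
    split_ifs with hc
    · rw [coeff_coeff_gammaTerm]
      rcases lt_trichotomy j l with hj | hj | hj
      · simp [Nat.choose_eq_zero_of_lt hj]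
      · subst hj
        rcases lt_or_gt_of_ne hi with hi | hi
        · rw [ihk i hi (by omega), zero_mul]
        · rw [if_neg (by omega)]
          simp
      · rw [iht (n - j) (by omega) i j hc rfl, zero_mul]
    · simp
  · intro hc; simp only [Finset.mem_range] at hc; omega

section GammaTriangle

variable {V : Type*} [DecidableEq V] {Δ : LowerSet (Finset V)} {T : Finset V}

lemma IsGammaTriangle.unique {γ γ' : ℕ → ℕ → ℤ} (h : IsGammaTriangle Δ T γ)
    (h' : IsGammaTriangle Δ T γ') : γ = γ' := by
  funext k l
  by_cases hkl : l + 2 * k ≤ T.card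
  · have := eq_zero_of_sum_gammaTerm_eq_zero T.card (fun i j => γ i j - γ' i j) ?_ k l hkl
    · exact sub_eq_zero.mp this
    · refine Eq.trans ?_ (sub_eq_zero.mpr (h.2.symm.trans h'.2))
      rw [← Finset.sum_sub_distrib]
      refine Finset.sum_congr rfl fun i _ => ?_
      rw [← Finset.sum_sub_distrib]
      refine Finset.sum_congr rfl fun j _ => ?_
      split_ifs
      · push_cast; ring
      · simp
  · rw [h.1 k l (by omega), h'.1 k l (by omega)]

lemma isGammaTriangle_of_fTriangle
    (h : ∀ i j, fTriangle Δ T i j = T.card.choose (i + j) * (T.card + i - 1).choose i) :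
    IsGammaTriangle Δ T fun k l =>
      if l + 2 * k ≤ T.card then (T.card.choose k * choosePred (T.card - k - l) k : ℕ) else 0 := by
  refine ⟨fun i j hij => if_neg (by omega), ?_⟩
  rw [hTriangle]
  simp only [h]
  rw [sum_fEntry_eq_sum_gammaEntry (C X : ℤ[X][Y]) Y]
  refine Finset.sum_congr rfl fun i _ => Finset.sum_congr rfl fun j _ => ?_
  split_ifs
  · push_cast; ring
  · rfl

lemma gammaTriangle_of_fTriangle
    (h : ∀ i j, fTriangle Δ T i j = T.card.choose (i + j) * (T.card + i - 1).choose i) :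
    (∃! γ : ℕ → ℕ → ℤ, IsGammaTriangle Δ T γ) ∧
      ∀ γ : ℕ → ℕ → ℤ, IsGammaTriangle Δ T γ → ∀ k l : ℕ, l + 2 * k ≤ T.card →
        γ k l = T.card.choose k * choosePred (T.card - k - l) k := by
  have h0 := isGammaTriangle_of_fTriangle h
  refine ⟨⟨_, h0, fun γ hγ => hγ.unique h0⟩, fun γ hγ k l hkl => ?_⟩
  rw [hγ.unique h0]
  simp only [if_pos hkl]
  push_cast
  rfl

end GammaTriangle

end

noncomputable section

/-! ### Finite root systems in simple root coordinates -/

/-- A finite reduced crystallographic root system, given by the coordinates of its roots with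
respect to the simple roots. `cartan j i` is the value of the simple coroot `i` at the simple
root `j`, and `len i` is half of the squared length of the simple root `i`. -/
structure CoordRoots (S : Type*) [Fintype S] [DecidableEq S] where
  roots : Finset (S → ℤ)
  cartan : S → S → ℤ
  len : S → ℤ
  len_pos : ∀ i, 0 < len i
  len_symm : ∀ i j, cartan i j * len j = cartan j i * len i
  cartan_self : ∀ i, cartan i i = 2
  anisotropic : ∀ v : S → ℤ, ∑ i, ∑ j, v i * (cartan i j * len j) * v j = 0 → v = 0
  ne_zero : ∀ v ∈ roots, v ≠ 0
  single_mem : ∀ i, Pi.single i 1 ∈ roots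
  refl_mem : ∀ i, ∀ v ∈ roots, v - (∑ j, v j * cartan j i) • Pi.single i (1 : ℤ) ∈ roots
  neg_mem : ∀ v ∈ roots, -v ∈ roots
  nonneg_or_nonpos : ∀ v ∈ roots, 0 ≤ v ∨ v ≤ 0
  eq_or_eq_neg : ∀ i, ∀ v ∈ roots, (∀ j, j ≠ i → v j = 0) →
    v = Pi.single i 1 ∨ v = -Pi.single i 1

namespace CoordRoots

variable {S : Type*} [Fintype S] [DecidableEq S] (D : CoordRoots S)

/-- The simple root `α_i`. -/
abbrev simple (i : S) : S → ℤ := Pi.single i 1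

/-- The vector `v` is in the span of the simple roots in `I`. -/
def SuppIn (I : Finset S) (v : S → ℤ) : Prop := ∀ j, j ∉ I → v j = 0

/-- The pairing of `v` with the simple coroot `i`. -/
def pairing (i : S) : (S → ℤ) →ₗ[ℤ] ℤ where
  toFun v := ∑ j, v j * D.cartan j i
  map_add' v w := by simp [add_mul, Finset.sum_add_distrib]
  map_smul' c v := by simp [Finset.mul_sum, mul_assoc]

/-- The reflection in the simple root `α_i`. -/
def refl (i : S) : (S → ℤ) →ₗ[ℤ] (S → ℤ) :=
  LinearMap.id - (D.pairing i).smulRight (simple i)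

/-- The product of the reflections in the letters of a word, the first letter acting first. -/
def cox : List S → (S → ℤ) →ₗ[ℤ] (S → ℤ)
  | [] => LinearMap.id
  | i :: w => cox w ∘ₗ D.refl i

/-- The invariant bilinear form. -/
def form : LinearMap.BilinForm ℤ (S → ℤ) :=
  Matrix.toBilin' (Matrix.of fun i j => D.cartan i j * D.len j)

/-- The Euler form of the orientation given by a ranking `p` of the simple roots. -/
def euler (p : S → ℕ) : LinearMap.BilinForm ℤ (S → ℤ) :=
  Matrix.toBilin' (Matrix.of fun i j =>
    if i = j then D.len i else if p i < p j then D.cartan i j * D.len j else 0)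

lemma refl_apply (i : S) (v : S → ℤ) : D.refl i v = v - D.pairing i v • simple i := by
  simp [refl]

lemma refl_apply_of_ne {i j : S} (h : j ≠ i) (v : S → ℤ) : D.refl i v j = v j := by
  simp [refl_apply, h]

lemma pairing_simple (i j : S) : D.pairing i (simple j) = D.cartan j i := by
  simp [pairing, Pi.single_apply]

lemma refl_simple (i : S) : D.refl i (simple i) = -simple i := by
  rw [refl_apply, pairing_simple, D.cartan_self]
  module

lemma refl_refl (i : S) (v : S → ℤ) : D.refl i (D.refl i v) = v := by
  rw [D.refl_apply i v, map_sub, map_smul, refl_simple, refl_apply]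
  module

lemma refl_mem_roots (i : S) {v : S → ℤ} (hv : v ∈ D.roots) : D.refl i v ∈ D.roots := by
  rw [refl_apply]
  exact D.refl_mem i v hv

lemma cox_append (w w' : List S) (v : S → ℤ) : D.cox (w ++ w') v = D.cox w' (D.cox w v) := by
  induction w generalizing v with
  | nil => rfl
  | cons i w ih => exact ih _

lemma cox_mem_roots (w : List S) {v : S → ℤ} (hv : v ∈ D.roots) : D.cox w v ∈ D.roots := by
  induction w generalizing v with
  | nil => exact hv
  | cons i w ih => exact ih (D.refl_mem_roots i hv)

lemma cox_apply_of_notMem {w : List S} {j : S} (h : j ∉ w) (v : S → ℤ) : D.cox w v j = v j := by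
  induction w generalizing v with
  | nil => rfl
  | cons i w ih =>
    simp only [List.mem_cons, not_or] at h
    rw [cox, LinearMap.comp_apply, ih h.2, D.refl_apply_of_ne h.1]

lemma form_simple (v : S → ℤ) (k : S) : D.form v (simple k) = D.len k * D.pairing k v := by
  simp [form, Matrix.toBilin'_apply, pairing, Pi.single_apply, Finset.mul_sum]
  exact Finset.sum_congr rfl fun _ _ => by ring

lemma euler_simple (p : S → ℕ) (v : S → ℤ) (k : S) : D.euler p v (simple k) =
    ∑ j, v j * (if j = k then D.len j else if p j < p k then D.cartan j k * D.len k else 0) := by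
  simp [euler, Matrix.toBilin'_apply, Pi.single_apply]

lemma simple_euler (p : S → ℕ) (v : S → ℤ) (k : S) : D.euler p (simple k) v =
    ∑ j, (if k = j then D.len k else if p k < p j then D.cartan k j * D.len j else 0) * v j := by
  rw [euler, Matrix.toBilin'_apply, Finset.sum_eq_single k]
  · simp
  · intro i _ hi
    simp [hi]
  · simp

lemma euler_simple_simple (p : S → ℕ) (i k : S) : D.euler p (simple i) (simple k) =
    if i = k then D.len i else if p i < p k then D.cartan i k * D.len k else 0 := by
  rw [euler, Matrix.toBilin'_single, Matrix.of_apply]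

variable {p : S → ℕ}

lemma euler_simple_eq_zero {v : S → ℤ} {k : S} (h : ∀ j, v j ≠ 0 → p k < p j) :
    D.euler p v (simple k) = 0 := by
  rw [euler_simple]
  refine Finset.sum_eq_zero fun j _ => ?_
  by_cases hj : v j = 0
  · simp [hj]
  · have := h j hj
    rw [if_neg (by rintro rfl; omega), if_neg (by omega), mul_zero]

lemma simple_euler_eq_zero {v : S → ℤ} {k : S} (h : ∀ j, v j ≠ 0 → p j < p k) :
    D.euler p (simple k) v = 0 := by
  rw [simple_euler]
  refine Finset.sum_eq_zero fun j _ => ?_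
  by_cases hj : v j = 0
  · simp [hj]
  · have := h j hj
    rw [if_neg (by rintro rfl; omega), if_neg (by omega), zero_mul]

lemma euler_add_euler (hp : Function.Injective p) (v w : S → ℤ) :
    D.euler p v w + D.euler p w v = D.form v w := by
  simp only [euler, form, Matrix.toBilin'_apply, Matrix.of_apply]
  rw [Finset.sum_comm (f := fun i j => w i * _ * v j), ← Finset.sum_add_distrib]
  refine Finset.sum_congr rfl fun i _ => ?_
  rw [← Finset.sum_add_distrib]
  refine Finset.sum_congr rfl fun j _ => ?_
  by_cases h : i = j
  · subst h
    simp only [if_true, D.cartan_self]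
    ring
  · rw [if_neg h, if_neg (Ne.symm h)]
    rcases lt_or_gt_of_ne (hp.ne h) with h' | h'
    · rw [if_pos h', if_neg (by omega)]
      ring
    · rw [if_neg (by omega), if_pos h', D.len_symm i j]
      ring

lemma eq_zero_of_form_self {v : S → ℤ} (h : D.form v v = 0) : v = 0 :=
  D.anisotropic v (by simpa [form, Matrix.toBilin'_apply] using h)

lemma SuppIn.linearMap_eq {I : Finset S} {u : S → ℤ} (hu : SuppIn I u) {f g : (S → ℤ) →ₗ[ℤ] ℤ}
    (h : ∀ i ∈ I, f (simple i) = g (simple i)) : f u = g u := by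
  rw [LinearMap.pi_apply_eq_sum_univ f, LinearMap.pi_apply_eq_sum_univ g]
  refine Finset.sum_congr rfl fun i _ => ?_
  by_cases hi : i ∈ I
  · have := h i hi
    simp only [simple] at this
    convert congrArg (u i • ·) this using 2 <;> (congr 1; ext j; simp [Pi.single_apply, eq_comm])
  · rw [hu i hi, zero_smul, zero_smul]

omit [Fintype S] [DecidableEq S] in
lemma SuppIn.neg {I : Finset S} {u : S → ℤ} (hu : SuppIn I u) : SuppIn I (-u) := fun j hj => by
  simp [hu j hj]

omit [Fintype S] in
lemma suppIn_simple {I : Finset S} {i : S} (hi : i ∈ I) : SuppIn I (simple i) := fun j hj => by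
  have : j ≠ i := by rintro rfl; exact hj hi
  simp [this]

/-- Each letter i subtracts a multiple of α_i, and E(α_j, α_k) = 0 when j comes after k. So only the
letters up to k contribute, and their contributions telescope to the symmetric form of v and α_k. -/
lemma euler_sub_cox {w : List S} (hw : w.Pairwise (p · < p ·)) {k : S} (hk : k ∈ w)
    (v : S → ℤ) : D.euler p (v - D.cox w v) (simple k) = D.len k * D.pairing k v := by
  induction w generalizing v with
  | nil => simp at hk
  | cons i w ih =>
    rw [List.pairwise_cons] at hw
    have e : v - D.cox (i :: w) v =
        D.pairing i v • simple i + (D.refl i v - D.cox w (D.refl i v)) := by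
      rw [cox, LinearMap.comp_apply, D.refl_apply i v]
      module
    rw [e, map_add, map_smul, LinearMap.add_apply, LinearMap.smul_apply, euler_simple_simple]
    rcases List.mem_cons.mp hk with rfl | hk
    · rw [D.euler_simple_eq_zero, if_pos rfl]
      · simp [mul_comm]
      · intro j hj
        by_contra hc
        apply hj
        rw [Pi.sub_apply, D.cox_apply_of_notMem, sub_self]
        exact fun hm => hc (hw.1 j hm)
    · have hik := hw.1 k hk
      rw [ih hw.2 hk, if_neg (by rintro rfl; omega), if_pos hik, D.refl_apply i v, map_sub,
        map_smul, pairing_simple]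
      simp only [smul_eq_mul]
      ring

variable (p) in
/-- The word `w` lists the elements of `I` in increasing rank. -/
def IsWord (I : Finset S) (w : List S) : Prop :=
  w.Pairwise (p · < p ·) ∧ ∀ i, i ∈ w ↔ i ∈ I

variable {I : Finset S} {w : List S}

omit [Fintype S] [DecidableEq S] in
lemma IsWord.nodup (hw : IsWord p I w) : w.Nodup :=
  hw.1.imp fun {a b} h => by rintro rfl; exact lt_irrefl _ h

lemma SuppIn.cox (hw : IsWord p I w) {v : S → ℤ} (hv : SuppIn I v) : SuppIn I (D.cox w v) := by
  intro j hj
  rw [D.cox_apply_of_notMem (fun h => hj ((hw.2 j).mp h)), hv j hj]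

/-- By `euler_sub_cox`, E(v - cv, u) is the symmetric form of v and u, which is E(v, u) + E(u, v).
Applied twice, the identity makes E invariant under c on the span of I. -/
lemma euler_cox (hp : Function.Injective p) (hw : IsWord p I w) (v : S → ℤ) {u : S → ℤ}
    (hu : SuppIn I u) : D.euler p (D.cox w v) u = -D.euler p u v := by
  have h : D.euler p (v - D.cox w v) u = D.form v u :=
    hu.linearMap_eq fun i hi => by
      rw [D.euler_sub_cox hw.1 ((hw.2 i).mpr hi), form_simple]
  rw [map_sub, LinearMap.sub_apply, ← D.euler_add_euler hp] at h
  linarith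

lemma pairing_eq_zero_of_cox_eq (hw : IsWord p I w) {v : S → ℤ} (h : D.cox w v = v) {k : S}
    (hk : k ∈ I) : D.pairing k v = 0 := by
  have := D.euler_sub_cox hw.1 ((hw.2 k).mpr hk) v
  rw [h, sub_self, map_zero, LinearMap.zero_apply, eq_comm, mul_eq_zero] at this
  exact this.resolve_left (D.len_pos k).ne'

/-- A fixed vector is orthogonal to every simple root of I, hence to itself. The lemma serves to
show that sums over orbits of c vanish. -/
lemma eq_zero_of_cox_eq (hw : IsWord p I w) {v : S → ℤ} (hv : SuppIn I v)
    (h : D.cox w v = v) : v = 0 := by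
  apply D.eq_zero_of_form_self
  rw [hv.linearMap_eq (f := D.form v) (g := 0), LinearMap.zero_apply]
  intro i hi
  rw [form_simple, D.pairing_eq_zero_of_cox_eq hw h hi, mul_zero, LinearMap.zero_apply]

/-! ### Piecewise linear reflections -/

open Classical in
/-- The piecewise linear reflection in `α_i`. -/
def plRefl (i : S) (v : S → ℤ) : S → ℤ :=
  if ∃ j, j ≠ i ∧ v = -simple j then v else D.refl i v

/-- The piecewise linear version of `cox`. -/
def plCox : List S → (S → ℤ) → (S → ℤ)
  | [], v => v
  | i :: w, v => plCox w (D.plRefl i v)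

omit [Fintype S] in
lemma simple_nonneg (i : S) : 0 ≤ (simple i : S → ℤ) := by
  intro j
  by_cases h : j = i <;> simp [h]

omit [Fintype S] in
lemma simple_injective : Function.Injective (simple : S → S → ℤ) := fun i j h => by
  by_contra hc
  have := congrFun h i
  simp [hc] at this

omit [Fintype S] in
lemma not_nonneg_neg_simple (i : S) : ¬ 0 ≤ (-simple i : S → ℤ) := fun h => by
  have := h i
  simp at this

omit [Fintype S] in
lemma ne_neg_simple {v : S → ℤ} (hv : 0 ≤ v) (i : S) : v ≠ -simple i := by
  rintro rfl
  exact not_nonneg_neg_simple i hv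

lemma plRefl_neg_simple_of_ne {i j : S} (h : j ≠ i) :
    D.plRefl i (-simple j) = -simple j := if_pos ⟨j, h, rfl⟩

lemma plRefl_neg_simple (i : S) : D.plRefl i (-simple i) = simple i := by
  rw [plRefl, if_neg, map_neg, refl_simple, neg_neg]
  rintro ⟨j, hj, h⟩
  exact hj (simple_injective (neg_injective h)).symm

lemma plRefl_of_nonneg (i : S) {v : S → ℤ} (hv : 0 ≤ v) : D.plRefl i v = D.refl i v :=
  if_neg fun ⟨j, _, h⟩ => ne_neg_simple hv j h

/-- The reflection changes only the coordinate i. If the image is nonpositive, all other coordinates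
vanish, and then v is ±α_i. -/
lemma refl_nonneg {i : S} {v : S → ℤ} (hv : v ∈ D.roots) (h0 : 0 ≤ v) (h : v ≠ simple i) :
    0 ≤ D.refl i v := by
  rcases D.nonneg_or_nonpos _ (D.refl_mem_roots i hv) with h1 | h1
  · exact h1
  · rcases D.eq_or_eq_neg i v hv fun j hj => le_antisymm
      (by have := h1 j; rwa [D.refl_apply_of_ne hj] at this) (h0 j) with h2 | h2
    · exact absurd h2 h
    · exact absurd h2 (ne_neg_simple h0 i)

lemma plCox_append (w w' : List S) (v : S → ℤ) :
    D.plCox (w ++ w') v = D.plCox w' (D.plCox w v) := by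
  induction w generalizing v with
  | nil => rfl
  | cons i w ih => exact ih _

lemma plCox_neg_simple_of_notMem {i : S} (h : i ∉ w) : D.plCox w (-simple i) = -simple i := by
  induction w with
  | nil => rfl
  | cons j w ih =>
    simp only [List.mem_cons, not_or] at h
    rw [plCox, D.plRefl_neg_simple_of_ne h.1, ih h.2]

/-- The nonzero coordinate at i is never touched, so no intermediate root is the simple root about
to be reflected. -/
lemma plCox_of_pos_of_notMem {i : S} (h : i ∉ w) {v : S → ℤ} (hv : v ∈ D.roots) (h0 : 0 ≤ v)
    (hi : v i ≠ 0) : D.plCox w v = D.cox w v ∧ 0 ≤ D.cox w v := by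
  induction w generalizing v with
  | nil => exact ⟨rfl, h0⟩
  | cons j w ih =>
    simp only [List.mem_cons, not_or] at h
    rw [plCox, cox, LinearMap.comp_apply, D.plRefl_of_nonneg j h0]
    refine ih h.2 (D.refl_mem_roots j hv) (D.refl_nonneg hv h0 ?_) ?_
    · rintro rfl
      simp [h.1] at hi
    · rwa [D.refl_apply_of_ne h.1]

/-- A positive root turns negative only by reaching α_i just before the letter i. From then on -α_i
stays fixed, since i does not recur. -/
lemma plCox_cases_aux (hw : w.Nodup) {v : S → ℤ} (hv : v ∈ D.roots) (h0 : 0 ≤ v) :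
    (D.plCox w v = D.cox w v ∧ 0 ≤ D.cox w v) ∨
      ∃ i w₁ w₂, w = w₁ ++ i :: w₂ ∧ D.cox w₁ v = simple i ∧ D.plCox w v = -simple i := by
  induction w generalizing v with
  | nil => exact Or.inl ⟨rfl, h0⟩
  | cons i w ih =>
    rw [List.nodup_cons] at hw
    by_cases h : v = simple i
    · refine Or.inr ⟨i, [], w, rfl, h, ?_⟩
      rw [plCox, D.plRefl_of_nonneg i h0, h, refl_simple, D.plCox_neg_simple_of_notMem hw.1]
    · rw [plCox, cox, LinearMap.comp_apply, D.plRefl_of_nonneg i h0]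
      rcases ih hw.2 (D.refl_mem_roots i hv) (D.refl_nonneg hv h0 h) with h1 | ⟨j, w₁, w₂, h1, h2, h3⟩
      · exact Or.inl h1
      · refine Or.inr ⟨j, i :: w₁, w₂, by rw [h1]; rfl, h2, h3⟩

variable (p) in
/-- The positive root `v` is sent to the negative simple root `-α_i` by `plCox w`. -/
structure IsProjective (I : Finset S) (w : List S) (i : S) (v : S → ℤ) : Prop where
  mem : i ∈ I
  plCox_eq : D.plCox w v = -simple i
  cox_nonpos : D.cox w v ≤ 0
  euler_eq : ∀ u, SuppIn I u → D.euler p u v = D.len i * u i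
  plCox_neg_simple : D.plCox w (-simple i) = -D.cox w v

/-- In the exceptional case v is α_i plus a combination of earlier simple roots. Evaluating E(α_m,
v) for m before, at and after i gives the characteristic property of an indecomposable projective or
injective in quiver representations. -/
lemma plCox_cases (hp : Function.Injective p) (hw : IsWord p I w) {v : S → ℤ} (hv : v ∈ D.roots)
    (h0 : 0 ≤ v) :
    (D.plCox w v = D.cox w v ∧ 0 ≤ D.cox w v) ∨ ∃ i, D.IsProjective p I w i v := by
  rcases D.plCox_cases_aux hw.nodup hv h0 with h | ⟨i, w₁, w₂, rfl, h2, h3⟩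
  · exact Or.inl h
  · have hn := hw.nodup
    have hs := hw.1
    simp only [List.nodup_append, List.nodup_cons, List.pairwise_append, List.pairwise_cons] at hn hs
    have hi1 : i ∉ w₁ := fun h => hn.2.2 i h i (by simp) rfl
    have h4 := D.plCox_of_pos_of_notMem hn.2.1.1 (D.single_mem i) (simple_nonneg i) (by simp)
    have h5 : D.cox (w₁ ++ i :: w₂) v = -D.cox w₂ (simple i) := by
      rw [cox_append, h2, cox, LinearMap.comp_apply, refl_simple, map_neg]
    refine Or.inr ⟨i, (hw.2 i).mp (by simp), h3, ?_, ?_, ?_⟩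
    · rw [h5]
      exact neg_nonpos.mpr h4.2
    · intro u hu
      have e : v = simple i + (v - D.cox w₁ v) := by rw [h2]; module
      have hsupp (j : S) (hj : (v - D.cox w₁ v) j ≠ 0) : j ∈ w₁ := by
        by_contra hc
        apply hj
        rw [Pi.sub_apply, D.cox_apply_of_notMem hc, sub_self]
      have hlin := hu.linearMap_eq (f := LinearMap.flip (D.euler p) v)
        (g := D.len i • LinearMap.proj i) ?_
      · simpa using hlin
      · intro m hm
        simp only [LinearMap.flip_apply, LinearMap.smul_apply, LinearMap.proj_apply, smul_eq_mul]
        rw [← hw.2 m, List.mem_append, List.mem_cons] at hm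
        rcases hm with hm | rfl | hm
        -- For m before i, `euler_sub_cox` for the prefix makes E(v, α_m) the whole symmetric form
        -- of v and α_m, so E(α_m, v) = 0.
        · have hpm : p m < p i := hs.2.2 m hm i (by simp)
          have hmi : m ≠ i := by rintro rfl; omega
          have h6 := D.euler_sub_cox hs.1 hm v
          rw [h2, map_sub, LinearMap.sub_apply, euler_simple_simple, if_neg hmi.symm,
            if_neg (by omega), sub_zero] at h6
          have h7 := D.euler_add_euler hp v (simple m)
          rw [form_simple] at h7
          have : (simple m : S → ℤ) i = 0 := by simp [hmi.symm]
          rw [this]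
          linarith
        · rw [e, map_add, euler_simple_simple, if_pos rfl, D.simple_euler_eq_zero]
          · simp
          · intro j hj
            exact hs.2.2 j (hsupp j hj) m (by simp)
        · have hpm : p i < p m := hs.2.1.1 m hm
          have hmi : m ≠ i := by rintro rfl; omega
          rw [D.simple_euler_eq_zero]
          · simp [hmi.symm]
          · intro j hj
            by_cases hji : j = i
            · rw [hji]; exact hpm
            · have : j ∈ w₁ := hsupp j (by rw [e] at hj; simpa [hji] using hj)
              exact hs.2.2 j this m (by simp [hm])
    · rw [h5, neg_neg, plCox_append, D.plCox_neg_simple_of_notMem hi1, plCox,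
        D.plRefl_neg_simple, h4.1]

end CoordRoots

end

noncomputable section

namespace CoordRoots

variable {S : Type*} [Fintype S] [DecidableEq S] (D : CoordRoots S)

/-! ### Compatibility of almost positive roots -/

open Classical in
/-- The roots in the span of the simple roots in `I`. -/
def rootsIn (I : Finset S) : Finset (S → ℤ) := D.roots.filter (SuppIn I)

open Classical in
/-- The almost positive roots in the span of the simple roots in `I`. -/
def almostPos (I : Finset S) : Finset (S → ℤ) :=
  (D.rootsIn I).filter fun v => 0 ≤ v ∨ ∃ i, v = -simple i

/-- Compatibility of almost positive roots in terms of the Euler form. -/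
def Rel (p : S → ℕ) (v u : S → ℤ) : Prop :=
  (0 ≤ v → 0 ≤ u → 0 ≤ D.euler p v u ∧ 0 ≤ D.euler p u v) ∧
    (∀ i, v = -simple i → u i ≤ 0) ∧ ∀ i, u = -simple i → v i ≤ 0

variable {p : S → ℕ} {I : Finset S} {w : List S}

lemma mem_rootsIn {v : S → ℤ} : v ∈ D.rootsIn I ↔ v ∈ D.roots ∧ SuppIn I v := by
  simp [rootsIn]

lemma mem_almostPos {v : S → ℤ} : v ∈ D.almostPos I ↔
    v ∈ D.roots ∧ SuppIn I v ∧ (0 ≤ v ∨ ∃ i, v = -simple i) := by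
  simp [almostPos, mem_rootsIn, and_assoc]

omit [Fintype S] in
lemma suppIn_neg_simple_iff {i : S} : SuppIn I (-simple i) ↔ i ∈ I := by
  refine ⟨fun h => ?_, fun h => (suppIn_simple h).neg⟩
  by_contra hi
  simpa using h i hi

lemma neg_simple_mem_almostPos {i : S} : -simple i ∈ D.almostPos I ↔ i ∈ I := by
  rw [mem_almostPos, suppIn_neg_simple_iff]
  exact ⟨fun h => h.2.1, fun h => ⟨D.neg_mem _ (D.single_mem i), h, Or.inr ⟨i, rfl⟩⟩⟩

lemma rel_comm {v u : S → ℤ} : D.Rel p v u ↔ D.Rel p u v := by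
  unfold Rel
  constructor <;> rintro ⟨h1, h2, h3⟩ <;> exact ⟨fun a b => (h1 b a).symm, h3, h2⟩

lemma rel_of_nonneg {v u : S → ℤ} (hv : 0 ≤ v) (hu : 0 ≤ u) :
    D.Rel p v u ↔ 0 ≤ D.euler p v u ∧ 0 ≤ D.euler p u v :=
  ⟨fun h => h.1 hv hu, fun h => ⟨fun _ _ => h, fun i hi => absurd hi (ne_neg_simple hv i),
    fun i hi => absurd hi (ne_neg_simple hu i)⟩⟩

lemma rel_neg_simple_of_nonneg {i : S} {u : S → ℤ} (hu : 0 ≤ u) :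
    D.Rel p (-simple i) u ↔ u i ≤ 0 := by
  refine ⟨fun h => h.2.1 i rfl, fun h => ⟨fun h0 => absurd h0 (not_nonneg_neg_simple i), ?_,
    fun j hj => absurd hj (ne_neg_simple hu j)⟩⟩
  intro j hj
  rwa [← simple_injective (neg_injective hj)]

lemma rel_neg_simple_neg_simple (i j : S) : D.Rel p (-simple i) (-simple j) := by
  have h (i j : S) : (-simple i : S → ℤ) j ≤ 0 := by
    have := simple_nonneg i j
    simpa using this
  exact ⟨fun h0 => absurd h0 (not_nonneg_neg_simple i), fun _ _ => h _ _, fun _ _ => h _ _⟩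

lemma plCox_neg_simple_nonneg (hw : w.Nodup) {i : S} (hi : i ∈ w) :
    0 ≤ D.plCox w (-simple i) := by
  obtain ⟨w₁, w₂, rfl⟩ := List.append_of_mem hi
  simp only [List.nodup_append, List.nodup_cons] at hw
  have hi1 : i ∉ w₁ := fun h => hw.2.2 i h i (by simp) rfl
  have h := D.plCox_of_pos_of_notMem hw.2.1.1 (D.single_mem i) (simple_nonneg i) (by simp)
  rw [plCox_append, D.plCox_neg_simple_of_notMem hi1, plCox, D.plRefl_neg_simple, h.1]
  exact h.2

lemma plRefl_mem_almostPos {i : S} (hi : i ∈ I) {v : S → ℤ} (hv : v ∈ D.almostPos I) :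
    D.plRefl i v ∈ D.almostPos I ∧ D.plRefl i (D.plRefl i v) = v := by
  have hv' := hv
  rw [mem_almostPos] at hv
  obtain ⟨h1, h2, h0 | ⟨j, rfl⟩⟩ := hv
  · rw [D.plRefl_of_nonneg i h0]
    by_cases h : v = simple i
    · rw [h, refl_simple, plRefl_neg_simple]
      exact ⟨D.neg_simple_mem_almostPos.mpr hi, rfl⟩
    · have h3 := D.refl_nonneg h1 h0 h
      rw [D.plRefl_of_nonneg i h3, refl_refl]
      refine ⟨D.mem_almostPos.mpr ⟨D.refl_mem_roots i h1, fun j hj => ?_, Or.inl h3⟩, rfl⟩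
      rw [D.refl_apply_of_ne (by rintro rfl; exact hj hi), h2 j hj]
  · by_cases h : j = i
    · subst h
      rw [plRefl_neg_simple, D.plRefl_of_nonneg j (simple_nonneg j), refl_simple]
      exact ⟨D.mem_almostPos.mpr ⟨D.single_mem j, suppIn_simple hi, Or.inl (simple_nonneg j)⟩, rfl⟩
    · rw [D.plRefl_neg_simple_of_ne h, D.plRefl_neg_simple_of_ne h]
      exact ⟨hv', rfl⟩

lemma plCox_mem_almostPos_aux (hw : ∀ i ∈ w, i ∈ I) {v : S → ℤ} (hv : v ∈ D.almostPos I) :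
    D.plCox w v ∈ D.almostPos I := by
  induction w generalizing v with
  | nil => exact hv
  | cons i w ih =>
    exact ih (fun j hj => hw j (by simp [hj])) (D.plRefl_mem_almostPos (hw i (by simp)) hv).1

lemma plCox_injOn_aux (hw : ∀ i ∈ w, i ∈ I) : Set.InjOn (D.plCox w) (D.almostPos I) := by
  induction w with
  | nil => exact fun _ _ _ _ h => h
  | cons i w ih =>
    intro v hv u hu h
    have hi := hw i (by simp)
    have h1 := D.plRefl_mem_almostPos hi hv
    have h2 := D.plRefl_mem_almostPos hi hu
    rw [← h1.2, ← h2.2, ih (fun j hj => hw j (by simp [hj])) h1.1 h2.1 h]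

lemma plCox_mem_almostPos (hw : IsWord p I w) {v : S → ℤ} (hv : v ∈ D.almostPos I) :
    D.plCox w v ∈ D.almostPos I :=
  D.plCox_mem_almostPos_aux (fun i hi => (hw.2 i).mp hi) hv

lemma plCox_injOn (hw : IsWord p I w) : Set.InjOn (D.plCox w) (D.almostPos I) :=
  D.plCox_injOn_aux fun i hi => (hw.2 i).mp hi

lemma plCox_surjOn (hw : IsWord p I w) :
    Set.SurjOn (D.plCox w) (D.almostPos I) (D.almostPos I) :=
  Finset.surjOn_of_injOn_of_card_le _ (fun _ hv => D.plCox_mem_almostPos hw hv)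
    (D.plCox_injOn hw) le_rfl

/-- The map τ is injective on a finite set, so -α_i has a preimage; this preimage is positive
because τ sends every negative simple root of I to a positive root. -/
lemma exists_isProjective (hp : Function.Injective p) (hw : IsWord p I w) {i : S} (hi : i ∈ I) :
    ∃ v ∈ D.rootsIn I, 0 ≤ v ∧ D.IsProjective p I w i v := by
  obtain ⟨v, hv, h⟩ := D.plCox_surjOn hw (D.neg_simple_mem_almostPos.mpr hi)
  have hv' := D.mem_almostPos.mp hv
  obtain ⟨h1, h2, h0 | ⟨j, rfl⟩⟩ := hv'
  · refine ⟨v, D.mem_rootsIn.mpr ⟨h1, h2⟩, h0, ?_⟩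
    rcases D.plCox_cases hp hw h1 h0 with h3 | ⟨j, h3⟩
    · rw [h3.1] at h
      exact absurd h (ne_neg_simple h3.2 i)
    · have := simple_injective (neg_injective (h.symm.trans h3.plCox_eq))
      rwa [this]
  · refine absurd h (ne_neg_simple (D.plCox_neg_simple_nonneg hw.nodup ?_) i)
    rw [hw.2, ← suppIn_neg_simple_iff]
    exact h2

variable {D} in
lemma IsProjective.euler_plCox (hp : Function.Injective p) (hw : IsWord p I w) {i : S}
    {v : S → ℤ} (h : D.IsProjective p I w i v) {u : S → ℤ} (hu : SuppIn I u) :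
    D.euler p (D.plCox w (-simple i)) u = D.len i * u i := by
  rw [h.plCox_neg_simple, map_neg, LinearMap.neg_apply, D.euler_cox hp hw v hu, neg_neg,
    h.euler_eq u hu]

lemma almostPos_cases (hp : Function.Injective p) (hw : IsWord p I w) {v : S → ℤ}
    (hv : v ∈ D.almostPos I) :
    (0 ≤ v ∧ D.plCox w v = D.cox w v ∧ 0 ≤ D.cox w v) ∨
      (0 ≤ v ∧ ∃ i, D.IsProjective p I w i v) ∨
      ∃ i u, v = -simple i ∧ D.IsProjective p I w i u := by
  obtain ⟨h1, h2, h0 | ⟨j, rfl⟩⟩ := D.mem_almostPos.mp hv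
  · rcases D.plCox_cases hp hw h1 h0 with h3 | h3
    · exact Or.inl ⟨h0, h3⟩
    · exact Or.inr (Or.inl ⟨h0, h3⟩)
  · obtain ⟨u, -, -, hu⟩ := D.exists_isProjective hp hw (suppIn_neg_simple_iff.mp h2)
    exact Or.inr (Or.inr ⟨j, u, rfl, hu⟩)

lemma mul_len_nonneg_iff (i : S) (z : ℤ) : 0 ≤ D.len i * z ↔ 0 ≤ z :=
  mul_nonneg_iff_of_pos_left (D.len_pos i)

/-- Each of v and u either stays positive, becomes negative simple, or is negative simple. In the
first case E is transported by `euler_cox`; in the other two its values are read off as the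
coordinates that define compatibility with -α_i. Any remaining condition is a coordinate of a
positive root, hence automatic. -/
lemma rel_plCox_plCox (hp : Function.Injective p) (hw : IsWord p I w) {v u : S → ℤ}
    (hv : v ∈ D.almostPos I) (hu : u ∈ D.almostPos I) :
    D.Rel p (D.plCox w v) (D.plCox w u) ↔ D.Rel p v u := by
  have hsupp {x : S → ℤ} (hx : x ∈ D.almostPos I) : SuppIn I x := (D.mem_almostPos.mp hx).2.1
  have hpl {i : S} {x : S → ℤ} (hx : D.IsProjective p I w i x) : 0 ≤ D.plCox w (-simple i) :=
    D.plCox_neg_simple_nonneg hw.nodup ((hw.2 i).mpr hx.mem)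
  have hAB {v u : S → ℤ} {i : S} (hv : v ∈ D.almostPos I) (hu : u ∈ D.almostPos I)
      (hv0 : 0 ≤ v) (hv1 : D.plCox w v = D.cox w v) (hv2 : 0 ≤ D.cox w v) (hu0 : 0 ≤ u)
      (hui : D.IsProjective p I w i u) :
      D.Rel p (D.plCox w v) (D.plCox w u) ↔ D.Rel p v u := by
    rw [hv1, hui.plCox_eq, rel_comm, D.rel_neg_simple_of_nonneg hv2, D.rel_of_nonneg hv0 hu0,
      hui.euler_eq v (hsupp hv), mul_len_nonneg_iff]
    have h := D.euler_cox hp hw v (hsupp hu)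
    rw [hui.euler_eq _ ((hsupp hv).cox D hw)] at h
    have h1 : D.euler p u v = D.len i * -(D.cox w v i) := by linarith
    rw [h1, mul_len_nonneg_iff, neg_nonneg]
    exact ⟨fun h2 => ⟨hv0 i, h2⟩, fun h2 => h2.2⟩
  have hAC {v : S → ℤ} {i : S} {x : S → ℤ} (hv : v ∈ D.almostPos I)
      (hu : -simple i ∈ D.almostPos I)
      (hv0 : 0 ≤ v) (hv1 : D.plCox w v = D.cox w v) (hv2 : 0 ≤ D.cox w v)
      (hx : D.IsProjective p I w i x) :
      D.Rel p (D.plCox w v) (D.plCox w (-simple i)) ↔ D.Rel p v (-simple i) := by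
    rw [hv1, D.rel_of_nonneg hv2 (hpl hx), D.rel_comm (u := -simple i),
      D.rel_neg_simple_of_nonneg hv0, hx.euler_plCox hp hw ((hsupp hv).cox D hw),
      D.euler_cox hp hw v (hsupp (D.plCox_mem_almostPos hw hu)),
      hx.euler_plCox hp hw (hsupp hv), ← mul_neg, mul_len_nonneg_iff, mul_len_nonneg_iff,
      neg_nonneg]
    exact ⟨fun h2 => h2.1, fun h2 => ⟨h2, hv2 i⟩⟩
  have hBC {v : S → ℤ} {i j : S} {x : S → ℤ} (hv : v ∈ D.almostPos I)
      (hu : -simple j ∈ D.almostPos I) (hv0 : 0 ≤ v)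
      (hvi : D.IsProjective p I w i v) (hx : D.IsProjective p I w j x) :
      D.Rel p (D.plCox w v) (D.plCox w (-simple j)) ↔ D.Rel p v (-simple j) := by
    have h := (hx.euler_plCox hp hw (hsupp hv)).symm.trans
      (hvi.euler_eq _ (hsupp (D.plCox_mem_almostPos hw hu)))
    rw [hvi.plCox_eq, D.rel_neg_simple_of_nonneg (hpl hx), D.rel_comm (u := -simple j),
      D.rel_neg_simple_of_nonneg hv0, ← neg_nonneg, ← D.mul_len_nonneg_iff i, mul_neg, ← h,
      ← mul_neg, mul_len_nonneg_iff, neg_nonneg]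
  rcases D.almostPos_cases hp hw hv with ⟨hv0, hv1, hv2⟩ | ⟨hv0, i, hvi⟩ | ⟨i, x, rfl, hvi⟩ <;>
    rcases D.almostPos_cases hp hw hu with ⟨hu0, hu1, hu2⟩ | ⟨hu0, j, huj⟩ | ⟨j, y, rfl, huj⟩
  · rw [hv1, hu1, D.rel_of_nonneg hv2 hu2, D.rel_of_nonneg hv0 hu0,
      D.euler_cox hp hw _ ((hsupp hu).cox D hw), D.euler_cox hp hw _ (hsupp hv),
      D.euler_cox hp hw _ ((hsupp hv).cox D hw), D.euler_cox hp hw _ (hsupp hu), neg_neg, neg_neg]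
  · exact hAB hv hu hv0 hv1 hv2 hu0 huj
  · exact hAC hv hu hv0 hv1 hv2 huj
  · rw [D.rel_comm, D.rel_comm (v := v)]
    exact hAB hu hv hu0 hu1 hu2 hv0 hvi
  · rw [hvi.plCox_eq, huj.plCox_eq, D.rel_of_nonneg hv0 hu0, huj.euler_eq v (hsupp hv),
      hvi.euler_eq u (hsupp hu), mul_len_nonneg_iff, mul_len_nonneg_iff]
    exact ⟨fun _ => ⟨hv0 j, hu0 i⟩, fun _ => D.rel_neg_simple_neg_simple i j⟩
  · exact hBC hv hu hv0 hvi huj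
  · rw [D.rel_comm, D.rel_comm (v := -simple i)]
    exact hAC hu hv hu0 hu1 hu2 hvi
  · rw [D.rel_comm, D.rel_comm (v := -simple i)]
    exact hBC hu hv hu0 huj hvi
  · rw [D.rel_of_nonneg (hpl hvi) (hpl huj),
      hvi.euler_plCox hp hw (hsupp (D.plCox_mem_almostPos hw hu)),
      huj.euler_plCox hp hw (hsupp (D.plCox_mem_almostPos hw hv)), mul_len_nonneg_iff,
      mul_len_nonneg_iff]
    exact ⟨fun _ => D.rel_neg_simple_neg_simple i j, fun _ => ⟨hpl huj i, hpl hvi j⟩⟩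

lemma iterate_plCox_mem_almostPos (hw : IsWord p I w) {v : S → ℤ} (hv : v ∈ D.almostPos I)
    (m : ℕ) : (D.plCox w)^[m] v ∈ D.almostPos I := by
  induction m with
  | zero => exact hv
  | succ m ih => rw [Function.iterate_succ_apply']; exact D.plCox_mem_almostPos hw ih

lemma rel_iterate_plCox (hp : Function.Injective p) (hw : IsWord p I w) {v u : S → ℤ}
    (hv : v ∈ D.almostPos I) (hu : u ∈ D.almostPos I) (m : ℕ) :
    D.Rel p ((D.plCox w)^[m] v) ((D.plCox w)^[m] u) ↔ D.Rel p v u := by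
  induction m with
  | zero => rfl
  | succ m ih =>
    rw [Function.iterate_succ_apply', Function.iterate_succ_apply',
      D.rel_plCox_plCox hp hw (D.iterate_plCox_mem_almostPos hw hv m)
        (D.iterate_plCox_mem_almostPos hw hu m), ih]

lemma exists_iterate_plCox_eq_self (hw : IsWord p I w) {v : S → ℤ} (hv : v ∈ D.almostPos I) :
    ∃ m, 0 < m ∧ (D.plCox w)^[m] v = v := by
  let f : D.almostPos I → D.almostPos I := fun u => ⟨D.plCox w u, D.plCox_mem_almostPos hw u.2⟩
  have hf : Function.Injective f := fun a b h =>
    Subtype.ext (D.plCox_injOn hw a.2 b.2 (congrArg Subtype.val h))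
  obtain ⟨m, hm, h⟩ := hf.mem_periodicPts ⟨v, hv⟩
  refine ⟨m, hm, ?_⟩
  have key (k : ℕ) : ((f^[k] ⟨v, hv⟩ : D.almostPos I) : S → ℤ) = (D.plCox w)^[k] v := by
    induction k with
    | zero => rfl
    | succ k ih => rw [Function.iterate_succ_apply', Function.iterate_succ_apply', ← ih]
  rw [← key, h]

/-- Every orbit of the piecewise linear Coxeter element contains a negative simple root. -/
lemma exists_iterate_plCox_eq_neg_simple (hp : Function.Injective p) (hw : IsWord p I w)
    {v : S → ℤ} (hv : v ∈ D.almostPos I) : ∃ m i, (D.plCox w)^[m] v = -simple i := by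
  by_contra! hc
  have hpos (m : ℕ) : 0 ≤ (D.plCox w)^[m] v := by
    obtain ⟨-, -, h | ⟨i, h⟩⟩ := D.mem_almostPos.mp (D.iterate_plCox_mem_almostPos hw hv m)
    · exact h
    · exact absurd h (hc m i)
  have hstep (m : ℕ) : D.cox w ((D.plCox w)^[m] v) = (D.plCox w)^[m + 1] v := by
    rw [Function.iterate_succ_apply']
    rcases D.almostPos_cases hp hw (D.iterate_plCox_mem_almostPos hw hv m) with
      ⟨-, h, -⟩ | ⟨-, i, h⟩ | ⟨i, -, h, -⟩
    · exact h.symm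
    · exact absurd (by rw [Function.iterate_succ_apply']; exact h.plCox_eq) (hc (m + 1) i)
    · exact absurd h (hc m i)
  -- An orbit of positive roots only is an orbit of the linear map c. Its sum is fixed by c, hence
  -- zero, which is impossible for positive vectors.
  obtain ⟨N, hN, hper⟩ := D.exists_iterate_plCox_eq_self hw hv
  have hx : D.cox w (∑ m ∈ Finset.range N, (D.plCox w)^[m] v) =
      ∑ m ∈ Finset.range N, (D.plCox w)^[m] v := by
    rw [map_sum, Finset.sum_congr rfl fun m _ => hstep m]
    have h1 := Finset.sum_range_succ (fun m => (D.plCox w)^[m] v) N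
    rw [Finset.sum_range_succ', hper] at h1
    exact add_right_cancel h1
  have hx0 := D.eq_zero_of_cox_eq hw (fun j hj => by
    rw [Finset.sum_apply]
    exact Finset.sum_eq_zero fun m _ =>
      (D.mem_almostPos.mp (D.iterate_plCox_mem_almostPos hw hv m)).2.1 j hj) hx
  have h0 := (Finset.sum_eq_zero_iff_of_nonneg fun m _ => hpos m).mp hx0 0 (by simpa)
  exact D.ne_zero v (D.mem_almostPos.mp hv).1 h0

/-- The Euler form describes compatibility. -/
lemma rel_iff_forall_iterate (hp : Function.Injective p) (hw : IsWord p I w) {v u : S → ℤ}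
    (hv : v ∈ D.almostPos I) (hu : u ∈ D.almostPos I) :
    D.Rel p v u ↔ ∀ m i, (D.plCox w)^[m] v = -simple i → (D.plCox w)^[m] u i ≤ 0 := by
  constructor
  · intro h m i hm
    exact ((D.rel_iterate_plCox hp hw hv hu m).mpr h).2.1 i hm
  · intro h
    -- It suffices to test the one instant at which the orbit of v meets a negative simple root, by
    -- invariance of the relation.
    obtain ⟨m, i, hm⟩ := D.exists_iterate_plCox_eq_neg_simple hp hw hv
    rw [← D.rel_iterate_plCox hp hw hv hu m]
    have hi := h m i hm
    obtain ⟨-, -, h0 | ⟨j, hj⟩⟩ := D.mem_almostPos.mp (D.iterate_plCox_mem_almostPos hw hu m)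
    · rwa [hm, D.rel_neg_simple_of_nonneg h0]
    · rw [hm, hj]
      exact D.rel_neg_simple_neg_simple i j

end CoordRoots

end

noncomputable section

namespace CoordRoots

variable {S : Type*} [Fintype S] [DecidableEq S] (D : CoordRoots S)
variable {p : S → ℕ} {I : Finset S} {w : List S}

/-! ### Orbits of a Coxeter element -/

lemma cox_mem_rootsIn (hw : IsWord p I w) {v : S → ℤ} (hv : v ∈ D.rootsIn I) :
    D.cox w v ∈ D.rootsIn I := by
  rw [mem_rootsIn] at hv ⊢
  exact ⟨D.cox_mem_roots w hv.1, hv.2.cox D hw⟩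

lemma neg_mem_rootsIn {v : S → ℤ} (hv : v ∈ D.rootsIn I) : -v ∈ D.rootsIn I := by
  rw [mem_rootsIn] at hv ⊢
  exact ⟨D.neg_mem _ hv.1, hv.2.neg⟩

lemma not_nonneg_iff {v : S → ℤ} (hv : v ∈ D.roots) : ¬ 0 ≤ v ↔ 0 ≤ -v := by
  constructor
  · intro h
    exact neg_nonneg.mpr ((D.nonneg_or_nonpos v hv).resolve_left h)
  · intro h h'
    exact D.ne_zero v hv (le_antisymm (neg_nonneg.mp h) h')

lemma cox_injective (w : List S) : Function.Injective (D.cox w) := by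
  induction w with
  | nil => exact fun _ _ h => h
  | cons i w ih => exact ih.comp (Function.LeftInverse.injective (D.refl_refl i))

lemma sum_rootsIn_comp_cox (hw : IsWord p I w) (g : (S → ℤ) → ℕ) :
    ∑ v ∈ D.rootsIn I, g (D.cox w v) = ∑ v ∈ D.rootsIn I, g v :=
  Finset.sum_nbij (D.cox w) (fun _ hv => D.cox_mem_rootsIn hw hv)
    ((D.cox_injective w).injOn)
    (Finset.surjOn_of_injOn_of_card_le _ (fun _ hv => D.cox_mem_rootsIn hw hv)
      ((D.cox_injective w).injOn) le_rfl) fun _ _ => rfl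

lemma iterate_cox_mem_rootsIn (hw : IsWord p I w) {v : S → ℤ} (hv : v ∈ D.rootsIn I) (m : ℕ) :
    (D.cox w)^[m] v ∈ D.rootsIn I := by
  induction m with
  | zero => exact hv
  | succ m ih => rw [Function.iterate_succ_apply']; exact D.cox_mem_rootsIn hw ih

lemma sum_rootsIn_comp_iterate_cox (hw : IsWord p I w) (g : (S → ℤ) → ℕ) (m : ℕ) :
    ∑ v ∈ D.rootsIn I, g ((D.cox w)^[m] v) = ∑ v ∈ D.rootsIn I, g v := by
  induction m with
  | zero => rfl
  | succ m ih =>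
    simp only [Function.iterate_succ_apply]
    rw [D.sum_rootsIn_comp_cox hw fun v => g ((D.cox w)^[m] v), ih]

/-- The negative root `v` is sent to a positive root. -/
def IsUp (w : List S) (v : S → ℤ) : Prop := ¬ 0 ≤ v ∧ 0 ≤ D.cox w v

/-- Every orbit of a Coxeter element contains positive and negative roots. -/
lemma exists_isUp (hw : IsWord p I w) {h : ℕ} (h0 : 0 < h)
    (hc : ∀ v ∈ D.rootsIn I, (D.cox w)^[h] v = v) {v : S → ℤ} (hv : v ∈ D.rootsIn I) :
    ∃ m < h, D.IsUp w ((D.cox w)^[m] v) := by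
  by_contra! hn
  -- The orbit sum is fixed by c, hence zero, so the orbit cannot have constant sign.
  have hx : D.cox w (∑ m ∈ Finset.range h, (D.cox w)^[m] v) =
      ∑ m ∈ Finset.range h, (D.cox w)^[m] v := by
    rw [map_sum]
    simp only [← Function.iterate_succ_apply' (D.cox w)]
    have h1 := Finset.sum_range_succ (fun m => (D.cox w)^[m] v) h
    rw [Finset.sum_range_succ', hc v hv] at h1
    exact add_right_cancel h1
  have hx0 := D.eq_zero_of_cox_eq hw (fun j hj => by
    rw [Finset.sum_apply]
    exact Finset.sum_eq_zero fun m _ =>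
      (D.mem_rootsIn.mp (D.iterate_cox_mem_rootsIn hw hv m)).2 j hj) hx
  have hne (m : ℕ) : (D.cox w)^[m] v ≠ 0 :=
    D.ne_zero _ (D.mem_rootsIn.mp (D.iterate_cox_mem_rootsIn hw hv m)).1
  have hper (m : ℕ) : (D.cox w)^[m + h] v = (D.cox w)^[m] v := by
    rw [Function.iterate_add_apply, hc v hv]
  have hn' (m : ℕ) : ¬ D.IsUp w ((D.cox w)^[m] v) := by
    have e : (D.cox w)^[m] v = (D.cox w)^[m % h] v :=
      (Function.IsPeriodicPt.iterate_mod_apply (hc v hv) m).symm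
    rw [e]
    exact hn _ (Nat.mod_lt m h0)
  by_cases hall : ∀ m, 0 ≤ (D.cox w)^[m] v
  · have := (Finset.sum_eq_zero_iff_of_nonneg fun m _ => hall m).mp hx0 0 (by simpa)
    exact hne 0 this
  -- Without an upward crossing, a negative root stays negative forever; by periodicity the whole
  -- orbit is then negative.
  · push Not at hall
    obtain ⟨m, hm⟩ := hall
    have hneg (k : ℕ) : ¬ 0 ≤ (D.cox w)^[m + k] v := by
      induction k with
      | zero => exact hm
      | succ k ih =>
        intro hk
        rw [← add_assoc, Function.iterate_succ_apply'] at hk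
        exact hn' _ ⟨ih, hk⟩
    have hall (k : ℕ) : (D.cox w)^[k] v ≤ 0 := by
      have e : (D.cox w)^[k] v = (D.cox w)^[m + (k + (h - 1) * m)] v := by
        have : m + (k + (h - 1) * m) = k + h * m := by
          obtain ⟨h', rfl⟩ := Nat.exists_eq_succ_of_ne_zero h0.ne'
          simp only [Nat.succ_eq_add_one, Nat.add_sub_cancel]
          ring
        rw [this, Function.iterate_add_apply]
        congr 1
        exact (Function.IsPeriodicPt.mul_const (hc v hv) m).symm
      rw [e]
      have hr := (D.mem_rootsIn.mp (D.iterate_cox_mem_rootsIn hw hv (m + (k + (h - 1) * m)))).1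
      exact (D.nonneg_or_nonpos _ hr).resolve_left (hneg _)
    have hx1 : ∑ m ∈ Finset.range h, -((D.cox w)^[m] v) = 0 := by
      rw [Finset.sum_neg_distrib, hx0, neg_zero]
    have := (Finset.sum_eq_zero_iff_of_nonneg fun m _ => neg_nonneg.mpr (hall m)).mp hx1 0
      (by simpa)
    exact hne 0 (neg_eq_zero.mp this)

open Classical in
/-- The sum of an invariant function over the crossings from negative to positive roots. -/
def upSum (I : Finset S) (w : List S) (g : (S → ℤ) → ℕ) : ℕ :=
  ∑ v ∈ D.rootsIn I, if D.IsUp w v then g v else 0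

open Classical in
/-- The number of crossings from negative to positive in `h` steps. -/
def upCount (h : ℕ) (w : List S) (v : S → ℤ) : ℕ :=
  ∑ m ∈ Finset.range h, if D.IsUp w ((D.cox w)^[m] v) then 1 else 0

/-- Exchange of sums: at each of the h instants c^m permutes the roots, so every instant contributes
the same total. -/
lemma sum_mul_upCount (hw : IsWord p I w) (h : ℕ) (g : (S → ℤ) → ℕ)
    (hg : ∀ v ∈ D.rootsIn I, g (D.cox w v) = g v) :
    ∑ v ∈ D.rootsIn I, g v * D.upCount h w v = h * D.upSum I w g := by
  classical
  have hg' (m : ℕ) : ∀ v ∈ D.rootsIn I, g ((D.cox w)^[m] v) = g v := by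
    induction m with
    | zero => exact fun _ _ => rfl
    | succ m ih =>
      intro v hv
      rw [Function.iterate_succ_apply', hg _ (D.iterate_cox_mem_rootsIn hw hv m), ih v hv]
  calc _ = ∑ v ∈ D.rootsIn I, ∑ m ∈ Finset.range h,
        if D.IsUp w ((D.cox w)^[m] v) then g ((D.cox w)^[m] v) else 0 := by
        refine Finset.sum_congr rfl fun v hv => ?_
        rw [upCount, Finset.mul_sum]
        refine Finset.sum_congr rfl fun m _ => ?_
        rw [hg' m v hv]
        split_ifs <;> simp
    _ = ∑ m ∈ Finset.range h, D.upSum I w g := by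
        rw [Finset.sum_comm]
        refine Finset.sum_congr rfl fun m _ => ?_
        exact D.sum_rootsIn_comp_iterate_cox hw (fun v => if D.IsUp w v then g v else 0) m
    _ = _ := by simp

/-- The upward crossings are exactly the negatives of the roots that τ sends to the -α_i, one for
each i in I. -/
lemma upSum_eq (hp : Function.Injective p) (hw : IsWord p I w) (φ : (S → ℤ) → ℕ)
    (g : (S → ℤ) → ℕ) (hg : ∀ v ∈ D.rootsIn I, 0 ≤ v → g (-v) = φ v)
    (hφ : ∀ v ∈ D.almostPos I, φ (D.plCox w v) = φ v) :
    D.upSum I w g = ∑ i ∈ I, φ (-simple i) := by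
  classical
  rw [upSum, ← Finset.sum_filter]
  symm
  choose! P hP1 hP2 hP3 using fun i (hi : i ∈ I) => D.exists_isProjective hp hw hi
  have hPa (i : S) (hi : i ∈ I) : P i ∈ D.almostPos I := by
    have := D.mem_rootsIn.mp (hP1 i hi)
    exact D.mem_almostPos.mpr ⟨this.1, this.2, Or.inl (hP2 i hi)⟩
  refine Finset.sum_nbij (fun i => -P i) ?_ ?_ ?_ ?_
  · intro i hi
    rw [Finset.mem_filter]
    refine ⟨D.neg_mem_rootsIn (hP1 i hi), ?_, ?_⟩
    · rw [D.not_nonneg_iff (D.neg_mem _ (D.mem_rootsIn.mp (hP1 i hi)).1), neg_neg]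
      exact hP2 i hi
    · rw [map_neg]
      exact neg_nonneg.mpr (hP3 i hi).cox_nonpos
  · intro i hi j hj h
    have h1 := (hP3 i hi).plCox_eq
    rw [neg_injective h, (hP3 j hj).plCox_eq] at h1
    exact (simple_injective (neg_injective h1)).symm
  · intro v hv
    rw [Finset.mem_coe, Finset.mem_filter] at hv
    obtain ⟨hv, hv1, hv2⟩ := hv
    have hv' := D.neg_mem_rootsIn hv
    have h0 := (D.not_nonneg_iff (D.mem_rootsIn.mp hv).1).mp hv1
    have hr := D.mem_rootsIn.mp hv'
    rcases D.plCox_cases hp hw hr.1 h0 with h | ⟨i, h⟩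
    · exfalso
      have h3 := h.2
      rw [map_neg] at h3
      exact D.ne_zero _ (D.cox_mem_roots w (D.mem_rootsIn.mp hv).1)
        (le_antisymm (neg_nonneg.mp h3) hv2)
    · refine ⟨i, h.mem, ?_⟩
      have := D.plCox_injOn hw (hPa i h.mem) (D.mem_almostPos.mpr ⟨hr.1, hr.2, Or.inl h0⟩)
        ((hP3 i h.mem).plCox_eq.trans h.plCox_eq.symm)
      change -P i = v
      rw [this, neg_neg]
  · intro i hi
    rw [hg _ (hP1 i hi) (hP2 i hi), ← hφ _ (hPa i hi), (hP3 i hi).plCox_eq]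

/-- The total of the counts is h|I|, each count is at least 1, and there are at least h|I| roots; so
every count equals 1. Only a lower bound on the number of roots is used. -/
lemma upCount_eq_one (hp : Function.Injective p) (hw : IsWord p I w) {h : ℕ} (h0 : 0 < h)
    (hc : ∀ v ∈ D.rootsIn I, (D.cox w)^[h] v = v) (hcard : h * I.card ≤ (D.rootsIn I).card)
    {v : S → ℤ} (hv : v ∈ D.rootsIn I) : D.upCount h w v = 1 := by
  classical
  have h1 := D.sum_mul_upCount hw h (fun _ => 1) fun _ _ => rfl
  rw [D.upSum_eq hp hw (fun _ => 1) (fun _ => 1) (fun _ _ _ => rfl) fun _ _ => rfl] at h1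
  simp only [one_mul, Finset.sum_const, smul_eq_mul, mul_one] at h1
  have h2 : ∀ v ∈ D.rootsIn I, 1 ≤ D.upCount h w v := by
    intro v hv
    obtain ⟨m, hm, hup⟩ := D.exists_isUp hw h0 hc hv
    have := Finset.single_le_sum (f := fun m => if D.IsUp w ((D.cox w)^[m] v) then 1 else 0)
      (fun _ _ => Nat.zero_le _) (Finset.mem_range.mpr hm)
    simpa [upCount, hup] using this
  have h3 : ∑ v ∈ D.rootsIn I, 1 = ∑ v ∈ D.rootsIn I, D.upCount h w v := by
    apply le_antisymm (Finset.sum_le_sum h2)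
    rw [h1]
    simpa using hcard
  exact ((Finset.sum_eq_sum_iff_of_le h2).mp h3 v hv).symm

lemma almostPos_eq [DecidableEq (S → ℤ)] [DecidablePred fun v : S → ℤ => 0 ≤ v] :
    D.almostPos I = (D.rootsIn I).filter (fun v => 0 ≤ v) ∪ I.image fun i => -simple i := by
  ext v
  simp only [mem_almostPos, Finset.mem_union, Finset.mem_filter, mem_rootsIn, Finset.mem_image]
  constructor
  · rintro ⟨h1, h2, h0 | ⟨i, rfl⟩⟩
    · exact Or.inl ⟨⟨h1, h2⟩, h0⟩
    · exact Or.inr ⟨i, suppIn_neg_simple_iff.mp h2, rfl⟩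
  · rintro (⟨⟨h1, h2⟩, h0⟩ | ⟨i, hi, rfl⟩)
    · exact ⟨h1, h2, Or.inl h0⟩
    · exact ⟨D.neg_mem _ (D.single_mem i), (suppIn_simple hi).neg, Or.inr ⟨i, rfl⟩⟩

/-- The average over almost positive roots of a function invariant under the piecewise linear
Coxeter element is determined by its values at the negative simple roots. -/
lemma two_mul_sum_almostPos (hp : Function.Injective p) (hw : IsWord p I w) {h : ℕ} (h0 : 0 < h)
    (hc : ∀ v ∈ D.rootsIn I, (D.cox w)^[h] v = v) (hcard : h * I.card ≤ (D.rootsIn I).card)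
    (φ : (S → ℤ) → ℕ) (hφ : ∀ v ∈ D.almostPos I, φ (D.plCox w v) = φ v) :
    2 * ∑ v ∈ D.almostPos I, φ v = (h + 2) * ∑ i ∈ I, φ (-simple i) := by
  classical
  -- The even extension of φ to all roots is invariant under the linear map c, although φ is only
  -- invariant under τ.
  set ψ : (S → ℤ) → ℕ := fun v => if 0 ≤ v then φ v else φ (-v) with hψ
  have hψ0 {v : S → ℤ} (hv : 0 ≤ v) : ψ v = φ v := if_pos hv
  have hψn {v : S → ℤ} (hv : v ∈ D.roots) : ψ (-v) = ψ v := by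
    by_cases h1 : 0 ≤ v
    · have h2 : ¬ 0 ≤ -v := by rwa [D.not_nonneg_iff (D.neg_mem _ hv), neg_neg]
      simp only [hψ, if_pos h1, if_neg h2, neg_neg]
    · simp only [hψ, if_neg h1, if_pos ((D.not_nonneg_iff hv).mp h1)]
  have hψp {v : S → ℤ} (hv : v ∈ D.rootsIn I) (h1 : 0 ≤ v) : ψ (D.cox w v) = ψ v := by
    have hv' := D.mem_rootsIn.mp hv
    have hva : v ∈ D.almostPos I := D.mem_almostPos.mpr ⟨hv'.1, hv'.2, Or.inl h1⟩
    rw [hψ0 h1, ← hφ v hva]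
    rcases D.plCox_cases hp hw hv'.1 h1 with h2 | ⟨i, h2⟩
    · rw [hψ0 h2.2, h2.1]
    -- At a crossing τ takes two steps, v to -α_i to -cv, where c takes v directly to cv; evenness
    -- of ψ identifies the ends.
    · rw [h2.plCox_eq, ← hφ _ (D.neg_simple_mem_almostPos.mpr h2.mem), h2.plCox_neg_simple,
        ← hψn (D.cox_mem_roots w hv'.1), hψ0 (neg_nonneg.mpr h2.cox_nonpos)]
  have hψc : ∀ v ∈ D.rootsIn I, ψ (D.cox w v) = ψ v := by
    intro v hv
    have hv' := (D.mem_rootsIn.mp hv).1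
    by_cases h1 : 0 ≤ v
    · exact hψp hv h1
    · have := hψp (D.neg_mem_rootsIn hv) ((D.not_nonneg_iff hv').mp h1)
      rwa [map_neg, hψn (D.cox_mem_roots w hv'), hψn hv'] at this
  have h1 := D.sum_mul_upCount hw h ψ hψc
  rw [D.upSum_eq hp hw φ ψ (fun v hv h2 => by
    rw [hψn (D.mem_rootsIn.mp hv).1, hψ0 h2]) hφ,
    Finset.sum_congr rfl fun v hv => by
      rw [D.upCount_eq_one hp hw h0 hc hcard hv, mul_one]] at h1
  have h2 : ∑ v ∈ D.rootsIn I, ψ v = 2 * ∑ v ∈ (D.rootsIn I).filter (fun v => 0 ≤ v), φ v := by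
    rw [← Finset.sum_filter_add_sum_filter_not (D.rootsIn I) (fun v => 0 ≤ v) ψ, two_mul]
    congr 1
    · exact Finset.sum_congr rfl fun v hv => hψ0 (Finset.mem_filter.mp hv).2
    · refine Finset.sum_nbij' (fun v => -v) (fun v => -v) ?_ ?_ ?_ ?_ ?_
      · intro v hv
        rw [Finset.mem_filter] at hv ⊢
        exact ⟨D.neg_mem_rootsIn hv.1, (D.not_nonneg_iff (D.mem_rootsIn.mp hv.1).1).mp hv.2⟩
      · intro v hv
        rw [Finset.mem_filter] at hv ⊢
        have hn := D.neg_mem_rootsIn hv.1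
        refine ⟨hn, ?_⟩
        rw [D.not_nonneg_iff (D.mem_rootsIn.mp hn).1, neg_neg]
        exact hv.2
      · simp
      · simp
      · intro v hv
        exact if_neg (Finset.mem_filter.mp hv).2
  have h3 : ∑ v ∈ D.almostPos I, φ v =
      ∑ v ∈ (D.rootsIn I).filter (fun v => 0 ≤ v), φ v + ∑ i ∈ I, φ (-simple i) := by
    rw [almostPos_eq, Finset.sum_union, Finset.sum_image]
    · intro i _ j _ h
      exact simple_injective (neg_injective h)
    · rw [Finset.disjoint_left]
      intro v hv hv'
      obtain ⟨i, -, rfl⟩ := Finset.mem_image.mp hv'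
      exact not_nonneg_neg_simple i (Finset.mem_filter.mp hv).2
  rw [h3, mul_add, ← h2, h1]
  ring

/-! ### Faces of the cluster complex -/

open Classical in
/-- The sets of pairwise compatible almost positive roots in the span of `I`. -/
def faces (p : S → ℕ) (I : Finset S) : Finset (Finset (S → ℤ)) :=
  (D.almostPos I).powerset.filter fun f => ∀ v ∈ f, ∀ u ∈ f, v ≠ u → D.Rel p v u

open Classical in
/-- The number of positive elements of `f`. -/
def posCard (f : Finset (S → ℤ)) : ℕ := (f.filter fun v => 0 ≤ v).card

open Classical in
/-- The number of elements of `f` which are not positive. -/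
def negCard (f : Finset (S → ℤ)) : ℕ := (f.filter fun v => ¬ 0 ≤ v).card

/-- The number of faces with `k` positive roots and `l` negative simple roots. -/
def faceCount (p : S → ℕ) (I : Finset S) (k l : ℕ) : ℕ :=
  ((D.faces p I).filter fun f => posCard f = k ∧ negCard f = l).card

omit [Fintype S] [DecidableEq S] in
lemma posCard_add_negCard (f : Finset (S → ℤ)) : posCard f + negCard f = f.card := by
  classical
  exact Finset.card_filter_add_card_filter_not _

lemma mem_faces {f : Finset (S → ℤ)} : f ∈ D.faces p I ↔
    f ⊆ D.almostPos I ∧ ∀ v ∈ f, ∀ u ∈ f, v ≠ u → D.Rel p v u := by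
  simp [faces]

lemma card_filter_neg_simple_mem {f : Finset (S → ℤ)} (hf : f ⊆ D.almostPos I)
    [DecidablePred fun i => -simple i ∈ f] :
    (I.filter fun i => -simple i ∈ f).card = negCard f := by
  classical
  rw [negCard]
  refine Finset.card_nbij (fun i => -simple i) ?_ ?_ ?_
  · intro i hi
    rw [Finset.mem_coe, Finset.mem_filter] at hi ⊢
    exact ⟨hi.2, not_nonneg_neg_simple i⟩
  · intro i _ j _ h
    exact simple_injective (neg_injective h)
  · intro v hv
    rw [Finset.mem_coe, Finset.mem_filter] at hv
    obtain ⟨-, h2, h0 | ⟨i, rfl⟩⟩ := D.mem_almostPos.mp (hf hv.1)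
    · exact absurd h0 hv.2
    · refine ⟨i, ?_, rfl⟩
      rw [Finset.mem_coe, Finset.mem_filter]
      exact ⟨suppIn_neg_simple_iff.mp h2, hv.1⟩

lemma image_plCox_mem_faces (hp : Function.Injective p) (hw : IsWord p I w)
    [DecidableEq (S → ℤ)] {f : Finset (S → ℤ)} (hf : f ∈ D.faces p I) :
    f.image (D.plCox w) ∈ D.faces p I := by
  rw [mem_faces] at hf ⊢
  refine ⟨fun v hv => ?_, fun v hv u hu h => ?_⟩
  · obtain ⟨u, hu, rfl⟩ := Finset.mem_image.mp hv
    exact D.plCox_mem_almostPos hw (hf.1 hu)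
  · obtain ⟨v', hv', rfl⟩ := Finset.mem_image.mp hv
    obtain ⟨u', hu', rfl⟩ := Finset.mem_image.mp hu
    rw [D.rel_plCox_plCox hp hw (hf.1 hv') (hf.1 hu')]
    exact hf.2 _ hv' _ hu' fun e => h (by rw [e])

-- The bijection is τ applied to each face; it preserves size and compatibility. This supplies the
-- invariant function for the averaging argument.
open Classical in
lemma card_faces_plCox_mem (hp : Function.Injective p) (hw : IsWord p I w) (m : ℕ)
    {v : S → ℤ} (hv : v ∈ D.almostPos I) :
    (((D.faces p I).filter fun f => f.card = m).filter fun f => D.plCox w v ∈ f).card =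
      (((D.faces p I).filter fun f => f.card = m).filter fun f => v ∈ f).card := by
  symm
  have hinj := D.plCox_injOn hw
  refine Finset.card_nbij (fun f => f.image (D.plCox w)) ?_ ?_ ?_
  · intro f hf
    simp only [Finset.mem_coe, Finset.mem_filter] at hf ⊢
    refine ⟨⟨D.image_plCox_mem_faces hp hw hf.1.1, ?_⟩, Finset.mem_image_of_mem _ hf.2⟩
    rw [Finset.card_image_of_injOn (hinj.mono (D.mem_faces.mp hf.1.1).1), hf.1.2]
  · intro f hf g hg h
    simp only [Finset.mem_coe, Finset.mem_filter] at hf hg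
    have hf' := (D.mem_faces.mp hf.1.1).1
    have hg' := (D.mem_faces.mp hg.1.1).1
    have h' : f.image (D.plCox w) = g.image (D.plCox w) := h
    ext x
    constructor <;> intro hx
    · have := Finset.mem_image_of_mem (D.plCox w) hx
      rw [h'] at this
      obtain ⟨y, hy, e⟩ := Finset.mem_image.mp this
      rwa [← hinj (hg' hy) (hf' hx) e]
    · have := Finset.mem_image_of_mem (D.plCox w) hx
      rw [← h'] at this
      obtain ⟨y, hy, e⟩ := Finset.mem_image.mp this
      rwa [← hinj (hf' hy) (hg' hx) e]
  · intro g hg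
    simp only [Finset.mem_coe, Finset.mem_filter] at hg
    have hg' := D.mem_faces.mp hg.1.1
    have himg : ((D.almostPos I).filter fun u => D.plCox w u ∈ g).image (D.plCox w) = g := by
      ext x
      simp only [Finset.mem_image, Finset.mem_filter]
      constructor
      · rintro ⟨y, ⟨-, hy⟩, rfl⟩
        exact hy
      · intro hx
        obtain ⟨y, hy, rfl⟩ := D.plCox_surjOn hw (hg'.1 hx)
        exact ⟨y, ⟨hy, hx⟩, rfl⟩
    refine ⟨(D.almostPos I).filter fun u => D.plCox w u ∈ g, ?_, himg⟩
    simp only [Finset.mem_coe, Finset.mem_filter]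
    refine ⟨⟨D.mem_faces.mpr ⟨Finset.filter_subset _ _, ?_⟩, ?_⟩, hv, hg.2⟩
    · intro x hx y hy h
      rw [Finset.mem_filter] at hx hy
      rw [← D.rel_plCox_plCox hp hw hx.1 hy.1]
      exact hg'.2 _ hx.2 _ hy.2 fun e => h (hinj hx.1 hy.1 e)
    · have hcd := Finset.card_image_of_injOn
        (hinj.mono (Finset.coe_subset.mpr (Finset.filter_subset (fun u => D.plCox w u ∈ g) _)))
      rw [himg, hg.1.2] at hcd
      exact hcd.symm

open Finset.HasAntidiagonal (antidiagonal) in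
/-- Among the faces of a given size, the average number of negative simple roots is determined
by the Coxeter number. -/
lemma sum_antidiagonal_faceCount (hp : Function.Injective p) (hw : IsWord p I w) {h : ℕ}
    (h0 : 0 < h) (hc : ∀ v ∈ D.rootsIn I, (D.cox w)^[h] v = v)
    (hcard : h * I.card ≤ (D.rootsIn I).card) (m : ℕ) :
    ∑ q ∈ antidiagonal m, (((h : ℚ) + 2) * q.2 - 2 * m) * D.faceCount p I q.1 q.2 = 0 := by
  classical
  set K := (D.faces p I).filter fun f => f.card = m
  have h1 := D.two_mul_sum_almostPos hp hw h0 hc hcard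
    (fun v => (K.filter fun f => v ∈ f).card) fun v hv => D.card_faces_plCox_mem hp hw m hv
  have h2 := Finset.sum_card_bipartiteAbove_eq_sum_card_bipartiteBelow
    (s := D.almostPos I) (t := K) fun (v : S → ℤ) f => v ∈ f
  have h3 := Finset.sum_card_bipartiteAbove_eq_sum_card_bipartiteBelow
    (s := I) (t := K) fun (i : S) f => -simple i ∈ f
  simp only [Finset.bipartiteAbove, Finset.bipartiteBelow] at h2 h3
  have hK {f : Finset (S → ℤ)} (hf : f ∈ K) : f ⊆ D.almostPos I ∧ f.card = m := by
    rw [Finset.mem_filter] at hf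
    exact ⟨(D.mem_faces.mp hf.1).1, hf.2⟩
  rw [h2, h3, Finset.sum_congr rfl fun f hf => D.card_filter_neg_simple_mem (hK hf).1,
    Finset.sum_congr rfl fun f hf => by
      rw [Finset.filter_mem_eq_inter, Finset.inter_eq_right.mpr (hK hf).1, (hK hf).2]] at h1
  -- Incidences counted by faces: each face of K contains m roots, `negCard f` of them negative
  -- simple.
  have h4 : ∑ f ∈ K, (((h : ℚ) + 2) * negCard f - 2 * m) = 0 := by
    rw [Finset.sum_sub_distrib, ← Finset.mul_sum]
    have h1' := congrArg (Nat.cast (R := ℚ)) h1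
    push_cast at h1'
    simp only [Finset.sum_const, nsmul_eq_mul] at h1' ⊢
    linarith
  rw [← h4, ← Finset.sum_fiberwise_of_maps_to (s := K) (t := antidiagonal m)
    (g := fun f => (posCard f, negCard f))]
  · refine Finset.sum_congr rfl fun q hq => ?_
    rw [Finset.HasAntidiagonal.mem_antidiagonal] at hq
    have hs : (K.filter fun f => (posCard f, negCard f) = q) =
        (D.faces p I).filter fun f => posCard f = q.1 ∧ negCard f = q.2 := by
      ext f
      simp only [K, Finset.mem_filter, Prod.ext_iff, and_assoc]
      refine and_congr_right fun _ => ⟨fun h => h.2, fun h => ⟨?_, h⟩⟩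
      rw [← posCard_add_negCard, h.1, h.2, hq]
    rw [hs, Finset.sum_congr rfl fun f hf => by rw [(Finset.mem_filter.mp hf).2.2],
      Finset.sum_const, nsmul_eq_mul, faceCount, mul_comm]
  · intro f hf
    rw [Finset.HasAntidiagonal.mem_antidiagonal, posCard_add_negCard]
    exact (hK hf).2

end CoordRoots

end

noncomputable section

namespace CoordRoots

/-! ### Root systems of type `B` -/

variable {n : ℕ}

/-- The coordinates with respect to the standard orthogonal basis `e_1, …, e_n` of the vector
`∑ v_i α_i`, where `α_i = e_i - e_(i+1)` and the last simple root is `e_n`. -/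
def orthCoord (n : ℕ) : (Fin n → ℤ) →ₗ[ℤ] (Fin n → ℤ) where
  toFun v a := v a - if h : a.val = 0 then 0 else v ⟨a.val - 1, by omega⟩
  map_add' v u := by
    ext a
    by_cases h : a.val = 0
    · simp [h]
    · simp only [Pi.add_apply, dif_neg h]; ring
  map_smul' c v := by
    ext a
    by_cases h : a.val = 0
    · simp [h]
    · simp [h]; ring

/-- The simple root coordinates of `e_i`. -/
def orthVec (i : Fin n) : Fin n → ℤ := fun k => if i ≤ k then 1 else 0

lemma orthCoord_apply (v : Fin n → ℤ) (a : Fin n) :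
    orthCoord n v a = v a - if h : a.val = 0 then 0 else v ⟨a.val - 1, by omega⟩ := rfl

lemma sum_orthCoord (v : Fin n → ℤ) (a : Fin n) :
    ∑ c ∈ Finset.univ.filter (· ≤ a), orthCoord n v c = v a := by
  obtain ⟨k, hk⟩ := a
  induction k with
  | zero =>
    have : Finset.univ.filter (· ≤ (⟨0, hk⟩ : Fin n)) = {⟨0, hk⟩} := by
      ext c; simp [Fin.le_def, Fin.ext_iff]
    rw [this, Finset.sum_singleton, orthCoord_apply, dif_pos rfl, sub_zero]
  | succ k ih =>
    have : Finset.univ.filter (· ≤ (⟨k + 1, hk⟩ : Fin n)) =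
        insert ⟨k + 1, hk⟩ (Finset.univ.filter (· ≤ (⟨k, by omega⟩ : Fin n))) := by
      ext c
      simp only [Finset.mem_filter, Finset.mem_univ, true_and, Finset.mem_insert, Fin.le_def,
        Fin.ext_iff]
      omega
    rw [this, Finset.sum_insert (by simp [Fin.le_def]), ih, orthCoord_apply]
    simp

lemma orthCoord_injective : Function.Injective (orthCoord n) := fun v u h => by
  ext a
  rw [← sum_orthCoord v, ← sum_orthCoord u, h]

lemma orthCoord_orthVec (i : Fin n) : orthCoord n (orthVec i) = Pi.single i 1 := by
  ext a
  simp only [orthCoord_apply, orthVec, Pi.single_apply, Fin.le_def, Fin.ext_iff]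
  split_ifs <;> omega

lemma orthCoord_surjective : Function.Surjective (orthCoord n) := fun f => by
  refine ⟨∑ i, f i • orthVec i, ?_⟩
  simp only [map_sum, map_smul, orthCoord_orthVec]
  ext a
  simp [Pi.single_apply]

lemma simple_eq_sub {k : Fin n} (hk : k.val + 1 < n) :
    simple k = orthVec k - orthVec ⟨k.val + 1, hk⟩ := by
  ext a
  simp only [Pi.single_apply, Pi.sub_apply, orthVec, Fin.le_def, Fin.ext_iff]
  split_ifs <;> omega

lemma simple_last_eq {k : Fin n} (hk : k.val + 1 = n) : simple k = orthVec k := by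
  ext a
  simp only [Pi.single_apply, orthVec, Fin.le_def, Fin.ext_iff]
  split_ifs <;> omega

/-- A root system with Cartan matrix of type `B_n`, generated by its simple roots. -/
structure IsTypeB (D : CoordRoots (Fin n)) : Prop where
  cartan_eq : ∀ i j, D.cartan i j = CartanMatrix.B n i j
  induction : ∀ Q : (Fin n → ℤ) → Prop, (∀ i, Q (simple i)) → (∀ i v, Q v → Q (D.refl i v)) →
    (∀ v, Q v → Q (-v)) → ∀ v ∈ D.roots, Q v

/-- The permutation of the coordinates given by a simple reflection. -/
def simplePerm (k : Fin n) : Equiv.Perm (Fin n) :=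
  if h : k.val + 1 < n then Equiv.swap k ⟨k.val + 1, h⟩ else 1

/-- The signs given by a simple reflection. -/
def simpleSign (k a : Fin n) : ℤ := if k.val + 1 = n ∧ a = k then -1 else 1

/-- The permutation of the coordinates given by a product of simple reflections. -/
def wordPerm : List (Fin n) → Equiv.Perm (Fin n)
  | [] => 1
  | i :: w => simplePerm i * wordPerm w

namespace IsTypeB

variable {D : CoordRoots (Fin n)} (hD : D.IsTypeB)
include hD

lemma pairing_eq (k : Fin n) (v : Fin n → ℤ) : D.pairing k v =
    if h : k.val + 1 < n then orthCoord n v k - orthCoord n v ⟨k.val + 1, h⟩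
    else 2 * orthCoord n v k := by
  have hv : SuppIn Finset.univ v := fun j hj => absurd (Finset.mem_univ j) hj
  split_ifs with h
  · refine hv.linearMap_eq (g := LinearMap.proj k ∘ₗ orthCoord n -
      LinearMap.proj ⟨k.val + 1, h⟩ ∘ₗ orthCoord n) fun j _ => ?_
    rw [pairing_simple, hD.cartan_eq, CartanMatrix.B]
    simp only [LinearMap.sub_apply, LinearMap.comp_apply, LinearMap.proj_apply, orthCoord_apply,
      Pi.single_apply, Fin.ext_iff, Matrix.of_apply]
    have := j.isLt
    split_ifs <;> first | omega | simp at *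
  · refine hv.linearMap_eq (g := (2 : ℤ) • (LinearMap.proj k ∘ₗ orthCoord n)) fun j _ => ?_
    rw [pairing_simple, hD.cartan_eq, CartanMatrix.B]
    simp only [LinearMap.smul_apply, LinearMap.comp_apply, LinearMap.proj_apply, orthCoord_apply,
      Pi.single_apply, Fin.ext_iff, Matrix.of_apply]
    have := j.isLt
    split_ifs <;> first | omega | simp at *

lemma orthCoord_refl (k : Fin n) (v : Fin n → ℤ) (a : Fin n) :
    orthCoord n (D.refl k v) a = simpleSign k a * orthCoord n v (simplePerm k a) := by
  rw [refl_apply, map_sub, map_smul, hD.pairing_eq, simplePerm, simpleSign]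
  split_ifs with h h' h'
  · omega
  · rw [simple_eq_sub h, map_sub, orthCoord_orthVec, orthCoord_orthVec]
    simp only [Pi.sub_apply, Pi.smul_apply, smul_eq_mul, Pi.single_apply, one_mul]
    have hne : k ≠ ⟨k.val + 1, h⟩ := by simp [Fin.ext_iff]
    by_cases h1 : a = k
    · subst h1
      simp [hne]
    · by_cases h2 : a = ⟨k.val + 1, h⟩
      · subst h2
        simp [hne.symm]
      · rw [Equiv.swap_apply_of_ne_of_ne h1 h2]
        simp [h1, h2]
  · rw [simple_last_eq h'.1, orthCoord_orthVec, h'.2]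
    simp
    ring
  · have : a ≠ k := fun e => h' ⟨by have := k.isLt; omega, e⟩
    rw [simple_last_eq (by have := k.isLt; omega), orthCoord_orthVec]
    simp [this]

omit hD in
lemma simpleSign_eq (k a : Fin n) : simpleSign k a = 1 ∨ simpleSign k a = -1 := by
  rw [simpleSign]
  split_ifs <;> simp

/-- Simple reflections act by signed permutations of the orthogonal coordinates, and only the last
one, in e_n, produces a sign. -/
lemma orthCoord_cox (w : List (Fin n)) : ∃ ε : Fin n → ℤ, (∀ a, ε a = 1 ∨ ε a = -1) ∧
    ((∀ k ∈ w, k.val + 1 < n) → ∀ a, ε a = 1) ∧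
    ∀ v a, orthCoord n (D.cox w v) a = ε a * orthCoord n v (wordPerm w a) := by
  induction w with
  | nil => exact ⟨1, fun _ => Or.inl rfl, fun _ _ => rfl, fun v a => by simp [cox, wordPerm]⟩
  | cons i w ih =>
    obtain ⟨ε, h1, h2, h3⟩ := ih
    refine ⟨fun a => ε a * simpleSign i (wordPerm w a), fun a => ?_, fun hk a => ?_, fun v a => ?_⟩
    · rcases h1 a with h | h <;> rcases simpleSign_eq i (wordPerm w a) with h' | h' <;>
        simp [h, h']
    · have hi := hk i (by simp)
      beta_reduce
      rw [h2 (fun k hk' => hk k (by simp [hk'])), simpleSign, if_neg (by omega), one_mul]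
    · rw [cox, LinearMap.comp_apply, h3, hD.orthCoord_refl, wordPerm, Equiv.Perm.mul_apply,
        mul_assoc]

lemma orthCoord_iterate_cox (w : List (Fin n)) (m : ℕ) :
    ∃ ε : Fin n → ℤ, (∀ a, ε a = 1 ∨ ε a = -1) ∧ ((∀ k ∈ w, k.val + 1 < n) → ∀ a, ε a = 1) ∧
    ∀ v a, orthCoord n ((D.cox w)^[m] v) a = ε a * orthCoord n v ((wordPerm w ^ m) a) := by
  obtain ⟨ε₀, h1, h2, h3⟩ := hD.orthCoord_cox w
  induction m with
  | zero => exact ⟨1, fun _ => Or.inl rfl, fun _ _ => rfl, fun v a => by simp⟩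
  | succ m ih =>
    obtain ⟨ε, h4, h5, h6⟩ := ih
    refine ⟨fun a => ε a * ε₀ ((wordPerm w ^ m) a), fun a => ?_, fun hk a => ?_, fun v a => ?_⟩
    · rcases h4 a with h | h <;> rcases h1 ((wordPerm w ^ m) a) with h' | h' <;> simp [h, h']
    · beta_reduce
      rw [h5 hk, h2 hk, one_mul]
    · rw [Function.iterate_succ_apply, h6, h3, pow_succ', Equiv.Perm.mul_apply, mul_assoc]

end IsTypeB

/-- The simple roots with indices in `[a, b)`. -/
def seg (n a b : ℕ) : Finset (Fin n) := Finset.univ.filter fun i => a ≤ i.val ∧ i.val < b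

lemma mem_seg {a b : ℕ} {i : Fin n} : i ∈ seg n a b ↔ a ≤ i.val ∧ i.val < b := by simp [seg]

lemma card_seg {a b : ℕ} (hb : b ≤ n) : (seg n a b).card = b - a := by
  rw [← Nat.card_Ico, eq_comm]
  refine Finset.card_bij (fun k hk => ⟨k, by rw [Finset.mem_Ico] at hk; omega⟩) ?_ ?_ ?_
  · intro k hk
    rw [Finset.mem_Ico] at hk
    exact mem_seg.mpr hk
  · intro k _ l _ h
    simpa using h
  · intro i hi
    exact ⟨i.val, Finset.mem_Ico.mpr (mem_seg.mp hi), rfl⟩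

lemma simplePerm_mem_seg {a b : ℕ} {k : Fin n} (hk : k ∈ seg n a b) {i : Fin n}
    (hi : i ∈ seg n a (b + 1)) : simplePerm k i ∈ seg n a (b + 1) := by
  rw [mem_seg] at hk
  rw [simplePerm]
  split_ifs with h
  · by_cases h1 : i = k
    · rw [h1, Equiv.swap_apply_left, mem_seg]
      exact ⟨by simp; omega, by simp; omega⟩
    · by_cases h2 : i = ⟨k.val + 1, h⟩
      · rw [h2, Equiv.swap_apply_right, mem_seg]
        omega
      · rwa [Equiv.swap_apply_of_ne_of_ne h1 h2]
  · exact hi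

lemma wordPerm_mem_seg {a b : ℕ} {w : List (Fin n)} (hw : ∀ k ∈ w, k ∈ seg n a b) {i : Fin n}
    (hi : i ∈ seg n a (b + 1)) : wordPerm w i ∈ seg n a (b + 1) := by
  induction w with
  | nil => exact hi
  | cons k w ih =>
    exact simplePerm_mem_seg (hw k (by simp)) (ih fun l hl => hw l (by simp [hl]))

/-- The reflection in e_n permutes nothing, so a type B segment has the same permutation as the type
A segment obtained by dropping its last node. -/
lemma wordPerm_filter (w : List (Fin n)) :
    wordPerm (w.filter fun k => k.val + 1 < n) = wordPerm w := by
  induction w with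
  | nil => rfl
  | cons k w ih =>
    rw [List.filter_cons, wordPerm]
    split_ifs with h
    · rw [wordPerm, ih]
    · rw [ih, simplePerm, dif_neg (by simpa using h), one_mul]

namespace IsTypeB

variable {D : CoordRoots (Fin n)} (hD : D.IsTypeB) {p : Fin n → ℕ} {w : List (Fin n)} {a b : ℕ}
include hD

/-- The indicator of a cycle of the permutation, as a vector in orthogonal coordinates, is fixed by
the Coxeter element. It is therefore orthogonal to all α_k of the segment, that is constant on
consecutive coordinates, so there is only one cycle. -/
lemma isCycleOn_wordPerm (hb : b < n) (hw : IsWord p (seg n a b) w) :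
    (wordPerm w).IsCycleOn (seg n a (b + 1) : Finset (Fin n)) := by
  classical
  have hmaps : Set.MapsTo (wordPerm w) (seg n a (b + 1) : Finset (Fin n))
      (seg n a (b + 1) : Finset (Fin n)) :=
    fun i hi => wordPerm_mem_seg (fun k hk => (hw.2 k).mp hk) hi
  refine ⟨⟨hmaps, (wordPerm w).injective.injOn,
    Finset.surjOn_of_injOn_of_card_le _ hmaps (wordPerm w).injective.injOn le_rfl⟩, ?_⟩
  intro i hi j hj
  obtain ⟨v, hv⟩ := orthCoord_surjective
    (fun k : Fin n => if (wordPerm w).SameCycle i k then (1 : ℤ) else 0)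
  have hfix : D.cox w v = v := by
    apply orthCoord_injective
    obtain ⟨ε, -, h2, h3⟩ := hD.orthCoord_cox w
    ext k
    rw [h3, h2 (fun l hl => ?_), one_mul, hv]
    · simp only [Equiv.Perm.sameCycle_apply_right]
    · have := mem_seg.mp ((hw.2 l).mp hl)
      omega
  have hconst (k : ℕ) (hk : k < n) (hak : a ≤ k) (hkb : k ≤ b) :
      orthCoord n v ⟨k, hk⟩ = orthCoord n v ⟨a, by omega⟩ := by
    induction k, hak using Nat.le_induction with
    | base => rfl
    | succ k hak ih =>
      have h := D.pairing_eq_zero_of_cox_eq hw hfix (k := ⟨k, by omega⟩)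
        (mem_seg.mpr ⟨hak, by simp; omega⟩)
      rw [hD.pairing_eq, dif_pos (show k + 1 < n from hk)] at h
      rw [← ih (by omega) (by omega)]
      linarith
  rw [Finset.mem_coe, mem_seg] at hi hj
  have h1 := hconst i i.isLt hi.1 (by omega)
  have h2 := hconst j j.isLt hj.1 (by omega)
  have h3 : orthCoord n v j = orthCoord n v i := h2.trans h1.symm
  rw [hv] at h3
  by_contra hc
  simp [hc, Equiv.Perm.SameCycle.refl] at h3

omit hD in
lemma orthCoord_eq_zero_of_suppIn {v : Fin n → ℤ} (hv : SuppIn (seg n a b) v) {k : Fin n}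
    (hk : k ∉ seg n a (b + 1)) : orthCoord n v k = 0 := by
  rw [mem_seg] at hk
  rw [orthCoord_apply, hv k (by rw [mem_seg]; omega), zero_sub, neg_eq_zero]
  split_ifs with h
  · rfl
  · exact hv _ (by rw [mem_seg]; simp; omega)

lemma iterate_cox_eq_of_lt (hab : a ≤ b) (hb : b < n) (hw : IsWord p (seg n a b) w) {v : Fin n → ℤ}
    (hv : v ∈ D.rootsIn (seg n a b)) : (D.cox w)^[b - a + 1] v = v := by
  obtain ⟨ε, -, h2, h3⟩ := hD.orthCoord_iterate_cox w (b - a + 1)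
  apply orthCoord_injective
  ext k
  by_cases hk : k ∈ seg n a (b + 1)
  · have hc := (hD.isCycleOn_wordPerm hb hw).pow_card_apply hk
    rw [card_seg (by omega), show b + 1 - a = b - a + 1 by omega] at hc
    rw [h3, hc, h2, one_mul]
    intro l hl
    have := mem_seg.mp ((hw.2 l).mp hl)
    omega
  · rw [orthCoord_eq_zero_of_suppIn (D.mem_rootsIn.mp hv).2 hk, orthCoord_eq_zero_of_suppIn
      (D.mem_rootsIn.mp (D.iterate_cox_mem_rootsIn hw hv _)).2 hk]

/-- After n-a steps the underlying cycle is back to the identity and only signs remain; these square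
to 1. -/
lemma iterate_cox_eq_of_eq (ha : a < n) (hw : IsWord p (seg n a n) w) {v : Fin n → ℤ}
    (hv : v ∈ D.rootsIn (seg n a n)) : (D.cox w)^[2 * (n - a)] v = v := by
  obtain ⟨ε, h1, -, h3⟩ := hD.orthCoord_iterate_cox w (n - a)
  apply orthCoord_injective
  ext k
  by_cases hk : k ∈ seg n a n
  · have hw' : IsWord p (seg n a (n - 1)) (w.filter fun k => k.val + 1 < n) := by
      refine ⟨hw.1.filter _, fun i => ?_⟩
      rw [List.mem_filter, hw.2, mem_seg, mem_seg]
      simp only [decide_eq_true_eq]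
      omega
    have hcyc := hD.isCycleOn_wordPerm (by omega) hw'
    rw [wordPerm_filter, show n - 1 + 1 = n by omega] at hcyc
    have hc := hcyc.pow_card_apply hk
    rw [card_seg le_rfl] at hc
    rw [two_mul, Function.iterate_add_apply, h3, hc, h3, hc, ← mul_assoc]
    rcases h1 k with h | h <;> simp [h]
  · have hk' : k ∉ seg n a (n + 1) := by
      rw [mem_seg] at hk ⊢
      omega
    rw [orthCoord_eq_zero_of_suppIn (D.mem_rootsIn.mp hv).2 hk', orthCoord_eq_zero_of_suppIn
      (D.mem_rootsIn.mp (D.iterate_cox_mem_rootsIn hw hv _)).2 hk']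

/-- The simple roots have squared length 1 or 2 and signed permutations preserve it. Thus a root has
at most two nonzero orthogonal coordinates. -/
lemma sum_sq_le_two {v : Fin n → ℤ} (hv : v ∈ D.roots) : ∑ k, orthCoord n v k ^ 2 ≤ 2 := by
  refine hD.induction (fun v => ∑ k, orthCoord n v k ^ 2 ≤ 2) ?_ ?_ ?_ v hv
  · intro i
    by_cases h : i.val + 1 < n
    · rw [simple_eq_sub h, map_sub, orthCoord_orthVec, orthCoord_orthVec]
      have hne : i ≠ ⟨i.val + 1, h⟩ := by simp [Fin.ext_iff]
      have e (k : Fin n) : ((Pi.single i 1 - Pi.single ⟨i.val + 1, h⟩ 1 : Fin n → ℤ) k) ^ 2 =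
          (if k = i then 1 else 0) + if k = ⟨i.val + 1, h⟩ then 1 else 0 := by
        simp only [Pi.sub_apply, Pi.single_apply]
        by_cases h1 : k = i
        · subst h1
          simp [hne]
        · by_cases h2 : k = ⟨i.val + 1, h⟩
          · subst h2
            simp [hne.symm]
          · simp [h1, h2]
      rw [Finset.sum_congr rfl fun k _ => e k]
      simp [Finset.sum_add_distrib]
    · rw [simple_last_eq (by omega), orthCoord_orthVec]
      simp [Pi.single_apply]
  · intro i v h
    have e (k : Fin n) : orthCoord n (D.refl i v) k ^ 2 = orthCoord n v (simplePerm i k) ^ 2 := by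
      rw [hD.orthCoord_refl, mul_pow]
      rcases simpleSign_eq i k with h | h <;> simp [h]
    simp only [e]
    rwa [Equiv.sum_comp (simplePerm i) fun k => orthCoord n v k ^ 2]
  · intro v h
    simpa using h

/-- A root whose coefficient at `α_k` vanishes is supported on one side of `k`. -/
lemma separated {v : Fin n → ℤ} (hv : v ∈ D.roots) {k : Fin n} (hk : v k = 0) :
    (∀ i < k, v i = 0) ∨ ∀ i, k < i → v i = 0 := by
  by_contra! hc
  obtain ⟨⟨i, hik, hi⟩, j, hkj, hj⟩ := hc
  have h1 : ∃ x ≤ i, orthCoord n v x ≠ 0 := by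
    by_contra! h
    apply hi
    rw [← sum_orthCoord v i]
    exact Finset.sum_eq_zero fun x hx => h x (Finset.mem_filter.mp hx).2
  have hsub {x y : Fin n} (hxy : x < y) :
      v y - v x = ∑ c ∈ Finset.univ.filter (fun c => x < c ∧ c ≤ y), orthCoord n v c := by
    rw [← sum_orthCoord v x, ← sum_orthCoord v y, sub_eq_iff_eq_add', ← Finset.sum_union]
    · congr 1
      ext c
      simp only [Finset.mem_filter, Finset.mem_univ, true_and, Finset.mem_union, Fin.le_def,
        Fin.lt_def] at hxy ⊢
      omega
    · rw [Finset.disjoint_left]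
      intro c hc hc'
      simp only [Finset.mem_filter, Finset.mem_univ, true_and, Fin.le_def, Fin.lt_def] at hc hc'
      omega
  have h2 {x y : Fin n} (hxy : x < y) (h : v y ≠ v x) :
      ∃ c, x < c ∧ c ≤ y ∧ orthCoord n v c ≠ 0 := by
    by_contra! h'
    apply h
    rw [← sub_eq_zero, hsub hxy]
    exact Finset.sum_eq_zero fun c hc => h' c (Finset.mem_filter.mp hc).2.1
      (Finset.mem_filter.mp hc).2.2
  -- The partial sums of the orthogonal coordinates are nonzero at i, zero at k and nonzero at j,
  -- which forces three nonzero coordinates.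
  obtain ⟨x, hx, hx0⟩ := h1
  obtain ⟨y, hy, hy', hy0⟩ := h2 hik (by rw [hk]; exact hi.symm)
  obtain ⟨z, hz, hz', hz0⟩ := h2 hkj (by rw [hk]; exact hj)
  have hle := hD.sum_sq_le_two hv
  have hxy : x < y := lt_of_le_of_lt hx hy
  have hyz : y < z := lt_of_le_of_lt hy' hz
  have hs := Finset.sum_le_sum_of_subset_of_nonneg (Finset.subset_univ ({x, y, z} : Finset (Fin n)))
    fun k _ _ => sq_nonneg (orthCoord n v k)
  rw [Finset.sum_insert (by simp [hxy.ne, (hxy.trans hyz).ne]), Finset.sum_pair hyz.ne] at hs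
  have hpos {c : Fin n} (hc : orthCoord n v c ≠ 0) : 1 ≤ orthCoord n v c ^ 2 := by
    have : 0 < orthCoord n v c ^ 2 := by positivity
    omega
  have := hpos hx0
  have := hpos hy0
  have := hpos hz0
  omega

end IsTypeB

end CoordRoots

end

/-! ### Lower bounds for the number of roots on a segment. -/

noncomputable section

namespace CoordRoots

variable {n : ℕ}

lemma suppIn_orthVec_sub {a b : ℕ} {i j : Fin n} (hi : i ∈ seg n a (b + 1))
    (hj : j ∈ seg n a (b + 1)) : SuppIn (seg n a b) (orthVec i - orthVec j) := fun k hk => by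
  rw [mem_seg] at hi hj hk
  simp only [Pi.sub_apply, orthVec, Fin.le_def]
  split_ifs <;> omega

lemma suppIn_orthVec {a : ℕ} {i : Fin n} (hi : i ∈ seg n a n) :
    SuppIn (seg n a n) (orthVec i) := fun k hk => by
  rw [mem_seg] at hi hk
  simp only [orthVec, Fin.le_def]
  split_ifs <;> omega

namespace IsTypeB

variable {D : CoordRoots (Fin n)} (hD : D.IsTypeB)
include hD

lemma refl_orthVec_self {k l : Fin n} (h : l.val = k.val + 1) :
    D.refl k (orthVec k) = orthVec l := by
  have hk : k.val + 1 < n := h ▸ l.isLt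
  obtain rfl : l = ⟨k.val + 1, hk⟩ := Fin.ext h
  rw [refl_apply, hD.pairing_eq, dif_pos hk, orthCoord_orthVec, simple_eq_sub hk]
  simp [Fin.ext_iff]

lemma refl_orthVec_succ {k l : Fin n} (h : l.val = k.val + 1) :
    D.refl k (orthVec l) = orthVec k := by
  rw [← hD.refl_orthVec_self h, refl_refl]

lemma refl_orthVec_of_ne {k i : Fin n} (h : i ≠ k) (h' : i.val ≠ k.val + 1) :
    D.refl k (orthVec i) = orthVec i := by
  have h1 : ¬ (k.val + 1 = i.val) := fun e => h' e.symm
  have h2 : ¬ (k.val = i.val) := fun e => h (Fin.ext e.symm)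
  rw [refl_apply, hD.pairing_eq, orthCoord_orthVec]
  simp [Fin.ext_iff, h1, h2]

omit hD in
lemma refl_orthVec_last {k : Fin n} (h : k.val + 1 = n) :
    D.refl k (orthVec k) = -orthVec k := by
  rw [← simple_last_eq h, refl_simple]

lemma orthVec_sub_mem {i j : Fin n} (h : i < j) : orthVec i - orthVec j ∈ D.roots := by
  obtain ⟨j, hj⟩ := j
  rw [Fin.lt_def] at h
  simp only at h
  induction j, (Nat.succ_le_of_lt h) using Nat.le_induction with
  | base =>
    rw [← simple_eq_sub hj]
    exact D.single_mem i
  | succ j hij ih =>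
    have := D.refl_mem_roots ⟨j, by omega⟩ (ih (by omega) (by omega))
    rwa [map_sub, hD.refl_orthVec_self (l := ⟨j + 1, hj⟩) rfl, hD.refl_orthVec_of_ne] at this
    · rw [Ne, Fin.ext_iff]
      simp only
      omega
    · simp only
      omega

lemma orthVec_mem (i : Fin n) : orthVec i ∈ D.roots := by
  obtain ⟨i, hi⟩ := i
  induction (Nat.le_sub_one_of_lt hi) using Nat.decreasingInduction with
  | self =>
    rw [← simple_last_eq (by simp only; omega)]
    exact D.single_mem _
  | of_succ i h ih =>
    rw [← hD.refl_orthVec_succ (k := ⟨i, hi⟩) (l := ⟨i + 1, by omega⟩) rfl]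
    exact D.refl_mem_roots _ (ih _)

lemma orthVec_add_mem {i j : Fin n} (h : i < j) : orthVec i + orthVec j ∈ D.roots := by
  obtain ⟨j, hj⟩ := j
  rw [Fin.lt_def] at h
  simp only at h
  induction (Nat.le_sub_one_of_lt hj) using Nat.decreasingInduction with
  | self =>
    have := D.refl_mem_roots ⟨n - 1, hj⟩ (hD.orthVec_sub_mem (i := i) (j := ⟨n - 1, hj⟩) h)
    rwa [map_sub, refl_orthVec_last (by simp only; omega), hD.refl_orthVec_of_ne,
      sub_neg_eq_add] at this
    · rw [Ne, Fin.ext_iff]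
      simp only
      omega
    · simp only
      omega
  | of_succ j hjn ih =>
    have := D.refl_mem_roots ⟨j, hj⟩ (ih (by omega) (by omega))
    rwa [map_add, hD.refl_orthVec_succ (k := ⟨j, hj⟩) (l := ⟨j + 1, by omega⟩) rfl, hD.refl_orthVec_of_ne] at this
    · rw [Ne, Fin.ext_iff]
      simp only
      omega
    · simp only
      omega

/-- The roots e_i - e_j with i ≠ j in [a, b] suffice: their number is h times the rank, with h =
b-a+1. -/
lemma mul_le_card_rootsIn_of_lt {a b : ℕ} (hab : a ≤ b) (hb : b < n) :
    (b - a + 1) * (b - a) ≤ (D.rootsIn (seg n a b)).card := by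
  have hc : (seg n a (b + 1)).offDiag.card = (b - a + 1) * (b - a) := by
    rw [Finset.offDiag_card, card_seg (by omega), show b + 1 - a = b - a + 1 by omega,
      Nat.mul_succ, Nat.add_sub_cancel]
  rw [← hc]
  refine Finset.card_le_card_of_injOn (fun x => orthVec x.1 - orthVec x.2) ?_ ?_
  · rintro ⟨i, j⟩ hij
    rw [Finset.mem_coe, Finset.mem_offDiag] at hij
    rw [Finset.mem_coe, mem_rootsIn]
    refine ⟨?_, suppIn_orthVec_sub hij.1 hij.2.1⟩
    rcases lt_or_gt_of_ne hij.2.2 with h | h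
    · exact hD.orthVec_sub_mem h
    · beta_reduce
      rw [← neg_sub]
      exact D.neg_mem _ (hD.orthVec_sub_mem h)
  · rintro ⟨i, j⟩ hij ⟨i', j'⟩ hij' h
    rw [Finset.mem_coe, Finset.mem_offDiag] at hij hij'
    simp only at h hij hij'
    have h' := congrArg (orthCoord n) h
    rw [map_sub, map_sub, orthCoord_orthVec, orthCoord_orthVec, orthCoord_orthVec,
      orthCoord_orthVec] at h'
    have h1 := congrFun h' i
    have h2 := congrFun h' j
    have h3 := hij.2.2
    have h4 := hij'.2.2
    simp only [Pi.sub_apply, Pi.single_apply, h3, h3.symm, if_true, if_false] at h1 h2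
    rw [Prod.mk.injEq]
    constructor
    · by_contra hne
      rw [if_neg hne] at h1
      split_ifs at h1 <;> omega
    · by_contra hne
      rw [if_neg hne] at h2
      split_ifs at h2 <;> omega

omit hD in
/-- The positive root attached to a pair of indices. -/
def pairRoot (x : Fin n × Fin n) : Fin n → ℤ :=
  if x.1 < x.2 then orthVec x.1 - orthVec x.2
  else if x.2 < x.1 then orthVec x.2 + orthVec x.1 else orthVec x.1

omit hD in
lemma orthCoord_pairRoot (x : Fin n × Fin n) (a : Fin n) : orthCoord n (pairRoot x) a =
    (if a = x.1 then 1 else 0) + if a = x.2 then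
      (if x.2 < x.1 then 1 else 0) - (if x.1 < x.2 then 1 else 0) else 0 := by
  rw [pairRoot]
  rcases lt_trichotomy x.1 x.2 with h | h | h
  · rw [if_pos h, map_sub, orthCoord_orthVec, orthCoord_orthVec]
    simp only [Pi.sub_apply, Pi.single_apply, if_pos h, if_neg h.not_gt]
    split_ifs <;> rfl
  · rw [if_neg h.not_lt, if_neg h.not_gt, orthCoord_orthVec]
    simp [Pi.single_apply, h]
  · rw [if_neg h.not_gt, if_pos h, map_add, orthCoord_orthVec, orthCoord_orthVec]
    simp only [Pi.add_apply, Pi.single_apply, if_pos h, if_neg h.not_gt]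
    split_ifs <;> rfl

omit hD in
lemma pairRoot_injective : Function.Injective (pairRoot (n := n)) := by
  rintro ⟨i, j⟩ ⟨i', j'⟩ h
  have h' (a : Fin n) := congrArg (orthCoord n · a) h
  simp only [orthCoord_pairRoot] at h'
  have h1 := h' i
  have h2 := h' j
  have h3 := h' i'
  have h4 := h' j'
  clear h' h
  rw [Prod.mk.injEq]
  rcases lt_trichotomy i j with h | rfl | h <;> rcases lt_trichotomy i' j' with h' | rfl | h' <;>
    grind

lemma pairRoot_mem (x : Fin n × Fin n) : pairRoot x ∈ D.roots := by
  rw [pairRoot]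
  split_ifs with h1 h2
  · exact hD.orthVec_sub_mem h1
  · exact hD.orthVec_add_mem h2
  · exact hD.orthVec_mem _

omit hD in
lemma pairRoot_nonneg (x : Fin n × Fin n) : 0 ≤ pairRoot x := fun k => by
  rw [pairRoot]
  split_ifs with h1 h2 <;> simp only [Pi.zero_apply, Pi.sub_apply, Pi.add_apply, orthVec]
  · have : x.2 ≤ k → x.1 ≤ k := h1.le.trans
    split_ifs <;> omega
  · split_ifs <;> omega
  · split_ifs <;> omega

/-- Ordered pairs of indices give (n-a)² positive roots, and negation doubles them; this is h times
the rank, with h = 2(n-a). -/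
lemma mul_le_card_rootsIn_of_eq (a : ℕ) :
    2 * (n - a) * (n - a) ≤ (D.rootsIn (seg n a n)).card := by
  classical
  set P := (seg n a n ×ˢ seg n a n).image pairRoot with hP
  have hPc : P.card = (n - a) * (n - a) := by
    rw [hP, Finset.card_image_of_injective _ pairRoot_injective, Finset.card_product,
      card_seg le_rfl]
  have hmem : ∀ v ∈ P, v ∈ D.rootsIn (seg n a n) ∧ 0 ≤ v := by
    intro v hv
    obtain ⟨⟨i, j⟩, hx, rfl⟩ := Finset.mem_image.mp hv
    rw [Finset.mem_product] at hx
    refine ⟨D.mem_rootsIn.mpr ⟨hD.pairRoot_mem _, ?_⟩, pairRoot_nonneg _⟩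
    intro k hk
    have h1 := suppIn_orthVec hx.1 k hk
    have h2 := suppIn_orthVec hx.2 k hk
    simp only at h1 h2
    rw [pairRoot]
    split_ifs <;> simp [h1, h2]
  have h1 : P.card ≤ ((D.rootsIn (seg n a n)).filter fun v => 0 ≤ v).card :=
    Finset.card_le_card fun v hv => Finset.mem_filter.mpr (hmem v hv)
  have h2 : P.card ≤ ((D.rootsIn (seg n a n)).filter fun v => ¬ 0 ≤ v).card := by
    refine Finset.card_le_card_of_injOn (fun v => -v) (fun v hv => ?_) neg_injective.injOn
    have hv := hmem v hv
    have h' := D.neg_mem_rootsIn hv.1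
    rw [Finset.mem_coe, Finset.mem_filter, D.not_nonneg_iff (D.mem_rootsIn.mp h').1, neg_neg]
    exact ⟨h', hv.2⟩
  rw [← Finset.card_filter_add_card_filter_not (s := D.rootsIn (seg n a n)) fun v => 0 ≤ v]
  have : 2 * (n - a) * (n - a) = (n - a) * (n - a) + (n - a) * (n - a) := by ring
  omega

end IsTypeB

end CoordRoots

end

noncomputable section

namespace CoordRoots

open Finset.HasAntidiagonal (antidiagonal)

/-! ### Links of negative simple roots -/

section Link

variable {S : Type*} [Fintype S] [DecidableEq S] (D : CoordRoots S) {p : S → ℕ}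

/-- Removing the simple root `α_i` splits the root system on `I` into orthogonal root systems on
`I₁` and `I₂`. -/
structure Splits (I : Finset S) (i : S) (I₁ I₂ : Finset S) : Prop where
  mem : i ∈ I
  notMem_left : i ∉ I₁
  notMem_right : i ∉ I₂
  left_subset : I₁ ⊆ I
  right_subset : I₂ ⊆ I
  disjoint : Disjoint I₁ I₂
  suppIn : ∀ v ∈ D.roots, SuppIn I v → v i = 0 → SuppIn I₁ v ∨ SuppIn I₂ v
  cartan_left : ∀ j ∈ I₁, ∀ k ∈ I₂, D.cartan j k = 0
  cartan_right : ∀ j ∈ I₁, ∀ k ∈ I₂, D.cartan k j = 0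

omit [Fintype S] [DecidableEq S] in
lemma SuppIn.mono {I J : Finset S} (h : I ⊆ J) {v : S → ℤ} (hv : SuppIn I v) : SuppIn J v :=
  fun j hj => hv j fun hj' => hj (h hj')

lemma almostPos_mono {I J : Finset S} (h : I ⊆ J) : D.almostPos I ⊆ D.almostPos J := fun v hv => by
  rw [mem_almostPos] at hv ⊢
  exact ⟨hv.1, hv.2.1.mono h, hv.2.2⟩

lemma rel_neg_simple_of_eq_zero {i : S} (u : S → ℤ) (hu : u i = 0)
    (hu' : 0 ≤ u ∨ ∃ j, u = -simple j) : D.Rel p (-simple i) u := by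
  rcases hu' with h | ⟨j, rfl⟩
  · exact (D.rel_neg_simple_of_nonneg h).mpr hu.le
  · exact D.rel_neg_simple_neg_simple i j

variable {D} {I I₁ I₂ : Finset S} {i : S} (h : D.Splits I i I₁ I₂)
include h

lemma Splits.not_suppIn_both {v : S → ℤ} (hv : v ∈ D.roots) (h1 : SuppIn I₁ v) :
    ¬ SuppIn I₂ v := fun h2 => D.ne_zero v hv <| by
  ext j
  by_cases hj : j ∈ I₁
  · exact h2 j (Finset.disjoint_left.mp h.disjoint hj)
  · exact h1 j hj

lemma Splits.euler_eq_zero {v u : S → ℤ} (hv : SuppIn I₁ v) (hu : SuppIn I₂ u) :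
    D.euler p v u = 0 ∧ D.euler p u v = 0 := by
  have h0 : ∀ j ∈ I₁, ∀ k ∈ I₂, D.euler p (simple j) (simple k) = 0 ∧
      D.euler p (simple k) (simple j) = 0 := by
    intro j hj k hk
    have hne : j ≠ k := fun e => Finset.disjoint_left.mp h.disjoint hj (e ▸ hk)
    rw [euler_simple_simple, euler_simple_simple, if_neg hne, if_neg hne.symm,
      h.cartan_left j hj k hk, h.cartan_right j hj k hk]
    simp
  have h1 : ∀ j ∈ I₁, D.euler p (simple j) u = 0 ∧ D.euler p u (simple j) = 0 := fun j hj =>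
    ⟨hu.linearMap_eq (f := D.euler p (simple j)) (g := 0) fun k hk => (h0 j hj k hk).1,
      hu.linearMap_eq (f := (D.euler p).flip (simple j)) (g := 0) fun k hk => (h0 j hj k hk).2⟩
  exact ⟨hv.linearMap_eq (f := (D.euler p).flip u) (g := 0) fun j hj => (h1 j hj).1,
    hv.linearMap_eq (f := D.euler p u) (g := 0) fun j hj => (h1 j hj).2⟩

lemma Splits.rel {v u : S → ℤ} (hv : v ∈ D.almostPos I₁) (hu : u ∈ D.almostPos I₂) :
    D.Rel p v u := by
  rw [mem_almostPos] at hv hu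
  refine ⟨fun _ _ => ?_, ?_, ?_⟩
  · rw [(h.euler_eq_zero hv.2.1 hu.2.1).1, (h.euler_eq_zero hv.2.1 hu.2.1).2]
    exact ⟨le_rfl, le_rfl⟩
  · rintro j rfl
    exact (hu.2.1 j (Finset.disjoint_left.mp h.disjoint (suppIn_neg_simple_iff.mp hv.2.1))).le
  · rintro j rfl
    exact (hv.2.1 j (Finset.disjoint_right.mp h.disjoint (suppIn_neg_simple_iff.mp hu.2.1))).le

/-- The faces of `I₁` and `I₂` give faces of `I` containing `-α_i`. -/
lemma Splits.insert_mem_faces [DecidableEq (S → ℤ)] {f₁ f₂ : Finset (S → ℤ)}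
    (h1 : f₁ ∈ D.faces p I₁) (h2 : f₂ ∈ D.faces p I₂) :
    insert (-simple i) (f₁ ∪ f₂) ∈ D.faces p I := by
  rw [mem_faces] at h1 h2 ⊢
  have hl (v) (hv : v ∈ f₁) : D.Rel p (-simple i) v := by
    have := D.mem_almostPos.mp (h1.1 hv)
    exact D.rel_neg_simple_of_eq_zero v (this.2.1 i h.notMem_left) this.2.2
  have hr (v) (hv : v ∈ f₂) : D.Rel p (-simple i) v := by
    have := D.mem_almostPos.mp (h2.1 hv)
    exact D.rel_neg_simple_of_eq_zero v (this.2.1 i h.notMem_right) this.2.2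
  refine ⟨?_, ?_⟩
  · rw [Finset.insert_subset_iff, Finset.union_subset_iff]
    exact ⟨D.neg_simple_mem_almostPos.mpr h.mem, h1.1.trans (D.almostPos_mono h.left_subset),
      h2.1.trans (D.almostPos_mono h.right_subset)⟩
  · intro v hv u hu hne
    rw [Finset.mem_insert, Finset.mem_union] at hv hu
    rcases hv with rfl | hv | hv <;> rcases hu with rfl | hu | hu
    · exact absurd rfl hne
    · exact hl u hu
    · exact hr u hu
    · exact D.rel_comm.mp (hl v hv)
    · exact h1.2 v hv u hu hne
    · exact h.rel (h1.1 hv) (h2.1 hu)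
    · exact D.rel_comm.mp (hr v hv)
    · exact D.rel_comm.mp (h.rel (h1.1 hu) (h2.1 hv))
    · exact h2.2 v hv u hu hne

lemma Splits.filter_left [DecidableEq (S → ℤ)] [DecidablePred (SuppIn I₁)]
    {f₁ f₂ : Finset (S → ℤ)} (h1 : f₁ ⊆ D.almostPos I₁) (h2 : f₂ ⊆ D.almostPos I₂) :
    (insert (-simple i) (f₁ ∪ f₂)).filter (SuppIn I₁) = f₁ := by
  ext v
  rw [Finset.mem_filter, Finset.mem_insert, Finset.mem_union]
  constructor
  · rintro ⟨rfl | hv | hv, hs⟩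
    · exact absurd (suppIn_neg_simple_iff.mp hs) h.notMem_left
    · exact hv
    · have := D.mem_almostPos.mp (h2 hv)
      exact absurd this.2.1 (h.not_suppIn_both this.1 hs)
  · exact fun hv => ⟨Or.inr (Or.inl hv), (D.mem_almostPos.mp (h1 hv)).2.1⟩

lemma Splits.filter_right [DecidableEq (S → ℤ)] [DecidablePred (SuppIn I₂)]
    {f₁ f₂ : Finset (S → ℤ)} (h1 : f₁ ⊆ D.almostPos I₁) (h2 : f₂ ⊆ D.almostPos I₂) :
    (insert (-simple i) (f₁ ∪ f₂)).filter (SuppIn I₂) = f₂ := by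
  ext v
  rw [Finset.mem_filter, Finset.mem_insert, Finset.mem_union]
  constructor
  · rintro ⟨rfl | hv | hv, hs⟩
    · exact absurd (suppIn_neg_simple_iff.mp hs) h.notMem_right
    · have := D.mem_almostPos.mp (h1 hv)
      exact absurd hs (h.not_suppIn_both this.1 this.2.1)
    · exact hv
  · exact fun hv => ⟨Or.inr (Or.inr hv), (D.mem_almostPos.mp (h2 hv)).2.1⟩

lemma Splits.disjoint_faces {f₁ f₂ : Finset (S → ℤ)} (h1 : f₁ ⊆ D.almostPos I₁)
    (h2 : f₂ ⊆ D.almostPos I₂) : Disjoint f₁ f₂ := by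
  rw [Finset.disjoint_left]
  intro v hv hv'
  have := D.mem_almostPos.mp (h1 hv)
  exact h.not_suppIn_both this.1 this.2.1 (D.mem_almostPos.mp (h2 hv')).2.1

lemma Splits.posCard_insert [DecidableEq (S → ℤ)] {f₁ f₂ : Finset (S → ℤ)}
    (h1 : f₁ ⊆ D.almostPos I₁) (h2 : f₂ ⊆ D.almostPos I₂) :
    posCard (insert (-simple i) (f₁ ∪ f₂)) = posCard f₁ + posCard f₂ := by
  classical
  rw [posCard, Finset.filter_insert, if_neg (not_nonneg_neg_simple i), Finset.filter_union,
    Finset.card_union_of_disjoint (Finset.disjoint_filter_filter (h.disjoint_faces h1 h2)),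
    posCard, posCard]

lemma Splits.negCard_insert [DecidableEq (S → ℤ)] {f₁ f₂ : Finset (S → ℤ)}
    (h1 : f₁ ⊆ D.almostPos I₁) (h2 : f₂ ⊆ D.almostPos I₂) :
    negCard (insert (-simple i) (f₁ ∪ f₂)) = negCard f₁ + negCard f₂ + 1 := by
  classical
  have hn : -simple i ∉ f₁ ∪ f₂ := by
    rw [Finset.mem_union]
    rintro (hi | hi)
    · exact h.notMem_left (D.neg_simple_mem_almostPos.mp (h1 hi))
    · exact h.notMem_right (D.neg_simple_mem_almostPos.mp (h2 hi))
  rw [negCard, Finset.filter_insert, if_pos (not_nonneg_neg_simple i), Finset.card_insert_of_notMem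
    (fun hi => hn (Finset.mem_filter.mp hi).1), Finset.filter_union,
    Finset.card_union_of_disjoint (Finset.disjoint_filter_filter (h.disjoint_faces h1 h2)),
    negCard, negCard]

/-- Compatibility with -α_i forces the coordinate at i of every other element to vanish, so each
lies on one of the two sides. -/
lemma Splits.eq_insert [DecidableEq (S → ℤ)] [DecidablePred (SuppIn I₁)] [DecidablePred (SuppIn I₂)]
    {f : Finset (S → ℤ)} (hf : f ∈ D.faces p I) (hi : -simple i ∈ f) :
    insert (-simple i) (f.filter (SuppIn I₁) ∪ f.filter (SuppIn I₂)) = f := by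
  rw [mem_faces] at hf
  ext v
  rw [Finset.mem_insert, Finset.mem_union, Finset.mem_filter, Finset.mem_filter]
  constructor
  · rintro (rfl | hv | hv)
    · exact hi
    · exact hv.1
    · exact hv.1
  · intro hv
    by_cases hne : v = -simple i
    · exact Or.inl hne
    · have hrel := hf.2 _ hi v hv (Ne.symm hne)
      obtain ⟨h1, h2, h3⟩ := D.mem_almostPos.mp (hf.1 hv)
      have h0 : v i = 0 := by
        rcases h3 with h3 | ⟨j, rfl⟩
        · exact le_antisymm ((D.rel_neg_simple_of_nonneg h3).mp hrel) (h3 i)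
        · have : i ≠ j := fun e => hne (e ▸ rfl)
          simp [this]
      rcases h.suppIn v h1 h2 h0 with h' | h'
      · exact Or.inr (Or.inl ⟨hv, h'⟩)
      · exact Or.inr (Or.inr ⟨hv, h'⟩)

omit h in
lemma filter_mem_faces {J : Finset S} [DecidablePred (SuppIn J)] {f : Finset (S → ℤ)}
    (hf : f ∈ D.faces p I) : f.filter (SuppIn J) ∈ D.faces p J := by
  rw [mem_faces] at hf ⊢
  refine ⟨fun v hv => ?_, fun v hv u hu => hf.2 v (Finset.mem_filter.mp hv).1 u
    (Finset.mem_filter.mp hu).1⟩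
  rw [Finset.mem_filter] at hv
  have := D.mem_almostPos.mp (hf.1 hv.1)
  exact D.mem_almostPos.mpr ⟨this.1, hv.2, this.2.2⟩

open Classical in
/-- The number of faces containing `-α_i`, but no negative simple root of `I₁`. -/
lemma Splits.card_faces (k l : ℕ) :
    ((D.faces p I).filter fun f => (posCard f = k ∧ negCard f = l + 1) ∧
      -simple i ∈ f ∧ ∀ j ∈ I₁, -simple j ∉ f).card =
    ∑ q ∈ antidiagonal k, D.faceCount p I₁ q.1 0 * D.faceCount p I₂ q.2 l := by
  set Λ := (D.faces p I₁ ×ˢ D.faces p I₂).filter fun x =>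
    posCard x.1 + posCard x.2 = k ∧ negCard x.1 = 0 ∧ negCard x.2 = l with hΛ
  have hmem (x : Finset (S → ℤ) × Finset (S → ℤ)) : x ∈ Λ ↔
      (x.1 ∈ D.faces p I₁ ∧ x.2 ∈ D.faces p I₂) ∧
      posCard x.1 + posCard x.2 = k ∧ negCard x.1 = 0 ∧ negCard x.2 = l := by
    rw [hΛ, Finset.mem_filter, Finset.mem_product]
  have hsub {J : Finset S} {f : Finset (S → ℤ)} (hf : f ∈ D.faces p J) : f ⊆ D.almostPos J :=
    (D.mem_faces.mp hf).1
  have h1 : Λ.card = ∑ q ∈ antidiagonal k, D.faceCount p I₁ q.1 0 * D.faceCount p I₂ q.2 l := by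
    rw [Finset.card_eq_sum_card_fiberwise (f := fun x => (posCard x.1, posCard x.2))
      (t := antidiagonal k)]
    · refine Finset.sum_congr rfl fun q hq => ?_
      rw [Finset.HasAntidiagonal.mem_antidiagonal] at hq
      rw [faceCount, faceCount, ← Finset.card_product]
      congr 1
      ext x
      rw [Finset.mem_filter, hmem, Finset.mem_product, Finset.mem_filter, Finset.mem_filter,
        Prod.ext_iff]
      constructor
      · rintro ⟨⟨⟨a, b⟩, -, c, d⟩, e, f⟩
        exact ⟨⟨a, e, c⟩, b, f, d⟩
      · rintro ⟨⟨a, e, c⟩, b, f, d⟩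
        exact ⟨⟨⟨a, b⟩, by rw [e, f, hq], c, d⟩, e, f⟩
    · intro x hx
      rw [Finset.mem_coe, hmem] at hx
      exact Finset.HasAntidiagonal.mem_antidiagonal.mpr hx.2.1
  rw [← h1, eq_comm]
  refine Finset.card_nbij (fun x => insert (-simple i) (x.1 ∪ x.2)) ?_ ?_ ?_
  · intro x hx
    rw [Finset.mem_coe, hmem] at hx
    obtain ⟨⟨h1, h2⟩, h3, h4, h5⟩ := hx
    rw [Finset.mem_coe, Finset.mem_filter, h.posCard_insert (hsub h1) (hsub h2),
      h.negCard_insert (hsub h1) (hsub h2), h4, h5, zero_add]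
    refine ⟨h.insert_mem_faces h1 h2, ⟨h3, rfl⟩, Finset.mem_insert_self _ _, fun j hj hj' => ?_⟩
    rw [Finset.mem_insert, Finset.mem_union] at hj'
    rcases hj' with hj' | hj' | hj'
    · exact h.notMem_left (simple_injective (neg_injective hj') ▸ hj)
    · rw [negCard, Finset.card_eq_zero, Finset.filter_eq_empty_iff] at h4
      exact h4 hj' (not_nonneg_neg_simple j)
    · exact Finset.disjoint_left.mp h.disjoint hj (D.neg_simple_mem_almostPos.mp (hsub h2 hj'))
  · intro x hx y hy hxy
    rw [Finset.mem_coe, hmem] at hx hy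
    obtain ⟨⟨h1, h2⟩, -⟩ := hx
    obtain ⟨⟨h3, h4⟩, -⟩ := hy
    have e1 := congrArg (Finset.filter (SuppIn I₁)) hxy
    have e2 := congrArg (Finset.filter (SuppIn I₂)) hxy
    beta_reduce at e1 e2
    rw [h.filter_left (hsub h1) (hsub h2), h.filter_left (hsub h3) (hsub h4)] at e1
    rw [h.filter_right (hsub h1) (hsub h2), h.filter_right (hsub h3) (hsub h4)] at e2
    exact Prod.ext e1 e2
  · intro f hf
    rw [Finset.mem_coe, Finset.mem_filter] at hf
    obtain ⟨hf, ⟨hk, hl⟩, hi, hj⟩ := hf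
    have h1 : f.filter (SuppIn I₁) ∈ D.faces p I₁ := filter_mem_faces hf
    have h2 : f.filter (SuppIn I₂) ∈ D.faces p I₂ := filter_mem_faces hf
    have he := h.eq_insert hf hi
    refine ⟨(f.filter (SuppIn I₁), f.filter (SuppIn I₂)), ?_, he⟩
    rw [← he, h.posCard_insert (hsub h1) (hsub h2)] at hk
    rw [← he, h.negCard_insert (hsub h1) (hsub h2)] at hl
    have h0 : negCard (f.filter (SuppIn I₁)) = 0 := by
      rw [negCard, Finset.card_eq_zero, Finset.filter_eq_empty_iff]
      intro v hv h0
      rcases (D.mem_almostPos.mp (hsub h1 hv)).2.2 with h3 | ⟨j, rfl⟩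
      · exact h0 h3
      · exact hj j (D.neg_simple_mem_almostPos.mp (hsub h1 hv)) (Finset.mem_filter.mp hv).1
    rw [Finset.mem_coe, hmem]
    exact ⟨⟨h1, h2⟩, hk, h0, by simp only at *; omega⟩

end Link

end CoordRoots

end

/-! ### Recursion and closed form for the face numbers. -/

noncomputable section

namespace CoordRoots

open Finset.HasAntidiagonal (antidiagonal)

section Basic

variable {S : Type*} [Fintype S] [DecidableEq S] (D : CoordRoots S) (p : S → ℕ)

lemma faceCount_zero_zero (I : Finset S) : D.faceCount p I 0 0 = 1 := by
  rw [faceCount, Finset.card_eq_one]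
  refine ⟨∅, ?_⟩
  ext f
  rw [Finset.mem_filter, Finset.mem_singleton]
  constructor
  · rintro ⟨-, h1, h2⟩
    rw [← Finset.card_eq_zero, ← posCard_add_negCard, h1, h2]
  · rintro rfl
    refine ⟨D.mem_faces.mpr ⟨by simp, by simp⟩, ?_, ?_⟩ <;> simp [posCard, negCard]

lemma faceCount_empty_succ (k : ℕ) : D.faceCount p ∅ (k + 1) 0 = 0 := by
  rw [faceCount, Finset.card_eq_zero, Finset.filter_eq_empty_iff]
  rintro f hf ⟨h1, -⟩
  have : f = ∅ := by
    rw [Finset.eq_empty_iff_forall_notMem]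
    intro v hv
    have := D.mem_almostPos.mp ((D.mem_faces.mp hf).1 hv)
    exact D.ne_zero v this.1 (by ext j; exact this.2.1 j (Finset.notMem_empty j))
  simp [this, posCard] at h1

variable {D p}

lemma IsWord.filter {w : List S} (hw : IsWord p Finset.univ w) (I : Finset S) :
    IsWord p I (w.filter (· ∈ I)) := by
  refine ⟨hw.1.filter _, fun i => ?_⟩
  rw [List.mem_filter, hw.2]
  simp

end Basic

/-- In the linear relation the entry (m+1, 0) has coefficient -2(m+1) ≠ 0, so it is determined by
the entries with positive second index. -/
lemma eq_of_sum_antidiagonal {g g' : ℕ → ℕ → ℚ} {c : ℚ} {m : ℕ}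
    (h : ∑ q ∈ antidiagonal (m + 1), (c * q.2 - 2 * ((m : ℚ) + 1)) * g q.1 q.2 = 0)
    (h' : ∑ q ∈ antidiagonal (m + 1), (c * q.2 - 2 * ((m : ℚ) + 1)) * g' q.1 q.2 = 0)
    (heq : ∀ k l, g k (l + 1) = g' k (l + 1)) : g (m + 1) 0 = g' (m + 1) 0 := by
  rw [← h', ← sub_eq_zero, ← Finset.sum_sub_distrib, Finset.sum_eq_single (m + 1, 0)] at h
  · rw [← mul_sub, mul_eq_zero, sub_eq_zero (a := g _ _)] at h
    refine h.resolve_left ?_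
    have : (0 : ℚ) ≤ m := Nat.cast_nonneg m
    simp only [Nat.cast_zero, mul_zero, zero_sub, neg_eq_zero, mul_eq_zero, not_or]
    exact ⟨two_ne_zero, by positivity⟩
  · rintro ⟨k, _ | l⟩ hq hne
    · rw [Finset.HasAntidiagonal.mem_antidiagonal] at hq
      simp only [add_zero] at hq
      exact absurd (by rw [hq]) hne
    · simp only [heq, sub_self]
  · intro hn
    exact absurd (Finset.HasAntidiagonal.mem_antidiagonal.mpr (by simp)) hn

namespace IsTypeB

variable {n : ℕ} {D : CoordRoots (Fin n)} (hD : D.IsTypeB) {p : Fin n → ℕ} {w : List (Fin n)}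
include hD

lemma splits {a b : ℕ} {i : Fin n} (hi : i ∈ seg n a b) :
    D.Splits (seg n a b) i (seg n a i) (seg n (i + 1) b) := by
  have hi' := mem_seg.mp hi
  refine ⟨hi, ?_, ?_, ?_, ?_, ?_, ?_, ?_, ?_⟩
  · rw [mem_seg]; omega
  · rw [mem_seg]; omega
  · intro j hj
    rw [mem_seg] at hj ⊢
    omega
  · intro j hj
    rw [mem_seg] at hj ⊢
    omega
  · rw [Finset.disjoint_left]
    intro j hj hj'
    rw [mem_seg] at hj hj'
    omega
  · intro v hv hs h0
    rcases hD.separated hv h0 with h | h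
    · refine Or.inr fun j hj => ?_
      by_cases h1 : j < i
      · exact h j h1
      · by_cases h2 : j = i
        · rw [h2, h0]
        · refine hs j ?_
          rw [mem_seg] at hj ⊢
          omega
    · refine Or.inl fun j hj => ?_
      by_cases h1 : i < j
      · exact h j h1
      · by_cases h2 : j = i
        · rw [h2, h0]
        · refine hs j ?_
          rw [mem_seg] at hj ⊢
          omega
  · intro j hj k hk
    rw [mem_seg] at hj hk
    simp only [hD.cartan_eq, CartanMatrix.B, Matrix.of_apply, Fin.ext_iff]
    split_ifs <;> omega
  · intro j hj k hk
    rw [mem_seg] at hj hk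
    simp only [hD.cartan_eq, CartanMatrix.B, Matrix.of_apply, Fin.ext_iff]
    split_ifs <;> omega

/-- Faces are sorted by the smallest i with -α_i in the face; minimality forbids negative simple
roots on the left segment. -/
lemma faceCount_succ (a b k l : ℕ) : D.faceCount p (seg n a b) k (l + 1) =
    ∑ i ∈ seg n a b, ∑ q ∈ antidiagonal k,
      D.faceCount p (seg n a i) q.1 0 * D.faceCount p (seg n (i + 1) b) q.2 l := by
  classical
  have e : ∀ i ∈ seg n a b, ∑ q ∈ antidiagonal k,
      D.faceCount p (seg n a i) q.1 0 * D.faceCount p (seg n (i + 1) b) q.2 l =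
      (((D.faces p (seg n a b)).filter fun f => posCard f = k ∧ negCard f = l + 1).filter fun f =>
        -simple i ∈ f ∧ ∀ j ∈ seg n a i, -simple j ∉ f).card := fun i hi => by
    rw [Finset.filter_filter, ← (hD.splits hi).card_faces]
    congr
  rw [Finset.sum_congr rfl e]
  have := Finset.sum_card_bipartiteAbove_eq_sum_card_bipartiteBelow
    (s := seg n a b) (t := (D.faces p (seg n a b)).filter fun f => posCard f = k ∧ negCard f = l + 1)
    fun (i : Fin n) f => -simple i ∈ f ∧ ∀ j ∈ seg n a i, -simple j ∉ f
  simp only [Finset.bipartiteAbove, Finset.bipartiteBelow] at this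
  rw [this, faceCount, Finset.card_eq_sum_ones]
  refine Finset.sum_congr rfl fun f hf => ?_
  rw [Finset.mem_filter] at hf
  have hne : ((seg n a b).filter fun i => -simple i ∈ f).Nonempty := by
    rw [← Finset.card_pos, D.card_filter_neg_simple_mem (D.mem_faces.mp hf.1).1, hf.2.2]
    omega
  rw [eq_comm, Finset.card_eq_one]
  refine ⟨Finset.min' _ hne,
    Finset.eq_singleton_iff_unique_mem.mpr ⟨Finset.mem_filter.mpr ?_, ?_⟩⟩
  · have h := Finset.min'_mem _ hne
    rw [Finset.mem_filter] at h
    refine ⟨h.1, h.2, fun j hj hj' => ?_⟩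
    rw [mem_seg] at hj
    have h1 := mem_seg.mp h.1
    have := Finset.min'_le ((seg n a b).filter fun i => -simple i ∈ f) j (by
      rw [Finset.mem_filter, mem_seg]
      exact ⟨⟨hj.1, hj.2.trans h1.2⟩, hj'⟩)
    omega
  · intro i hi
    rw [Finset.mem_filter] at hi
    refine le_antisymm ?_ (Finset.min'_le _ i (Finset.mem_filter.mpr ⟨hi.1, hi.2.1⟩))
    by_contra! hlt
    have h := Finset.min'_mem _ hne
    rw [Finset.mem_filter] at h
    exact hi.2.2 _ (mem_seg.mpr ⟨(mem_seg.mp h.1).1, hlt⟩) h.2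

omit hD in
lemma sum_seg {a N : ℕ} (h : a + (N + 1) ≤ n) (g : ℕ → ℕ → ℚ) :
    ∑ i ∈ seg n a (a + (N + 1)), g (i - a) (a + N - i) = ∑ s ∈ antidiagonal N, g s.1 s.2 := by
  refine Finset.sum_nbij (fun i => (i.val - a, a + N - i.val)) ?_ ?_ ?_ fun _ _ => rfl
  · intro i hi
    rw [mem_seg] at hi
    rw [Finset.HasAntidiagonal.mem_antidiagonal]
    simp only
    omega
  · intro i hi j hj hij
    rw [Finset.mem_coe, mem_seg] at hi hj
    simp only [Prod.mk.injEq] at hij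
    omega
  · rintro ⟨x, y⟩ hxy
    rw [Finset.mem_coe, Finset.HasAntidiagonal.mem_antidiagonal] at hxy
    simp only at hxy
    refine ⟨⟨a + x, by omega⟩, ?_, ?_⟩
    · rw [Finset.mem_coe, mem_seg]
      simp only
      omega
    · simp only [Prod.mk.injEq]
      omega

/-- The face numbers of the cluster complex of type `A_N`. -/
theorem faceCount_eq_fEntryA (hp : Function.Injective p) (hw : IsWord p Finset.univ w) (N : ℕ) :
    ∀ a, a + N < n → ∀ k l, (D.faceCount p (seg n a (a + N)) k l : ℚ) = fEntryA N k l := by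
  induction N using Nat.strong_induction_on with
  | _ N ih =>
    intro a ha
    have hsucc (k l : ℕ) :
        (D.faceCount p (seg n a (a + N)) k (l + 1) : ℚ) = fEntryA N k (l + 1) := by
      rw [hD.faceCount_succ]
      rcases N with _ | N
      · have : seg n a (a + 0) = ∅ := by
          rw [← Finset.card_eq_zero, card_seg (by omega)]
          omega
        rw [this]
        simp [fEntryA, Nat.choose_eq_zero_of_lt (show 0 < k + (l + 1) by omega)]
      · rw [fEntryA_succ_succ, ← sum_seg (a := a) ha.le fun x y => ∑ q ∈ antidiagonal k,
          fEntryA x q.1 0 * fEntryA y q.2 l]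
        push_cast
        refine Finset.sum_congr rfl fun i hi => Finset.sum_congr rfl fun q _ => ?_
        rw [mem_seg] at hi
        rw [← ih (i - a) (by omega) a (by omega), ← ih (a + N - i) (by omega) (i + 1) (by omega),
          show a + (i.val - a) = i.val by omega,
          show i.val + 1 + (a + N - i.val) = a + (N + 1) by omega]
    rintro k (_ | l)
    · rcases k with _ | m
      · rw [D.faceCount_zero_zero]
        simp [fEntryA]
      -- The recursion says nothing about faces of positive roots only; these are recovered from the
      -- Coxeter number relation with h = N+1.
      · refine eq_of_sum_antidiagonal (g := fun k l => (D.faceCount p (seg n a (a + N)) k l : ℚ))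
          ?_ (sum_fEntryA_eq_zero N m) hsucc
        have hcard := hD.mul_le_card_rootsIn_of_lt (a := a) (b := a + N) (by omega) ha
        rw [Nat.add_sub_cancel_left] at hcard
        have := D.sum_antidiagonal_faceCount hp (hw.filter (seg n a (a + N))) (h := N + 1)
          (by omega) (fun v hv => by
            have := hD.iterate_cox_eq_of_lt (by omega) ha (hw.filter (seg n a (a + N))) hv
            rwa [Nat.add_sub_cancel_left] at this)
          (by rwa [card_seg (by omega), Nat.add_sub_cancel_left]) (m + 1)
        push_cast at this ⊢
        exact this
    · exact hsucc k l

/-- The face numbers of the cluster complex of type `B_N`. -/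
theorem faceCount_eq_fEntryB (hp : Function.Injective p) (hw : IsWord p Finset.univ w) (N : ℕ) :
    ∀ a, a + N = n → ∀ k l, (D.faceCount p (seg n a n) k l : ℚ) = fEntryB N k l := by
  induction N using Nat.strong_induction_on with
  | _ N ih =>
    intro a ha
    have hsucc (k l : ℕ) :
        (D.faceCount p (seg n a n) k (l + 1) : ℚ) = fEntryB N k (l + 1) := by
      rw [hD.faceCount_succ]
      rcases N with _ | N
      · have : seg n a n = ∅ := by
          rw [← Finset.card_eq_zero, card_seg (by omega)]
          omega
        rw [this]
        simp [fEntryB, Nat.choose_eq_zero_of_lt (show 0 < k + (l + 1) by omega)]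
      · have e : seg n a n = seg n a (a + (N + 1)) := by rw [ha]
        rw [fEntryB_succ_succ, ← sum_seg (a := a) ha.le fun x y => ∑ q ∈ antidiagonal k,
          fEntryA x q.1 0 * fEntryB y q.2 l, ← e]
        push_cast
        refine Finset.sum_congr rfl fun i hi => Finset.sum_congr rfl fun q _ => ?_
        rw [mem_seg] at hi
        rw [← hD.faceCount_eq_fEntryA hp hw (i - a) a (by omega),
          ← ih (a + N - i) (by omega) (i + 1) (by omega),
          show a + (i.val - a) = i.val by omega]
    rintro k (_ | l)
    · rcases k with _ | m
      · rw [D.faceCount_zero_zero]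
        simp [fEntryB]
      -- Rank zero is separate, since the averaging argument needs h = 2N to be positive.
      · rcases N with _ | N
        · have : seg n a n = ∅ := by
            rw [← Finset.card_eq_zero, card_seg (by omega)]
            omega
          rw [this, D.faceCount_empty_succ]
          simp [fEntryB]
        refine eq_of_sum_antidiagonal (g := fun k l => (D.faceCount p (seg n a n) k l : ℚ))
          ?_ (sum_fEntryB_eq_zero (N + 1) m) hsucc
        have hcard := hD.mul_le_card_rootsIn_of_eq a
        have hn : n - a = N + 1 := by omega
        rw [hn] at hcard
        have := D.sum_antidiagonal_faceCount hp (hw.filter (seg n a n)) (h := 2 * (N + 1))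
          (by omega) (fun v hv => by
            have := hD.iterate_cox_eq_of_eq (by omega) (hw.filter (seg n a n)) hv
            rwa [hn] at this)
          (by rwa [card_seg le_rfl, hn]) (m + 1)
        push_cast at this ⊢
        exact this
    · exact hsucc k l

end IsTypeB

end CoordRoots

end

noncomputable section

/-! ### Coordinates of the roots of a root pairing -/

namespace RootPairing.Base

open CoordRoots (simple)

variable {ι K M N : Type*} [Field K] [CharZero K] [AddCommGroup M] [Module K M]
  [AddCommGroup N] [Module K N] {P : RootPairing ι K M N} (b : P.Base)
  {S : Type*} [Fintype S] [DecidableEq S] (e : S ≃ b.support)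

/-- The coordinates of a root with respect to the simple roots, numbered by `e`. -/
def coords (β : ι) (i : S) : ℤ := b.simpleCoeff β (e i)

omit [DecidableEq S] in
lemma root_eq_sum_coords (β : ι) : P.root β = ∑ i, b.coords e β i • P.root (e i) := by
  have h := congrArg Subtype.val (b.toWeightBasisInt.sum_repr (P.rootSpanMem ℤ β))
  rw [← e.sum_comp] at h
  simpa [coords, simpleCoeff] using h.symm

omit [DecidableEq S] in
lemma coords_eq {β : ι} {f : S → ℤ} (h : P.root β = ∑ i, f i • P.root (e i)) :
    b.coords e β = f := by
  have h' : P.rootSpanMem ℤ β = ∑ s, f (e.symm s) • b.toWeightBasisInt s := by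
    ext
    change P.root β = _
    rw [h, ← e.sum_comp]
    simp
  ext i
  rw [coords, simpleCoeff, h', Module.Basis.repr_sum_self, Equiv.symm_apply_apply]

omit [DecidableEq S] in
lemma coords_injective : Function.Injective (b.coords e) := fun β β' h => by
  apply P.root.injective
  rw [b.root_eq_sum_coords e β, h, ← b.root_eq_sum_coords e β']

lemma coords_simple (i : S) : b.coords e (e i) = simple i :=
  b.coords_eq e (by simp [Pi.single_apply, ite_smul])

omit [DecidableEq S] in
lemma coords_reflectionPerm_self (β : ι) :
    b.coords e (P.reflectionPerm β β) = -b.coords e β := by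
  apply b.coords_eq e
  rw [root_reflectionPerm, reflection_apply_self, b.root_eq_sum_coords e β]
  simp

lemma reflectionPerm_self_eq_iff (β : ι) (i : S) :
    P.reflectionPerm β β = e i ↔ b.coords e β = -simple i := by
  rw [← (b.coords_injective e).eq_iff, coords_reflectionPerm_self, coords_simple, neg_eq_iff_eq_neg]

lemma isNegSimple_iff (β : ι) : b.IsNegSimple β ↔ ∃ i, b.coords e β = -simple i := by
  simp only [← b.reflectionPerm_self_eq_iff e]
  constructor
  · exact fun h => ⟨e.symm ⟨_, h⟩, by simp⟩
  · rintro ⟨i, h⟩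
    rw [IsNegSimple, h]
    exact (e i).2

omit [DecidableEq S] in
lemma pos_or_neg_coords (β : ι) :
    (b.IsPos β ∧ 0 ≤ b.coords e β) ∨ (¬ b.IsPos β ∧ b.coords e β ≤ 0) := by
  obtain ⟨f, -, hf, h⟩ := b.exists_root_eq_sum_int β
  have hc : b.coords e β = fun i => f (e i) := by
    apply b.coords_eq e
    rw [h, ← Finset.sum_coe_sort, ← e.sum_comp]
  have hh : b.height β = ∑ i, f (e i) := by
    rw [b.height_eq_sum h, ← Finset.sum_coe_sort, ← e.sum_comp]
  rcases hf with hf | hf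
  · refine Or.inl ⟨?_, ?_⟩
    · rw [isPos_iff', hh]
      exact Finset.sum_nonneg fun i _ => hf.le _
    · rw [hc]
      exact fun i => hf.le _
  · refine Or.inr ⟨?_, ?_⟩
    · rw [isPos_iff, hh, not_lt]
      exact Finset.sum_nonpos fun i _ => hf.le _
    · rw [hc]
      exact fun i => hf.le _

omit [DecidableEq S] in
lemma coords_ne_zero (β : ι) : b.coords e β ≠ 0 := fun h => by
  have := b.root_eq_sum_coords e β
  rw [h] at this
  exact P.ne_zero β (by simpa using this)

omit [DecidableEq S] in
lemma isPos_iff_coords (β : ι) : b.IsPos β ↔ 0 ≤ b.coords e β := by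
  rcases b.pos_or_neg_coords e β with ⟨h, h'⟩ | ⟨h, h'⟩
  · exact iff_of_true h h'
  · exact iff_of_false h fun h'' => b.coords_ne_zero e β (le_antisymm h' h'')

lemma coords_reflectionPerm [P.IsCrystallographic] (i : S) (β : ι) :
    b.coords e (P.reflectionPerm (e i) β) = b.coords e β -
      (∑ j, b.coords e β j * b.cartanMatrix (e j) (e i)) • simple i := by
  have hp : P.pairing β (e i) = ∑ j, b.coords e β j * P.pairing (e j) (e i) := by
    have := congrArg (P.coroot' (e i)) (b.root_eq_sum_coords e β)
    rw [map_sum] at this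
    simpa using this
  apply b.coords_eq e
  rw [root_reflectionPerm, reflection_apply_root, hp]
  simp only [Pi.sub_apply, sub_smul, Finset.sum_sub_distrib, ← b.root_eq_sum_coords e β]
  congr 1
  simp only [Pi.smul_apply, Pi.single_apply, smul_eq_mul, mul_ite, mul_one, mul_zero, ite_smul,
    zero_smul, Finset.sum_ite_eq', Finset.mem_univ, if_true]
  rw [← Int.cast_smul_eq_zsmul K]
  push_cast
  congr 2
  ext j
  rw [← b.algebraMap_cartanMatrixIn_apply ℤ (e j) (e i)]
  simp

variable [Finite ι] [P.IsRootSystem] [P.IsCrystallographic]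

/-- The symmetrised Cartan matrix is positive definite, which yields both symmetry and anisotropy.
-/
lemma exists_simpleLength : ∃ d : b.support → ℤ, (∀ s, 0 < d s) ∧
    (∀ s t, b.cartanMatrix s t * d t = b.cartanMatrix t s * d s) ∧
    ∀ v : b.support → ℤ, ∑ s, ∑ t, v s * (b.cartanMatrix s t * d t) * v t = 0 → v = 0 := by
  classical
  obtain ⟨d, hd, hd'⟩ := b.exists_cartanMatrix_mul_diagaonal_posDef
  refine ⟨d, hd, fun s t => ?_, fun v hv => ?_⟩
  · have := hd'.isHermitian.apply s t
    simpa [Matrix.mul_diagonal] using this.symm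
  · by_contra hne
    refine (hd'.dotProduct_mulVec_pos hne).ne' ?_
    rw [← hv, dotProduct]
    refine Finset.sum_congr rfl fun s _ => ?_
    rw [Matrix.mulVec, dotProduct, Finset.mul_sum]
    refine Finset.sum_congr rfl fun t _ => ?_
    simp [Matrix.mul_diagonal, mul_assoc]

open Classical in
/-- The coordinates of the roots with respect to the simple roots. -/
def coordRoots : CoordRoots S :=
  have hd := b.exists_simpleLength.choose_spec
  have : Fintype ι := Fintype.ofFinite ι
  { roots := Finset.univ.image (b.coords e)
    cartan := fun j i => b.cartanMatrix (e j) (e i)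
    len := fun i => b.exists_simpleLength.choose (e i)
    len_pos := fun i => hd.1 (e i)
    len_symm := fun i j => hd.2.1 (e i) (e j)
    anisotropic := fun v hv => by
      have h := hd.2.2 (fun s => v (e.symm s)) (by
        refine Eq.trans ?_ hv
        rw [← e.sum_comp]
        refine Finset.sum_congr rfl fun i _ => ?_
        rw [← e.sum_comp]
        simp)
      ext i
      simpa using congrFun h (e i)
    cartan_self := fun i => b.cartanMatrix_apply_same (e i)
    ne_zero := fun v hv => by
      obtain ⟨β, -, rfl⟩ := Finset.mem_image.mp hv
      exact b.coords_ne_zero e β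
    single_mem := fun i => Finset.mem_image.mpr ⟨e i, Finset.mem_univ _, b.coords_simple e i⟩
    refl_mem := fun i v hv => by
      obtain ⟨β, -, rfl⟩ := Finset.mem_image.mp hv
      exact Finset.mem_image.mpr ⟨_, Finset.mem_univ _, b.coords_reflectionPerm e i β⟩
    neg_mem := fun v hv => by
      obtain ⟨β, -, rfl⟩ := Finset.mem_image.mp hv
      exact Finset.mem_image.mpr ⟨_, Finset.mem_univ _, b.coords_reflectionPerm_self e β⟩
    nonneg_or_nonpos := fun v hv => by
      obtain ⟨β, -, rfl⟩ := Finset.mem_image.mp hv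
      exact (b.pos_or_neg_coords e β).imp And.right And.right
    eq_or_eq_neg := fun i v hv h => by
      obtain ⟨β, -, rfl⟩ := Finset.mem_image.mp hv
      have hβ : P.root β = (b.coords e β i : K) • P.root (e i) := by
        rw [Int.cast_smul_eq_zsmul, b.root_eq_sum_coords e β]
        exact Finset.sum_eq_single i (fun j _ hj => by rw [h j hj, zero_smul]) (by simp)
      have _ : IsAddTorsionFree M := .of_isTorsionFree K M
      have _ : IsAddTorsionFree N := .of_isTorsionFree K N
      have hi : b.coords e β = b.coords e β i • simple i := by
        ext j
        by_cases hj : j = i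
        · subst hj
          simp
        · simp [hj, h j hj]
      rw [hi]
      rcases b.eq_one_or_neg_one_of_mem_support_of_smul_mem (e i) (e i).2 _ ⟨β, hβ⟩ with h | h
      · left
        rw [show b.coords e β i = 1 by exact_mod_cast h, one_smul]
      · right
        rw [show b.coords e β i = -1 by exact_mod_cast h, neg_one_smul] }

/-! ### Transfer of the reflections, compatibility and faces to coordinates. -/

lemma mem_roots_coordRoots {v : S → ℤ} :
    v ∈ (b.coordRoots e).roots ↔ ∃ β, b.coords e β = v := by
  simp [coordRoots]

lemma coords_mem_roots (β : ι) : b.coords e β ∈ (b.coordRoots e).roots :=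
  (b.mem_roots_coordRoots e).mpr ⟨β, rfl⟩

lemma refl_coords (i : S) (β : ι) :
    (b.coordRoots e).refl i (b.coords e β) = b.coords e (P.reflectionPerm (e i) β) := by
  rw [coords_reflectionPerm]
  rfl

lemma coords_mem_almostPos (β : ι) :
    b.coords e β ∈ (b.coordRoots e).almostPos Finset.univ ↔ b.IsAlmostPos β := by
  rw [CoordRoots.mem_almostPos, IsAlmostPos, b.isPos_iff_coords e, b.isNegSimple_iff e]
  exact ⟨fun h => h.2.2, fun h => ⟨b.coords_mem_roots e β,
    fun j hj => absurd (Finset.mem_univ j) hj, h⟩⟩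

lemma coords_plReflection (i : S) (β : ι) :
    b.coords e (b.plReflection (e i) β) = (b.coordRoots e).plRefl i (b.coords e β) := by
  have : (b.IsNegSimple β ∧ P.reflectionPerm β β ≠ e i) ↔
      ∃ j, j ≠ i ∧ b.coords e β = -simple j := by
    constructor
    · rintro ⟨h1, h2⟩
      obtain ⟨j, hj⟩ := (b.isNegSimple_iff e β).mp h1
      refine ⟨j, ?_, hj⟩
      rintro rfl
      exact h2 ((b.reflectionPerm_self_eq_iff e β j).mpr hj)
    · rintro ⟨j, hj, h⟩
      refine ⟨(b.isNegSimple_iff e β).mpr ⟨j, h⟩, ?_⟩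
      rw [(b.reflectionPerm_self_eq_iff e β j).mpr h, Ne, Subtype.val_inj, e.injective.eq_iff]
      exact hj
  rw [plReflection, CoordRoots.plRefl]
  by_cases h : b.IsNegSimple β ∧ P.reflectionPerm β β ≠ e i
  · rw [if_pos h, if_pos (this.mp h)]
  · rw [if_neg h, if_neg fun h' => h (this.mpr h'), refl_coords]

lemma coords_deformedCoxeter (w : List S) (β : ι) :
    b.coords e (b.deformedCoxeter (w.map fun i => (e i : ι)) β) =
      (b.coordRoots e).plCox w (b.coords e β) := by
  induction w generalizing β with
  | nil => rfl
  | cons i w ih =>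
    rw [CoordRoots.plCox, ← coords_plReflection, ← ih]
    rfl

lemma coords_iterate_deformedCoxeter (w : List S) (m : ℕ) (β : ι) :
    b.coords e ((b.deformedCoxeter (w.map fun i => (e i : ι)))^[m] β) =
      ((b.coordRoots e).plCox w)^[m] (b.coords e β) := by
  induction m generalizing β with
  | zero => rfl
  | succ m ih => rw [Function.iterate_succ_apply, Function.iterate_succ_apply, ih,
      coords_deformedCoxeter]

/-- Compatibility is defined by iterating τ, and coordinates intertwine the two versions of τ, so
the criterion `rel_iff_forall_iterate` applies. -/
lemma compatible_iff {p : S → ℕ} (hp : Function.Injective p) {w : List S}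
    (hw : CoordRoots.IsWord p Finset.univ w) {α β : ι} (hα : b.IsAlmostPos α)
    (hβ : b.IsAlmostPos β) : b.Compatible (w.map fun i => (e i : ι)) α β ↔
      (b.coordRoots e).Rel p (b.coords e α) (b.coords e β) := by
  rw [CoordRoots.rel_iff_forall_iterate _ hp hw ((b.coords_mem_almostPos e α).mpr hα)
    ((b.coords_mem_almostPos e β).mpr hβ), Compatible]
  refine forall_congr' fun m => e.symm.forall_congr fun {s} => ?_
  obtain ⟨i, rfl⟩ := e.surjective s
  rw [Equiv.symm_apply_apply, ← coords_iterate_deformedCoxeter, ← coords_iterate_deformedCoxeter,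
    ← b.reflectionPerm_self_eq_iff e, ← P.root.injective.eq_iff, root_reflectionPerm,
    reflection_apply_self, neg_eq_iff_eq_neg]
  rfl

omit [CharZero K] [Finite ι] [P.IsRootSystem] [P.IsCrystallographic] in
lemma reflectionPerm_self_reflectionPerm_self (β : ι) :
    P.reflectionPerm (P.reflectionPerm β β) (P.reflectionPerm β β) = β := by
  apply P.root.injective
  rw [root_reflectionPerm, reflection_apply_self, root_reflectionPerm, reflection_apply_self,
    neg_neg]

variable [DecidableEq ι]

omit [CharZero K] [Finite ι] [P.IsRootSystem] [P.IsCrystallographic] in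
lemma mem_negSimples {β : ι} : β ∈ b.negSimples ↔ b.IsNegSimple β := by
  rw [negSimples, Finset.mem_image, IsNegSimple]
  constructor
  · rintro ⟨s, hs, rfl⟩
    rwa [reflectionPerm_self_reflectionPerm_self]
  · intro h
    exact ⟨_, h, reflectionPerm_self_reflectionPerm_self β⟩

omit [CharZero K] [DecidableEq S] [Finite ι] [P.IsRootSystem] [P.IsCrystallographic] in
include e in
lemma card_negSimples : b.negSimples.card = Fintype.card S := by
  rw [negSimples, Finset.card_image_of_injective, Fintype.card_congr e, Fintype.card_coe]
  intro s t h
  beta_reduce at h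
  rw [← reflectionPerm_self_reflectionPerm_self (P := P) s, h,
    reflectionPerm_self_reflectionPerm_self]

omit [Finite ι] [P.IsRootSystem] [P.IsCrystallographic] in
lemma posCard_map {c : List ι} {f : Finset ι} (hf : f ∈ b.clusterComplex c) :
    CoordRoots.posCard (f.map ⟨b.coords e, b.coords_injective e⟩) = (f \ b.negSimples).card := by
  classical
  rw [CoordRoots.posCard, Finset.filter_map, Finset.card_map]
  congr 1
  ext β
  rw [Finset.mem_filter, Finset.mem_sdiff, mem_negSimples]
  refine and_congr_right fun hβ => ?_
  simp only [Function.comp_apply, Function.Embedding.coeFn_mk]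
  rcases hf.1 β hβ with h | h
  · rw [b.isPos_iff_coords e] at h
    refine iff_of_true h fun h' => ?_
    obtain ⟨i, hi⟩ := (b.isNegSimple_iff e β).mp h'
    exact CoordRoots.ne_neg_simple h i hi
  · refine iff_of_false (fun h0 => ?_) (not_not.mpr h)
    obtain ⟨i, hi⟩ := (b.isNegSimple_iff e β).mp h
    exact CoordRoots.ne_neg_simple h0 i hi

omit [Finite ι] [P.IsRootSystem] [P.IsCrystallographic] in
lemma negCard_map {c : List ι} {f : Finset ι} (hf : f ∈ b.clusterComplex c) :
    CoordRoots.negCard (f.map ⟨b.coords e, b.coords_injective e⟩) = (f ∩ b.negSimples).card := by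
  have h1 := CoordRoots.posCard_add_negCard (f.map ⟨b.coords e, b.coords_injective e⟩)
  rw [b.posCard_map e hf, Finset.card_map] at h1
  have := Finset.card_sdiff_add_card_inter f b.negSimples
  omega

omit [DecidableEq ι] in
lemma map_mem_faces_iff {p : S → ℕ} (hp : Function.Injective p) {w : List S}
    (hw : CoordRoots.IsWord p Finset.univ w) {f : Finset ι} :
    f.map ⟨b.coords e, b.coords_injective e⟩ ∈ (b.coordRoots e).faces p Finset.univ ↔
      f ∈ b.clusterComplex (w.map fun i => (e i : ι)) := by
  have h1 : f.map ⟨b.coords e, b.coords_injective e⟩ ⊆ (b.coordRoots e).almostPos Finset.univ ↔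
      ∀ β ∈ f, b.IsAlmostPos β := by
    simp [Finset.subset_iff, coords_mem_almostPos]
  rw [CoordRoots.mem_faces, h1]
  refine and_congr_right fun h => ?_
  simp only [Finset.forall_mem_map, Function.Embedding.coeFn_mk, (b.coords_injective e).ne_iff]
  refine forall₂_congr fun α hα => forall₂_congr fun β hβ => imp_congr_right fun _ => ?_
  exact (b.compatible_iff e hp hw (h α hα) (h β hβ)).symm

lemma fTriangle_clusterComplex {p : S → ℕ} (hp : Function.Injective p) {w : List S}
    (hw : CoordRoots.IsWord p Finset.univ w) (i j : ℕ) :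
    fTriangle (b.clusterComplex (w.map fun i => (e i : ι))) b.negSimples i j =
      (b.coordRoots e).faceCount p Finset.univ i j := by
  classical
  rw [fTriangle, CoordRoots.faceCount, ← Set.ncard_coe_finset, ← Set.ncard_image_of_injective _
    (Finset.map_injective ⟨b.coords e, b.coords_injective e⟩)]
  congr 1
  ext g
  simp only [Set.mem_image, Finset.coe_filter]
  constructor
  · rintro ⟨f, ⟨h1, h2, h3⟩, rfl⟩
    exact ⟨(b.map_mem_faces_iff e hp hw).mpr h1, by rw [b.posCard_map e h1, h2],
      by rw [b.negCard_map e h1, h3]⟩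
  · rintro ⟨h1, h2, h3⟩
    have _ : Fintype ι := Fintype.ofFinite ι
    have hg : g ⊆ Finset.univ.map ⟨b.coords e, b.coords_injective e⟩ := fun v hv => by
      obtain ⟨β, rfl⟩ := (b.mem_roots_coordRoots e).mp
        (((b.coordRoots e).mem_almostPos.mp (((b.coordRoots e).mem_faces.mp h1).1 hv)).1)
      simp
    obtain ⟨f, -, rfl⟩ := Finset.subset_map_iff.mp hg
    rw [b.map_mem_faces_iff e hp hw] at h1
    exact ⟨f, ⟨h1, by rw [← b.posCard_map e h1, h2], by rw [← b.negCard_map e h1, h3]⟩, rfl⟩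

omit [DecidableEq ι] in
lemma isTypeB_coordRoots [P.IsReduced] {n : ℕ} (e : Fin n ≃ b.support)
    (he : ∀ i j, b.cartanMatrix (e i) (e j) = CartanMatrix.B n i j) :
    (b.coordRoots e).IsTypeB := by
  refine ⟨he, fun Q h1 h2 h3 v hv => ?_⟩
  obtain ⟨β, rfl⟩ := (b.mem_roots_coordRoots e).mp hv
  refine b.induction_reflect β (p := fun β => Q (b.coords e β)) ?_ ?_ ?_
  · intro β h
    rw [coords_reflectionPerm_self]
    exact h3 _ h
  · intro s hs
    obtain ⟨i, hi⟩ := e.surjective ⟨s, hs⟩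
    have : s = e i := by rw [hi]
    rw [this, coords_simple]
    exact h1 i
  · intro β s h hs
    obtain ⟨i, hi⟩ := e.surjective ⟨s, hs⟩
    have : s = e i := by rw [hi]
    rw [this, ← refl_coords]
    exact h2 i _ h

omit [Fintype S] in
lemma _root_.List.Nodup.pairwise_idxOf {w : List S} (hw : w.Nodup) :
    w.Pairwise fun i j => w.idxOf i < w.idxOf j := by
  rw [List.pairwise_iff_getElem]
  intro i j hi hj hij
  rwa [hw.idxOf_getElem, hw.idxOf_getElem]

/-- The `F`-triangle of the cluster complex of type `B`. -/
theorem fTriangle_clusterComplex_of_isTypeB [P.IsReduced] {n : ℕ} (hb : b.IsTypeB n) {c : List ι}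
    (hc : b.IsCoxeterWord c) : b.negSimples.card = n ∧ ∀ i j,
      fTriangle (b.clusterComplex c) b.negSimples i j =
        n.choose (i + j) * (n + i - 1).choose i := by
  obtain ⟨e, he⟩ := hb
  refine ⟨by rw [b.card_negSimples e, Fintype.card_fin], fun i j => ?_⟩
  obtain ⟨w, rfl⟩ : ∃ w : List (Fin n), w.map (fun i => (e i : ι)) = c := by
    have : c ∈ Set.range (List.map fun i => (e i : ι)) := by
      rw [Set.range_list_map]
      intro s hs
      obtain ⟨i, hi⟩ := e.surjective ⟨s, (hc.2 s).mp hs⟩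
      exact ⟨i, by simp [hi]⟩
    exact this
  have hinj : Function.Injective fun i => (e i : ι) := Subtype.val_injective.comp e.injective
  have hmem (i : Fin n) : i ∈ w := by
    have := (hc.2 (e i)).mpr (e i).2
    rwa [List.mem_map_of_injective hinj] at this
  have hnd : w.Nodup := hc.1.of_map _
  -- The rank of a simple root is its position in the Coxeter word; this choice attaches the Euler
  -- form to c.
  have hw : CoordRoots.IsWord (fun i => w.idxOf i) Finset.univ w :=
    ⟨hnd.pairwise_idxOf, fun i => by simp [hmem]⟩
  have hp : Function.Injective fun i => w.idxOf i := fun i j h => (List.idxOf_inj (hmem i)).mp h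
  have hD := b.isTypeB_coordRoots e he
  have hs : CoordRoots.seg n 0 n = Finset.univ := by
    ext i
    simp [CoordRoots.mem_seg]
  have := hD.faceCount_eq_fEntryB hp hw n 0 (zero_add n) i j
  rw [hs, fEntryB] at this
  rw [b.fTriangle_clusterComplex e hp hw]
  exact_mod_cast this

end RootPairing.Base

end
theorem mainTheorem3 :
    (∀ {ι K M N : Type*} [Finite ι] [DecidableEq ι] [Field K] [CharZero K]
        [AddCommGroup M] [Module K M] [AddCommGroup N] [Module K N]
        (P : RootPairing ι K M N) [P.IsRootSystem] [P.IsCrystallographic] [P.IsReduced]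
        (b : P.Base) (n : ℕ) (_ : b.IsTypeB n) (c : List ι) (_ : b.IsCoxeterWord c),
      (∃! γ : ℕ → ℕ → ℤ, IsGammaTriangle (b.clusterComplex c) b.negSimples γ) ∧
      ∀ γ : ℕ → ℕ → ℤ, IsGammaTriangle (b.clusterComplex c) b.negSimples γ →
        ∀ k l : ℕ, l + 2 * k ≤ n → γ k l = n.choose k * choosePred (n - k - l) k) ∧
    bigSeriesB = smallSeriesB +
      PowerSeries.C (Y : ℚ[X][Y]) * PowerSeries.X * smallSeriesA * bigSeriesB ∧
    bigSeriesB = smallSeriesB +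
      PowerSeries.C (Y : ℚ[X][Y]) * PowerSeries.X * smallSeriesB * bigSeriesA := by
  refine ⟨?_, bigSeriesB_eq_small_add_smallA_mul, bigSeriesB_eq_small_add_smallB_mul⟩
  intro ι K M N _ _ _ _ _ _ _ _ P _ _ _ b n hb c hc
  obtain ⟨hT, hF⟩ := b.fTriangle_clusterComplex_of_isTypeB hb hc
  have h := gammaTriangle_of_fTriangle (Δ := b.clusterComplex c) (T := b.negSimples)
    (by rwa [hT])
  rw [hT] at h
  exact h
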